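/- Let $F2 \mid G=(V,E),\, p_{ij}=1 \mid C_{\max}$ be the following problem. Given $n$ jobs $V$ and a simple conflict graph $G=(V,E)$, each job needs one unit of processing on machine $M_1$ and afterwards one unit of processing on machine $M_2$; each machine processes at most one job at a time, without preemption; and two jobs that are adjacent in $G$ must not be processed concurrently on the two machines. All processing starts at time $0$ or later (starting times may be any real numbers), and the makespan $C_{\max}$, the largest completion time of a job, is to be minimized. Let $m=|\overline E|$ be the number of edges of the agreement graph $\overline G=(V,\overline E)$, the complement of $G$, and let the instance be given by $n$ and a list of the edges of $\overline G$. Theorem. This problem has a $4/3$-approximation algorithm that runs in $O(n+m^2\log n)$ time (hence in $O(m^2\log n)$ time on instances with $n = O(m^2\log n)$, in particular whenever $\overline G$ has an edge and no isolated vertices). That is, there are a program for the unit-cost RAM with words of $O(\log n)$ bits and a constant $c$ such that, for every instance, the program halts after at most $c\,(m^2\lfloor\log_2 n\rfloor+n+1)$ steps (where $\log_2 0$ is read as $0$) and outputs the starting times of a feasible schedule whose makespan is at most $\frac43$ times the makespan of every feasible schedule. -/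

import Mathlib

/-! ## A word RAM

Programs are structured (assignments, sequencing, conditionals, loops) and work on finitely many
scalar variables and finitely many arrays, each named by a natural number that is fixed in the
program text. Every constant, variable access, array access, arithmetic operation, comparison,
assignment and test costs one unit of time. All computed values have to be smaller than a
bound `W` (words of `log W` bits); a program that exceeds it has no execution. -/

namespace WordRAM

/-- Binary operations on words. -/
inductive Op where
  | add | sub | mul | div | lt | eq

/-- The value of a binary operation: truncated subtraction, division rounding down,
comparisons with value `0` or `1`. -/
def Op.apply : Op → ℕ → ℕ → ℕ
  | .add, a, b => a + b
  | .sub, a, b => a - b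
  | .mul, a, b => a * b
  | .div, a, b => a / b
  | .lt, a, b => if a < b then 1 else 0
  | .eq, a, b => if a = b then 1 else 0

/-- Expressions: a constant, a variable, an array entry, a binary operation. -/
inductive Expr where
  | const (k : ℕ)
  | var (x : ℕ)
  | get (a : ℕ) (i : Expr)
  | bin (o : Op) (e f : Expr)

/-- The memory: scalar variables and arrays. -/
structure State where
  var : ℕ → ℕ
  arr : ℕ → ℕ → ℕ

/-- `v` as a machine word, undefined if it does not fit. -/
def word (W v : ℕ) : Option ℕ := if v < W then some v else none

/-- The value of an expression, undefined if some intermediate value does not fit in a word. -/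
def Expr.eval (W : ℕ) (s : State) : Expr → Option ℕ
  | .const k => word W k
  | .var x => word W (s.var x)
  | .get a i => (i.eval W s).bind fun j => word W (s.arr a j)
  | .bin o e f => (e.eval W s).bind fun u => (f.eval W s).bind fun v => word W (o.apply u v)

/-- The time for evaluating an expression: its number of constants, variables, array accesses
and operations. -/
def Expr.cost : Expr → ℕ
  | .const _ => 1
  | .var _ => 1
  | .get _ i => i.cost + 1
  | .bin _ e f => e.cost + f.cost + 1

/-- Assignment to the variable `x`. -/
def State.setVar (s : State) (x v : ℕ) : State :=
  { s with var := Function.update s.var x v }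

/-- Assignment to the entry `i` of the array `a`. -/
def State.setArr (s : State) (a i v : ℕ) : State :=
  { s with arr := Function.update s.arr a (Function.update (s.arr a) i v) }

/-- Programs. A test `e` counts as true if its value is not `0`. -/
inductive Cmd where
  | nop
  | assign (x : ℕ) (e : Expr)
  | put (a : ℕ) (i e : Expr)
  | seq (p q : Cmd)
  | cond (e : Expr) (p q : Cmd)
  | loop (e : Expr) (p : Cmd)

/-- `Exec W p s t s'`: with words below `W`, the program `p` started in the memory `s` halts after
exactly `t` units of time, in the memory `s'`. -/
inductive Exec (W : ℕ) : Cmd → State → ℕ → State → Prop where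
  | nop (s : State) : Exec W .nop s 1 s
  | assign {s : State} {x : ℕ} {e : Expr} {v : ℕ} (he : e.eval W s = some v) :
      Exec W (.assign x e) s (e.cost + 1) (s.setVar x v)
  | put {s : State} {a : ℕ} {i e : Expr} {j v : ℕ}
      (hi : i.eval W s = some j) (he : e.eval W s = some v) :
      Exec W (.put a i e) s (i.cost + e.cost + 1) (s.setArr a j v)
  | seq {s s' s'' : State} {p q : Cmd} {t t' : ℕ}
      (hp : Exec W p s t s') (hq : Exec W q s' t' s'') :
      Exec W (.seq p q) s (t + t') s''
  | condTrue {s s' : State} {e : Expr} {p q : Cmd} {v t : ℕ}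
      (he : e.eval W s = some v) (hv : v ≠ 0) (hp : Exec W p s t s') :
      Exec W (.cond e p q) s (e.cost + 1 + t) s'
  | condFalse {s s' : State} {e : Expr} {p q : Cmd} {t : ℕ}
      (he : e.eval W s = some 0) (hq : Exec W q s t s') :
      Exec W (.cond e p q) s (e.cost + 1 + t) s'
  | loopTrue {s s' s'' : State} {e : Expr} {p : Cmd} {v t t' : ℕ}
      (he : e.eval W s = some v) (hv : v ≠ 0) (hp : Exec W p s t s')
      (hl : Exec W (.loop e p) s' t' s'') :
      Exec W (.loop e p) s (e.cost + 1 + t + t') s''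
  | loopFalse {s : State} {e : Expr} {p : Cmd} (he : e.eval W s = some 0) :
      Exec W (.loop e p) s (e.cost + 1) s

end WordRAM

/-! ## Two-machine flow-shop with unit jobs and a conflict graph -/

namespace FlowShop

/-- A nonpreemptive schedule on two machines: the starting times of each job on the first and on
the second machine. -/
structure Schedule (V : Type*) where
  fst : V → ℝ
  snd : V → ℝ

/-- The time interval in which a unit operation started at time `x` occupies its machine. -/
def busy (x : ℝ) : Set ℝ := Set.Ico x (x + 1)

/-- Feasibility for the conflict graph `G`: no operation starts before time `0`, each machine
processes at most one job at a time, each job is finished on the first machine before it starts on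
the second one, and two conflicting jobs are never processed concurrently on the two machines. -/
structure Schedule.Feasible {V : Type*} (σ : Schedule V) (G : SimpleGraph V) : Prop where
  fst_nonneg : ∀ j, 0 ≤ σ.fst j
  snd_nonneg : ∀ j, 0 ≤ σ.snd j
  fst_disjoint : ∀ j k, j ≠ k → Disjoint (busy (σ.fst j)) (busy (σ.fst k))
  snd_disjoint : ∀ j k, j ≠ k → Disjoint (busy (σ.snd j)) (busy (σ.snd k))
  flow : ∀ j, σ.fst j + 1 ≤ σ.snd j
  conflict : ∀ j k, G.Adj j k → Disjoint (busy (σ.fst j)) (busy (σ.snd k))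

/-- The makespan: the maximum completion time of a job (`0` if there are no jobs). -/
noncomputable def Schedule.makespan {V : Type*} (σ : Schedule V) : ℝ := ⨆ j, (σ.snd j + 1)

/-- `l` lists every edge of `H` exactly once, in some order and orientation. -/
def ListsEdges {V : Type*} (H : SimpleGraph V) (l : List (V × V)) : Prop :=
  (l.map fun p => s(p.1, p.2)).Nodup ∧ ∀ e : Sym2 V, e ∈ (l.map fun p => s(p.1, p.2)) ↔ e ∈ H.edgeSet

/-- The memory that holds a graph on the vertices `0, …, n - 1` given by a list of edges:
variable `0` holds `n`, variable `1` the number of edges, and the entries `i` of the arrays `0`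
and `1` hold the two ends of the edge number `i`. Everything else is `0`. -/
def inputState {n : ℕ} (l : List (Fin n × Fin n)) : WordRAM.State where
  var := fun x => if x = 0 then n else if x = 1 then l.length else 0
  arr := fun a i =>
    if a = 0 then (l.map fun p => (p.1 : ℕ)).getD i 0
    else if a = 1 then (l.map fun p => (p.2 : ℕ)).getD i 0
    else 0

/-- The schedule that a memory holds: the entries `j` of the arrays `2` and `3` are the starting
times of the job `j` on the first and on the second machine. -/
def outputSchedule (n : ℕ) (s : WordRAM.State) : Schedule (Fin n) where
  fst := fun j => (s.arr 2 j : ℝ)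
  snd := fun j => (s.arr 3 j : ℝ)

end FlowShop

/-! ### Running times of programs -/

/-! Lower bound. Unit intervals whose starting times have the same integer part overlap. So in a
feasible schedule the pairs of jobs that share a slot on the two machines, after rounding down, are
edges of the agreement graph. As a directed graph these pairs have in- and outdegrees at most one
and no 2-cycles, so they form a simple 2-matching with `d ≤ n` edges. Counting the slots used by
each machine shows that the makespan is at least `2n - d` (`Schedule.Feasible.exists_twoMatching`).

Upper bound. A packing of disjoint paths with `p` edges in the agreement graph is processed path by
path. Each edge lets the next job start one unit later instead of two, so the makespan is at most
`2n - p` (`feasible_of_sequence`, `startTime_add`). If `2d ≤ 3p`, then `2n - p ≤ 2n - 2d/3 ≤ 4/3 (2n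
- d)`, where the last inequality is `d ≤ n`.

The packing comes from local search with three kinds of exchange: joining two paths by an edge
between ends; replacing a path edge by two edges from its ends to ends of other paths; replacing a
path edge by an edge that turns one of the two parts around and an edge to the end of another path.
When no exchange is left, a charging argument gives `2d ≤ 3p` (`two_thirds_of_stuck`): every vertex
of packing degree `g < 2` sends `2 - g` units along each of its edges in the 2-matching, and every
edge of the packing receives at most two units in all.

Running time. The paths are intervals of a permutation of the jobs, separated by zero link flags.
Reversing segments made of whole paths brings two path ends side by side (`runs_linkCmd`). Jobs with
neighbours come first and there are `N ≤ 2m` of them, so an exchange costs `O(m)`. A search also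
costs `O(m)`, because at most two outside path ends have to be remembered per job (`Marks`). Each
exchange adds an edge and there are at most `N` edges, so the total is `O(n + m²)`; the logarithm is
needed only as a factor that is at least one. -/

namespace WordRAM

/-- Every memory cell holds a word. -/
structure Small (W : ℕ) (s : State) : Prop where
  var_lt : ∀ x, s.var x < W
  arr_lt : ∀ a i, s.arr a i < W

instance : Add Expr := ⟨.bin .add⟩
instance : Sub Expr := ⟨.bin .sub⟩

/-- The value of an expression if words are unbounded. -/
def Expr.val (s : State) : Expr → ℕ
  | .const k => k
  | .var x => s.var x
  | .get a i => s.arr a (i.val s)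
  | .bin o e f => o.apply (e.val s) (f.val s)

/-- No constant, sum or product in the expression overflows. -/
def Expr.Fits (W : ℕ) (s : State) : Expr → Prop
  | .const k => k < W
  | .var _ => True
  | .get _ i => i.Fits W s
  | .bin .add e f => e.Fits W s ∧ f.Fits W s ∧ e.val s + f.val s < W
  | .bin .mul e f => e.Fits W s ∧ f.Fits W s ∧ e.val s * f.val s < W
  | .bin _ e f => e.Fits W s ∧ f.Fits W s

theorem word_of_lt {W v : ℕ} (h : v < W) : word W v = some v := by simp [word, h]

/-- Truncated subtraction and division do not exceed their first argument and comparisons are at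
most `1`. In a memory of words, overflow can therefore come only from constants, sums and products,
which are what `Expr.Fits` checks. -/
theorem Expr.eval_eq {W : ℕ} {s : State} (hs : Small W s) (hW : 1 < W) {e : Expr}
    (he : e.Fits W s) : e.eval W s = some (e.val s) ∧ e.val s < W := by
  induction e with
  | const k => exact ⟨word_of_lt he, he⟩
  | var x => exact ⟨word_of_lt (hs.var_lt x), hs.var_lt x⟩
  | get a i ih =>
    obtain ⟨h1, h2⟩ := ih he
    refine ⟨?_, hs.arr_lt _ _⟩
    simp only [Expr.eval, h1, Option.bind_some]
    exact word_of_lt (hs.arr_lt _ _)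
  | bin o e f ihe ihf =>
    have key : ∀ (h1 : e.Fits W s) (h2 : f.Fits W s)
        (h3 : o.apply (e.val s) (f.val s) < W),
        (Expr.bin o e f).eval W s = some ((Expr.bin o e f).val s) ∧
          (Expr.bin o e f).val s < W := by
      intro h1 h2 h3
      refine ⟨?_, h3⟩
      simp only [Expr.eval, (ihe h1).1, (ihf h2).1, Option.bind_some]
      exact word_of_lt h3
    cases o with
    | add => exact key he.1 he.2.1 he.2.2
    | mul => exact key he.1 he.2.1 he.2.2
    | sub =>
      exact key he.1 he.2 (lt_of_le_of_lt (Nat.sub_le _ _) (ihe he.1).2)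
    | div =>
      exact key he.1 he.2 (lt_of_le_of_lt (Nat.div_le_self _ _) (ihe he.1).2)
    | lt =>
      refine key he.1 he.2 ?_
      simp only [Op.apply]; split_ifs <;> omega
    | eq =>
      refine key he.1 he.2 ?_
      simp only [Op.apply]; split_ifs <;> omega

theorem Small.setVar {W : ℕ} {s : State} (hs : Small W s) {x v : ℕ} (hv : v < W) :
    Small W (s.setVar x v) := by
  refine ⟨fun y => ?_, hs.arr_lt⟩
  simp only [State.setVar, Function.update_apply]
  split_ifs
  · exact hv
  · exact hs.var_lt y

theorem Small.setArr {W : ℕ} {s : State} (hs : Small W s) {a i v : ℕ} (hv : v < W) :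
    Small W (s.setArr a i v) := by
  refine ⟨hs.var_lt, fun b j => ?_⟩
  simp only [State.setArr, Function.update_apply]
  split_ifs with h1
  · simp only [Function.update_apply]
    split_ifs
    · exact hv
    · exact hs.arr_lt _ _
  · exact hs.arr_lt _ _

/-- Started in a memory `s` of words, the program `P` halts within time `T` in a memory of words
that satisfies `Q`. -/
def Runs (W : ℕ) (P : Cmd) (s : State) (T : ℕ) (Q : State → Prop) : Prop :=
  Small W s → ∃ t s', Exec W P s t s' ∧ t ≤ T ∧ Small W s' ∧ Q s'

theorem Runs.mono {W : ℕ} {P : Cmd} {s : State} {T T' : ℕ} {Q Q' : State → Prop}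
    (h : Runs W P s T Q) (hT : T ≤ T') (hQ : ∀ s', Q s' → Q' s') : Runs W P s T' Q' := by
  intro hs
  obtain ⟨t, s', h1, h2, h3, h4⟩ := h hs
  exact ⟨t, s', h1, h2.trans hT, h3, hQ s' h4⟩

theorem Runs.seq {W : ℕ} {P P' : Cmd} {s : State} {T T' : ℕ} {Q R : State → Prop}
    (h : Runs W P s T R) (h' : ∀ s', R s' → Runs W P' s' T' Q) :
    Runs W (.seq P P') s (T + T') Q := by
  intro hs
  obtain ⟨t, s', h1, h2, h3, h4⟩ := h hs
  obtain ⟨t', s'', k1, k2, k3, k4⟩ := h' s' h4 h3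
  exact ⟨t + t', s'', .seq h1 k1, by omega, k3, k4⟩

theorem Runs.cond {W : ℕ} {P P' : Cmd} {s : State} {T : ℕ} {Q : State → Prop} {e : Expr}
    (hW : 1 < W) (he : e.Fits W s) (h : e.val s ≠ 0 → Runs W P s T Q)
    (h' : e.val s = 0 → Runs W P' s T Q) : Runs W (.cond e P P') s (e.cost + 1 + T) Q := by
  intro hs
  by_cases h0 : e.val s = 0
  · obtain ⟨t, s', h1, h2, h3, h4⟩ := h' h0 hs
    exact ⟨_, s', .condFalse (by rw [(Expr.eval_eq hs hW he).1, h0]) h1, by omega, h3, h4⟩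
  · obtain ⟨t, s', h1, h2, h3, h4⟩ := h h0 hs
    exact ⟨_, s', .condTrue (Expr.eval_eq hs hW he).1 h0 h1, by omega, h3, h4⟩

/-- A loop with the invariant `I`, indexed by the number of rounds that have been completed. -/
theorem Runs.loop {W : ℕ} {P : Cmd} {s : State} {e : Expr} (hW : 1 < W) (I : ℕ → State → Prop)
    (K D : ℕ) (hfit : ∀ k s, I k s → e.Fits W s)
    (hbody : ∀ k s, I k s → e.val s ≠ 0 → k < K ∧ Runs W P s D (I (k + 1)))
    (h0 : I 0 s) :
    Runs W (.loop e P) s (K * (e.cost + 1 + D) + e.cost + 1)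
      (fun s' => ∃ k ≤ K, I k s' ∧ e.val s' = 0) := by
  have main : ∀ d k s, k + d = K → I k s →
      Runs W (.loop e P) s (d * (e.cost + 1 + D) + e.cost + 1)
        (fun s' => ∃ k ≤ K, I k s' ∧ e.val s' = 0) := by
    intro d
    induction d with
    | zero =>
      intro k s hk hI hs
      have hv : e.val s = 0 := by
        by_contra hne
        have := (hbody k s hI hne).1
        omega
      exact ⟨_, s, .loopFalse (by rw [(Expr.eval_eq hs hW (hfit k s hI)).1, hv]), by omega, hs,
        k, by omega, hI, hv⟩
    | succ d ih =>
      intro k s hk hI hs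
      by_cases hv : e.val s = 0
      · exact ⟨_, s, .loopFalse (by rw [(Expr.eval_eq hs hW (hfit k s hI)).1, hv]), by
          have : 0 ≤ (d + 1) * (e.cost + 1 + D) := Nat.zero_le _
          omega, hs, k, by omega, hI, hv⟩
      · obtain ⟨t, s', h1, h2, h3, h4⟩ := (hbody k s hI hv).2 hs
        obtain ⟨t', s'', k1, k2, k3, k4⟩ := ih (k + 1) s' (by omega) h4 h3
        refine ⟨_, s'', .loopTrue (Expr.eval_eq hs hW (hfit k s hI)).1 hv h1 k1, ?_, k3, k4⟩
        rw [Nat.succ_mul]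
        omega
  exact main K 0 s (by omega) h0

theorem Runs.loop_le {W : ℕ} {P : Cmd} {s : State} {e : Expr} {Q : State → Prop} (hW : 1 < W)
    (I : ℕ → State → Prop) (K D c T : ℕ) (hc : e.cost = c) (hT : K * (c + 1 + D) + c + 1 ≤ T)
    (hfit : ∀ k s, I k s → e.Fits W s)
    (hbody : ∀ k s, I k s → e.val s ≠ 0 → k < K ∧ Runs W P s D (I (k + 1)))
    (h0 : I 0 s) (hend : ∀ k s, k ≤ K → I k s → e.val s = 0 → Q s) :
    Runs W (.loop e P) s T Q :=
  (Runs.loop hW I K D hfit hbody h0).mono (hc ▸ hT)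
    fun s' ⟨k, hk, hI, hv⟩ => hend k s' hk hI hv

/-- Weakest preconditions of loop-free programs. -/
def wp (W : ℕ) : Cmd → (State → Prop) → State → Prop
  | .nop, Q, s => Q s
  | .assign x e, Q, s => e.Fits W s ∧ Q (s.setVar x (e.val s))
  | .put a i e, Q, s => i.Fits W s ∧ e.Fits W s ∧ Q (s.setArr a (i.val s) (e.val s))
  | .seq p q, Q, s => wp W p (wp W q Q) s
  | .cond e p q, Q, s =>
      e.Fits W s ∧ (e.val s ≠ 0 → wp W p Q s) ∧ (e.val s = 0 → wp W q Q s)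
  | .loop _ _, _, _ => False

/-- A bound on the running time of a loop-free program. -/
def Cmd.time : Cmd → ℕ
  | .nop => 1
  | .assign _ e => e.cost + 1
  | .put _ i e => i.cost + e.cost + 1
  | .seq p q => p.time + q.time
  -- The sum of both branches is a crude substitute for their maximum. The value for a loop does not
  -- matter, since `wp` is `False` there.
  | .cond e p q => e.cost + 1 + (p.time + q.time)
  | .loop _ _ => 0

theorem Runs.of_wp {W : ℕ} (hW : 1 < W) {P : Cmd} : ∀ {s : State} {Q : State → Prop},
    wp W P Q s → Runs W P s P.time Q := by
  induction P with
  | nop => intro s Q h hs; exact ⟨1, s, .nop s, le_rfl, hs, h⟩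
  | assign x e =>
    intro s Q h hs
    have he := Expr.eval_eq hs hW h.1
    exact ⟨_, _, .assign he.1, le_rfl, hs.setVar he.2, h.2⟩
  | put a i e =>
    intro s Q h hs
    have hi := Expr.eval_eq hs hW h.1
    have he := Expr.eval_eq hs hW h.2.1
    exact ⟨_, _, .put hi.1 he.1, le_rfl, hs.setArr he.2, h.2.2⟩
  | seq p q ihp ihq => intro s Q h; exact Runs.seq (ihp h) fun s' h' => ihq h'
  | cond e p q ihp ihq =>
    intro s Q h
    exact Runs.cond hW h.1
      (fun h0 => (ihp (h.2.1 h0)).mono (Nat.le_add_right _ _) fun _ h => h)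
      (fun h0 => (ihq (h.2.2 h0)).mono (Nat.le_add_left _ _) fun _ h => h)
  | loop e p => intro s Q h; exact h.elim

theorem Runs.of_wp_le {W : ℕ} (hW : 1 < W) {P : Cmd} {T : ℕ} {s : State} {Q : State → Prop}
    (hT : P.time ≤ T) (h : wp W P Q s) : Runs W P s T Q :=
  (Runs.of_wp hW h).mono hT fun _ h => h

section Simp

variable (s : State) (W x y v a b i k : ℕ) (e f : Expr)

@[simp] theorem setVar_var : (s.setVar x v).var y = if y = x then v else s.var y := by
  simp [State.setVar, Function.update_apply]

@[simp] theorem setVar_arr : (s.setVar x v).arr = s.arr := rfl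

@[simp] theorem setArr_var : (s.setArr a i v).var = s.var := rfl

@[simp] theorem setArr_arr : (s.setArr a i v).arr b =
    if b = a then Function.update (s.arr a) i v else s.arr b := by
  simp only [State.setArr, Function.update_apply]

@[simp] theorem val_const : (Expr.const k).val s = k := rfl
@[simp] theorem val_var : (Expr.var x).val s = s.var x := rfl
@[simp] theorem val_get : (Expr.get a e).val s = s.arr a (e.val s) := rfl
@[simp] theorem val_add : (e + f).val s = e.val s + f.val s := rfl
@[simp] theorem val_sub : (e - f).val s = e.val s - f.val s := rfl
@[simp] theorem val_lt : (Expr.bin .lt e f).val s = if e.val s < f.val s then 1 else 0 := rfl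
@[simp] theorem val_eq : (Expr.bin .eq e f).val s = if e.val s = f.val s then 1 else 0 := rfl

@[simp] theorem fits_const : (Expr.const k).Fits W s ↔ k < W := Iff.rfl
@[simp] theorem fits_var : (Expr.var x).Fits W s ↔ True := Iff.rfl
@[simp] theorem fits_get : (Expr.get a e).Fits W s ↔ e.Fits W s := Iff.rfl
@[simp] theorem fits_add :
    (e + f).Fits W s ↔ e.Fits W s ∧ f.Fits W s ∧ e.val s + f.val s < W := Iff.rfl
@[simp] theorem fits_sub : (e - f).Fits W s ↔ e.Fits W s ∧ f.Fits W s := Iff.rfl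
@[simp] theorem fits_lt : (Expr.bin .lt e f).Fits W s ↔ e.Fits W s ∧ f.Fits W s := Iff.rfl
@[simp] theorem fits_eq : (Expr.bin .eq e f).Fits W s ↔ e.Fits W s ∧ f.Fits W s := Iff.rfl

variable (p q : Cmd) (Q : State → Prop)

@[simp] theorem wp_nop : wp W .nop Q s ↔ Q s := Iff.rfl
@[simp] theorem wp_assign :
    wp W (.assign x e) Q s ↔ e.Fits W s ∧ Q (s.setVar x (e.val s)) := Iff.rfl
@[simp] theorem wp_put : wp W (.put a e f) Q s ↔
    e.Fits W s ∧ f.Fits W s ∧ Q (s.setArr a (e.val s) (f.val s)) := Iff.rfl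
@[simp] theorem wp_seq : wp W (.seq p q) Q s ↔ wp W p (wp W q Q) s := Iff.rfl
@[simp] theorem wp_cond : wp W (.cond e p q) Q s ↔
    e.Fits W s ∧ (e.val s ≠ 0 → wp W p Q s) ∧ (e.val s = 0 → wp W q Q s) := Iff.rfl

end Simp

end WordRAM

/-! ### The approximation ratio of stuck packings -/

namespace FlowShop

open Finset

/-- A sequence of `n` positions is split into paths by link flags: `L i = 1` if the positions
`i - 1` and `i` are consecutive on a path. A path packing without improving exchange has at least
two thirds as many edges as any simple 2-matching `O`. -/
theorem two_thirds_of_stuck {n : ℕ} {L c : ℕ → ℕ} {O : ℕ → ℕ → Prop} [DecidableRel O]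
    (hL1 : ∀ i, L i ≤ 1) (hL0 : L 0 = 0) (hLn : ∀ i, n ≤ i → L i = 0)
    (hc1 : ∀ i, L i ≠ 0 → c (i - 1) = c i)
    (hc0 : ∀ i i' j', L i = 0 → i' < i → i ≤ j' → j' < n → c i' ≠ c j')
    (hsymm : ∀ i j, O i j → O j i) (hirr : ∀ i, ¬ O i i) (hlt : ∀ i j, O i j → i < n)
    (hdeg : ∀ i, #{j ∈ range n | O i j} ≤ 2)
    (h1 : ∀ i j, O i j → L i + L (i + 1) < 2 → c i ≠ c j → ¬ L j + L (j + 1) < 2)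
    (h2 : ∀ b x y, L b ≠ 0 → O x (b - 1) → O y b → L x + L (x + 1) < 2 → L y + L (y + 1) < 2 →
      c x ≠ c b → c y ≠ c b → x = y ∧ L x + L (x + 1) ≠ 0)
    (h3 : ∀ b x y, L b ≠ 0 → x < b → c x = c b → L x = 0 → O x b → O y (b - 1) →
      L y + L (y + 1) < 2 → c y ≠ c b → False)
    (h3' : ∀ b x y, L b ≠ 0 → b ≤ x → c x = c b → L (x + 1) = 0 → O x (b - 1) → O y b →
      L y + L (y + 1) < 2 → c y ≠ c b → False) :
    ∑ x ∈ range n, #{y ∈ range n | O x y} ≤ 3 * ∑ i ∈ range n, L i := by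
  classical
  have hlt' : ∀ i j, O i j → j < n := fun i j h => hlt j i (hsymm i j h)
  have hLlt : ∀ i, L i ≠ 0 → i < n := fun i hi => by
    by_contra h; exact hi (hLn i (by omega))
  have hbetween : ∀ i t j, i < t → t ≤ j → j < n → c i = c j → L t ≠ 0 :=
    fun i t j hit htj hj hij h0 => hc0 t i j h0 hit htj hj hij
  set E : ℕ → Prop := fun x => L x + L (x + 1) < 2 with hE
  -- The vertices that charge the edge `b`, which joins the positions `b - 1` and `b`. They are path
  -- ends adjacent in `O` to the left end (`X0`) or to the right end (`X1`) of this edge. Those on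
  -- the path of `b` itself count only if the edge lies between them and that neighbour.
  set X0 : ℕ → Finset ℕ := fun b => {x ∈ range n | O x (b - 1) ∧ E x ∧ (c x ≠ c b ∨ b ≤ x)}
    with hX0
  set X1 : ℕ → Finset ℕ := fun b => {x ∈ range n | O x b ∧ E x ∧ (c x ≠ c b ∨ x < b)} with hX1
  -- The position `x` is linked to its left because `b - 1` is on its path, so an end has no link to
  -- its right.
  have hright : ∀ b x, L b ≠ 0 → x < n → E x → c x = c b → b ≤ x → L (x + 1) = 0 := by
    intro b x hb hx hEx hcx hbx
    have hb0 : b ≠ 0 := by rintro rfl; exact hb hL0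
    have := hbetween (b - 1) x x (by omega) le_rfl hx ((hc1 b hb).trans hcx.symm)
    have : L x + L (x + 1) < 2 := hEx
    omega
  have hleft : ∀ b x, L b ≠ 0 → E x → c x = c b → x < b → L x = 0 := by
    intro b x hb hEx hcx hbx
    have := hbetween x (x + 1) b (by omega) (by omega) (hLlt b hb) hcx
    have : L x + L (x + 1) < 2 := hEx
    omega
  -- The mixed cases, with one vertex on the path of `b` and one off it, are the rotations excluded
  -- by `h3` and `h3'`. Two vertices off the path coincide by `h2`. Two vertices on the path are its
  -- right and left ends, a configuration that no exchange excludes.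
  have hpair : ∀ b x y, L b ≠ 0 → x ∈ X0 b → y ∈ X1 b →
      (c y ≠ c b ∧ x = y) ∨ (c y = c b ∧ y < b ∧ L y = 0 ∧ c x = c b ∧ b ≤ x ∧ L (x + 1) = 0) := by
    intro b x y hb hx hy
    simp only [hX0, hX1, mem_filter, mem_range] at hx hy
    obtain ⟨hxn, hxO, hxE, hxc⟩ := hx
    obtain ⟨hyn, hyO, hyE, hyc⟩ := hy
    by_cases hcx : c x = c b
    · have hbx : b ≤ x := hxc.resolve_left fun h => h hcx
      have hx0 := hright b x hb hxn hxE hcx hbx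
      by_cases hcy : c y = c b
      · have hby : y < b := hyc.resolve_left fun h => h hcy
        exact Or.inr ⟨hcy, hby, hleft b y hb hyE hcy hby, hcx, hbx, hx0⟩
      · exact (h3' b x y hb hbx hcx hx0 hxO hyO hyE hcy).elim
    · by_cases hcy : c y = c b
      · have hby : y < b := hyc.resolve_left fun h => h hcy
        exact (h3 b y x hb hby hcy (hleft b y hb hyE hcy hby) hyO hxO hxE hcx).elim
      · exact Or.inl ⟨hcy, (h2 b x y hb hxO hyO hxE hyE hcx hcy).1⟩
  -- If one set is empty, the degree bound for `O` suffices. Otherwise comparison with a fixed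
  -- element of the other set leaves one candidate in each: the common outside end, or the unique
  -- end of the path on the appropriate side.
  have hcard : ∀ b, L b ≠ 0 → #(X0 b) + #(X1 b) ≤ 2 := by
    intro b hb
    have d0 : #(X0 b) ≤ 2 := by
      refine (card_le_card fun x hx => ?_).trans (hdeg (b - 1))
      simp only [hX0, mem_filter] at hx ⊢
      exact ⟨hx.1, hsymm _ _ hx.2.1⟩
    have d1 : #(X1 b) ≤ 2 := by
      refine (card_le_card fun x hx => ?_).trans (hdeg b)
      simp only [hX1, mem_filter] at hx ⊢
      exact ⟨hx.1, hsymm _ _ hx.2.1⟩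
    rcases (X0 b).eq_empty_or_nonempty with he | ⟨x, hx⟩
    · rw [he, card_empty]; omega
    rcases (X1 b).eq_empty_or_nonempty with he | ⟨y, hy⟩
    · rw [he, card_empty]; omega
    have e0 : #(X0 b) ≤ 1 := by
      refine card_le_one.2 fun u hu v hv => ?_
      have hun := (mem_filter.1 hu).1
      have hvn := (mem_filter.1 hv).1
      rw [mem_range] at hun hvn
      rcases hpair b u y hb hu hy with ⟨p1, p2⟩ | ⟨p1, -, -, p2, p3, p4⟩ <;>
        rcases hpair b v y hb hv hy with ⟨q1, q2⟩ | ⟨q1, -, -, q2, q3, q4⟩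
      · exact p2.trans q2.symm
      · exact (p1 q1).elim
      · exact (q1 p1).elim
      · rcases lt_trichotomy u v with h | h | h
        · exact (hbetween u (u + 1) v (by omega) h hvn (p2.trans q2.symm) p4).elim
        · exact h
        · exact (hbetween v (v + 1) u (by omega) h hun (q2.trans p2.symm) q4).elim
    have e1 : #(X1 b) ≤ 1 := by
      refine card_le_one.2 fun u hu v hv => ?_
      have hun := (mem_filter.1 hu).1
      have hvn := (mem_filter.1 hv).1
      rw [mem_range] at hun hvn
      rcases hpair b x u hb hx hu with ⟨p1, p2⟩ | ⟨p1, p2, p3, p4, p5, p6⟩ <;>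
        rcases hpair b x v hb hx hv with ⟨q1, q2⟩ | ⟨q1, q2, q3, q4, q5, q6⟩
      · exact p2.symm.trans q2
      · exact (p1 (p2 ▸ q4)).elim
      · exact (q1 (q2 ▸ p4)).elim
      · rcases lt_trichotomy u v with h | h | h
        · exact (hbetween u v v h le_rfl hvn (p1.trans q1.symm) q3).elim
        · exact h
        · exact (hbetween v u u h le_rfl hun (q1.trans p1.symm) p3).elim
    omega
  -- If `v` is on another path, it is an inner vertex by `h1`, and both its edges receive one unit.
  -- If `v` is on the path of `x`, then `x` has degree at least one, and one unit on the edge at `v`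
  -- towards `x` is enough.
  have hcharge : ∀ x v, x < n → O x v → 2 - (L x + L (x + 1)) ≤
      (if L (v + 1) ≠ 0 ∧ x ∈ X0 (v + 1) then 1 else 0) +
        (if L v ≠ 0 ∧ x ∈ X1 v then 1 else 0) := by
    intro x v hx hxv
    by_cases hEx : E x
    swap
    · have : ¬ L x + L (x + 1) < 2 := hEx
      omega
    have hv := hlt' x v hxv
    have mem0 : L (v + 1) ≠ 0 → (c x ≠ c v ∨ v < x) → x ∈ X0 (v + 1) := by
      intro hL h
      simp only [hX0, mem_filter, mem_range]
      have hcv : c v = c (v + 1) := hc1 (v + 1) hL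
      exact ⟨hx, hxv, hEx, by rw [← hcv]; exact h⟩
    have mem1 : (c x ≠ c v ∨ x < v) → x ∈ X1 v := by
      intro h
      simp only [hX1, mem_filter, mem_range]
      exact ⟨hx, hxv, hEx, h⟩
    by_cases hcv : c x = c v
    · rcases lt_trichotomy x v with h | h | h
      · have a1 := hbetween x v v h le_rfl hv hcv
        have a2 := hbetween x (x + 1) v (by omega) h hv hcv
        rw [if_pos (c := L v ≠ 0 ∧ x ∈ X1 v) ⟨a1, mem1 (Or.inr h)⟩]
        omega
      · exact (hirr x (by rw [← h] at hxv; exact hxv)).elim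
      · have a1 := hbetween v x x h le_rfl hx hcv.symm
        have a2 := hbetween v (v + 1) x (by omega) h hx hcv.symm
        rw [if_pos (c := L (v + 1) ≠ 0 ∧ x ∈ X0 (v + 1)) ⟨a2, mem0 a2 (Or.inr h)⟩]
        omega
    · have h := h1 x v hxv hEx hcv
      have b1 := hL1 v
      have b2 := hL1 (v + 1)
      rw [if_pos (c := L v ≠ 0 ∧ x ∈ X1 v) ⟨by omega, mem1 (Or.inl hcv)⟩,
        if_pos (c := L (v + 1) ≠ 0 ∧ x ∈ X0 (v + 1)) ⟨by omega, mem0 (by omega) (Or.inl hcv)⟩]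
      omega
  set f0 : ℕ → ℕ := fun b => if L b ≠ 0 then #(X0 b) else 0 with hf0
  set f1 : ℕ → ℕ := fun b => if L b ≠ 0 then #(X1 b) else 0 with hf1
  have hcount : ∀ (X : ℕ → Finset ℕ) (b : ℕ), (∀ b, X b ⊆ range n) →
      ∑ x ∈ range n, (if L b ≠ 0 ∧ x ∈ X b then 1 else 0) = if L b ≠ 0 then #(X b) else 0 := by
    intro X b hX
    split_ifs with hb
    · simp only [hb, ne_eq, not_false_eq_true, true_and]
      rw [sum_ite_mem, inter_eq_right.2 (hX b)]
      simp
    · simp [hb]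
  have hsum : ∑ x ∈ range n, #{y ∈ range n | O x y} * (2 - (L x + L (x + 1))) ≤
      ∑ v ∈ range n, f0 (v + 1) + ∑ v ∈ range n, f1 v := by
    calc ∑ x ∈ range n, #{y ∈ range n | O x y} * (2 - (L x + L (x + 1)))
        ≤ ∑ x ∈ range n, ∑ v ∈ range n,
          ((if L (v + 1) ≠ 0 ∧ x ∈ X0 (v + 1) then 1 else 0) +
            (if L v ≠ 0 ∧ x ∈ X1 v then 1 else 0)) := by
          refine sum_le_sum fun x hx => ?_
          rw [← smul_eq_mul, ← sum_const]
          refine (sum_le_sum fun v hv => hcharge x v (mem_range.1 hx)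
            (mem_filter.1 hv).2).trans ?_
          exact sum_le_sum_of_subset (filter_subset _ _)
      _ = _ := by
          rw [sum_comm, ← sum_add_distrib]
          refine sum_congr rfl fun v _ => ?_
          rw [sum_add_distrib, hcount X1 v fun b => filter_subset _ _,
            hcount X0 (v + 1) fun b => filter_subset _ _]
  have hshift : ∀ f : ℕ → ℕ, f 0 = 0 → f n = 0 →
      ∑ v ∈ range n, f (v + 1) = ∑ v ∈ range n, f v := by
    intro f h0 hn
    have e1 := sum_range_succ f n
    have e2 := sum_range_succ' f n
    omega
  have hf : ∑ v ∈ range n, f0 (v + 1) + ∑ v ∈ range n, f1 v ≤ 2 * ∑ i ∈ range n, L i := by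
    rw [hshift f0 (by simp [hf0, hL0]) (by simp [hf0, hLn n le_rfl]), ← sum_add_distrib, mul_sum]
    refine sum_le_sum fun b _ => ?_
    by_cases hb : L b = 0
    · simp [hf0, hf1, hb]
    · have := hcard b hb
      simp only [hf0, hf1, ne_eq, hb, not_false_eq_true, if_true]
      omega
  have hL2 := hshift L hL0 (hLn n le_rfl)
  -- With `d` the degree in `O` and `g` the degree in the packing, the claim at each vertex is `2d ≤
  -- d(2 - g) + 2g`, which holds because `d ≤ 2`. The charges sum to at most `2p` and the packing
  -- degrees to `2p`, where `p` is the sum of the flags; hence twice the sum of the `d` is at most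
  -- `6p`.
  have hfin : 2 * ∑ x ∈ range n, #{y ∈ range n | O x y} ≤
      ∑ x ∈ range n, #{y ∈ range n | O x y} * (2 - (L x + L (x + 1))) +
        2 * (∑ x ∈ range n, L x + ∑ x ∈ range n, L (x + 1)) := by
    rw [← sum_add_distrib, mul_sum, mul_sum, ← sum_add_distrib]
    refine sum_le_sum fun x _ => ?_
    have b1 := hL1 x
    have b2 := hL1 (x + 1)
    have b3 := hdeg x
    have hg : L x + L (x + 1) ≤ 2 := by omega
    generalize #{y ∈ range n | O x y} = d at *
    generalize L x + L (x + 1) = g at *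
    interval_cases g <;> omega
  omega

end FlowShop

/-! ### Schedules and 2-matchings -/

namespace FlowShop

open Finset in
/-- In a feasible schedule, the pairs of jobs that share a unit time slot after rounding down form
a simple 2-matching of the agreement graph, and every such pair saves one time unit. -/
theorem Schedule.Feasible.exists_twoMatching {n : ℕ} {G : SimpleGraph (Fin n)}
    {σ : Schedule (Fin n)} (h : σ.Feasible G) :
    ∃ D : Fin n → Fin n → Prop,
      (∀ j k, D j k → Gᶜ.Adj j k) ∧ (∀ j k, D j k → ¬ D k j) ∧
      (∀ j k k', D j k → D j k' → k = k') ∧ (∀ j j' k, D j k → D j' k → j = j') ∧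
      ∀ [DecidableRel D], ((2 * n : ℕ) : ℝ) ≤
        σ.makespan + #{p : Fin n × Fin n | D p.1 p.2} := by
  -- Both intervals contain the later of the two starting times.
  have overlap : ∀ x y : ℝ, 0 ≤ x → 0 ≤ y → ⌊x⌋₊ = ⌊y⌋₊ → ¬ Disjoint (busy x) (busy y) := by
    intro x y hx hy hxy
    rw [Set.not_disjoint_iff]
    have h1 := Nat.floor_le hx
    have h2 := Nat.floor_le hy
    have h3 := Nat.lt_floor_add_one x
    have h4 := Nat.lt_floor_add_one y
    rw [hxy] at h1 h3
    refine ⟨max x y, ⟨le_max_left _ _, max_lt ?_ ?_⟩, le_max_right _ _, max_lt ?_ ?_⟩ <;> linarith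
  have hflow : ∀ j, ⌊σ.fst j⌋₊ + 1 ≤ ⌊σ.snd j⌋₊ := by
    intro j
    rw [← Nat.floor_add_one (h.fst_nonneg j)]
    exact Nat.floor_mono (h.flow j)
  have hf : ∀ j k, ⌊σ.fst j⌋₊ = ⌊σ.fst k⌋₊ → j = k := by
    intro j k hjk
    by_contra hne
    exact overlap _ _ (h.fst_nonneg j) (h.fst_nonneg k) hjk (h.fst_disjoint j k hne)
  have hg : ∀ j k, ⌊σ.snd j⌋₊ = ⌊σ.snd k⌋₊ → j = k := by
    intro j k hjk
    by_contra hne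
    exact overlap _ _ (h.snd_nonneg j) (h.snd_nonneg k) hjk (h.snd_disjoint j k hne)
  -- A 2-cycle is impossible because the slot of a job on the second machine is strictly later than
  -- its slot on the first.
  refine ⟨fun j k => ⌊σ.fst j⌋₊ = ⌊σ.snd k⌋₊, ?_, ?_, ?_, ?_, ?_⟩
  · intro j k hjk
    rw [SimpleGraph.compl_adj]
    refine ⟨?_, fun hadj => overlap _ _ (h.fst_nonneg j) (h.snd_nonneg k) hjk
      (h.conflict j k hadj)⟩
    rintro rfl
    have := hflow j
    omega
  · intro j k h1 h2
    have := hflow j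
    have := hflow k
    omega
  · intro j k k' h1 h2
    exact hg _ _ (h1.symm.trans h2)
  · intro j j' k h1 h2
    exact hf _ _ (h1.trans h2.symm)
  · intro _
    have hnonneg : 0 ≤ σ.makespan :=
      Real.iSup_nonneg fun j => by have := h.snd_nonneg j; linarith
    have hlt : ∀ j, ⌊σ.snd j⌋₊ < ⌊σ.makespan⌋₊ := by
      intro j
      have h1 : σ.snd j + 1 ≤ σ.makespan :=
        le_ciSup (f := fun j => σ.snd j + 1) (Set.finite_range _).bddAbove j
      have h2 := Nat.floor_mono h1
      rw [Nat.floor_add_one (h.snd_nonneg j)] at h2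
      omega
    -- The slots used by the two machines. Both sets have `n` elements, the union fits below the
    -- floor of the makespan, and every common slot comes from a pair in the relation, so
    -- inclusion–exclusion gives the bound.
    set A := univ.image fun j => ⌊σ.fst j⌋₊ with hA
    set B := univ.image fun j => ⌊σ.snd j⌋₊ with hB
    have cA : #A = n := by
      rw [hA, card_image_of_injective _ fun j k => hf j k, card_univ, Fintype.card_fin]
    have cB : #B = n := by
      rw [hB, card_image_of_injective _ fun j k => hg j k, card_univ, Fintype.card_fin]
    have cU : #(A ∪ B) ≤ ⌊σ.makespan⌋₊ := by
      rw [← card_range ⌊σ.makespan⌋₊]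
      refine card_le_card fun t ht => ?_
      rw [mem_range]
      rcases mem_union.1 ht with ht | ht
      · obtain ⟨j, -, rfl⟩ := mem_image.1 ht
        have := hlt j
        have := hflow j
        omega
      · obtain ⟨j, -, rfl⟩ := mem_image.1 ht
        exact hlt j
    have cI : #(A ∩ B) ≤ #{p : Fin n × Fin n | ⌊σ.fst p.1⌋₊ = ⌊σ.snd p.2⌋₊} := by
      refine le_trans (card_le_card fun t ht => ?_)
        (card_image_le (f := fun p : Fin n × Fin n => ⌊σ.fst p.1⌋₊))
      obtain ⟨h1, h2⟩ := mem_inter.1 ht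
      obtain ⟨j, -, rfl⟩ := mem_image.1 h1
      obtain ⟨k, -, hk⟩ := mem_image.1 h2
      exact mem_image.2 ⟨(j, k), by simpa using hk.symm, rfl⟩
    have hsum := card_union_add_card_inter A B
    have hfloor := Nat.floor_le hnonneg
    have : 2 * n ≤ ⌊σ.makespan⌋₊ + #{p : Fin n × Fin n | ⌊σ.fst p.1⌋₊ = ⌊σ.snd p.2⌋₊} := by
      omega
    have hcast : ((2 * n : ℕ) : ℝ) ≤
        (⌊σ.makespan⌋₊ + #{p : Fin n × Fin n | ⌊σ.fst p.1⌋₊ = ⌊σ.snd p.2⌋₊} : ℕ) :=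
      Nat.cast_le.2 this
    rw [Nat.cast_add] at hcast
    convert hcast.trans (add_le_add_left hfloor _) using 3

theorem ListsEdges.length_eq {V : Type*} {H : SimpleGraph V} {l : List (V × V)}
    (h : ListsEdges H l) : l.length = H.edgeSet.ncard := by
  classical
  have : H.edgeSet = ((l.map fun p => s(p.1, p.2)).toFinset : Set (Sym2 V)) := by
    ext e; simp [← h.2 e]
  rw [this, Set.ncard_coe_finset, List.toFinset_card_of_nodup h.1, List.length_map]

theorem ListsEdges.length_le {n : ℕ} {H : SimpleGraph (Fin n)} {l : List (Fin n × Fin n)}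
    (h : ListsEdges H l) : l.length ≤ n * n := by
  have h1 : l.Nodup := List.Nodup.of_map _ h.1
  simpa using h1.length_le_card

theorem ListsEdges.adj_iff {V : Type*} {H : SimpleGraph V} {l : List (V × V)}
    (h : ListsEdges H l) (u v : V) : H.Adj u v ↔ (u, v) ∈ l ∨ (v, u) ∈ l := by
  rw [← SimpleGraph.mem_edgeSet, ← h.2]
  simp only [List.mem_map, Sym2.eq_iff, Prod.exists]
  constructor
  · rintro ⟨a, b, hab, ⟨rfl, rfl⟩ | ⟨rfl, rfl⟩⟩ <;> simp [hab]
  · rintro (h | h)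
    · exact ⟨u, v, h, by simp⟩
    · exact ⟨v, u, h, by simp⟩

/-- The schedule that processes the jobs in the order `q` without waiting, except that it inserts
an idle slot before the job number `i` if `c i = 0`. -/
theorem feasible_of_sequence {n : ℕ} {G : SimpleGraph (Fin n)} {σ : Schedule (Fin n)}
    {q : Fin n → Fin n} (hq : Function.Bijective q) {c T : ℕ → ℕ}
    (hT : ∀ i, T (i + 1) = T i + if c (i + 1) = 0 then 2 else 1)
    (hfst : ∀ i : Fin n, σ.fst (q i) = T i) (hsnd : ∀ i : Fin n, σ.snd (q i) = T i + 1)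
    (hc : ∀ i j : Fin n, i.1 + 1 = j.1 → c j ≠ 0 → Gᶜ.Adj (q i) (q j)) :
    σ.Feasible G := by
  have hstep : ∀ i, T i + 1 ≤ T (i + 1) := by intro i; rw [hT]; split_ifs <;> omega
  have hmono : StrictMono T := strictMono_nat_of_lt_succ fun i => by have := hstep i; omega
  have hbusy : ∀ a b : ℕ, a ≠ b → Disjoint (busy (a : ℝ)) (busy (b : ℝ)) := by
    intro a b hab
    rw [Set.disjoint_left]
    rintro z ⟨h1, h2⟩ ⟨h3, h4⟩
    have h5 : (a : ℝ) < (b + 1 : ℕ) := by push_cast; linarith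
    have h6 : (b : ℝ) < (a + 1 : ℕ) := by push_cast; linarith
    rw [Nat.cast_lt] at h5 h6
    omega
  have hinj : ∀ i j : Fin n, i ≠ j → T i ≠ T j := fun i j hij h =>
    hij (Fin.ext (hmono.injective h))
  constructor
  · intro j
    obtain ⟨i, rfl⟩ := hq.2 j
    rw [hfst]; positivity
  · intro j
    obtain ⟨i, rfl⟩ := hq.2 j
    rw [hsnd]; positivity
  · intro j k hjk
    obtain ⟨i, rfl⟩ := hq.2 j
    obtain ⟨i', rfl⟩ := hq.2 k
    rw [hfst, hfst]
    exact hbusy _ _ (hinj _ _ fun h => hjk (by rw [h]))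
  · intro j k hjk
    obtain ⟨i, rfl⟩ := hq.2 j
    obtain ⟨i', rfl⟩ := hq.2 k
    rw [hsnd, hsnd]
    have := hbusy (T i + 1) (T i' + 1)
      (fun h => hinj i i' (fun h => hjk (by rw [h])) (by omega))
    exact_mod_cast this
  · intro j
    obtain ⟨i, rfl⟩ := hq.2 j
    rw [hfst, hsnd]
  · intro j k hjk
    obtain ⟨i, rfl⟩ := hq.2 j
    obtain ⟨i', rfl⟩ := hq.2 k
    rw [hfst, hsnd]
    -- Starting times are integers that grow by at least one per position. Equality `T i = T i' + 1`
    -- forces `i = i' + 1` without an idle slot, so the two jobs agree.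
    have := hbusy (T i) (T i' + 1) (fun h => by
      have h1 : i'.1 < i.1 := hmono.lt_iff_lt.1 (by omega)
      have h2 : i.1 ≤ i'.1 + 1 := hmono.le_iff_le.1 (by have := hstep i'; omega)
      have h3 : i.1 = i'.1 + 1 := by omega
      have h4 : c i ≠ 0 := by
        intro h0
        have := hT i'
        rw [← h3, if_pos h0] at this
        omega
      exact ((SimpleGraph.compl_adj _ _ _).1 (hc i' i h3.symm h4)).2 hjk.symm)
    exact_mod_cast this

theorem makespan_le {n : ℕ} {σ : Schedule (Fin n)} {C : ℝ} (hC : 0 ≤ C)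
    (h : ∀ j, σ.snd j + 1 ≤ C) : σ.makespan ≤ C :=
  Real.iSup_le h hC

end FlowShop

/-! ### Path packings -/

namespace FlowShop

/-- The agreement graph on `0, …, n - 1` (relation `a`), with a list `eu, ev` of its `M` oriented
edges. -/
structure Agreement (n M : ℕ) (a : ℕ → ℕ → Prop) (eu ev : ℕ → ℕ) : Prop where
  symm : ∀ {u v}, a u v → a v u
  irrefl : ∀ u, ¬ a u u
  lt : ∀ {u v}, a u v → u < n
  edge : ∀ {e}, e < M → a (eu e) (ev e)
  exists_edge : ∀ {u v}, a u v → ∃ e < M, eu e = u ∧ ev e = v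

/-- A packing of paths: the jobs are listed by `q`, with inverse `ps - 1`, and `L i = 1` if the
jobs at the positions `i - 1` and `i` are consecutive on a path. Only the first `N` positions
hold jobs with neighbours. -/
structure Packing (n N : ℕ) (a : ℕ → ℕ → Prop) (q ps L : ℕ → ℕ) : Prop where
  q_lt : ∀ {i}, i < n → q i < n
  ps_q : ∀ {i}, i < n → ps (q i) = i + 1
  ps_pos : ∀ {u}, u < n → 1 ≤ ps u
  ps_le : ∀ {u}, u < n → ps u ≤ n
  q_ps : ∀ {u}, u < n → q (ps u - 1) = u
  L_zero : L 0 = 0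
  L_le : ∀ i, L i ≤ 1
  L_lt : ∀ {i}, L i ≠ 0 → i < N
  L_adj : ∀ {i}, L i ≠ 0 → a (q (i - 1)) (q i)
  ps_le_of_adj : ∀ {u v}, a u v → ps u ≤ N
  N_le : N ≤ n

/-- The colours are the same along paths and differ between paths. -/
structure Colored (n : ℕ) (q L col : ℕ → ℕ) : Prop where
  eq : ∀ {i}, i < n → L i ≠ 0 → col (q (i - 1)) = col (q i)
  ne : ∀ {i i' j'}, L i = 0 → i' < i → i ≤ j' → j' < n → col (q i') ≠ col (q j')

/-- The degree of a job in the packing. -/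
def deg (ps L : ℕ → ℕ) (v : ℕ) : ℕ := L (ps v - 1) + L (ps v)

theorem Colored.link {n : ℕ} {q L col : ℕ → ℕ} (h : Colored n q L col) {i t j : ℕ}
    (hij : col (q i) = col (q j)) (hit : i < t) (htj : t ≤ j) (hj : j < n) : L t ≠ 0 :=
  fun h0 => h.ne h0 hit htj hj hij

theorem Colored.eq_of_links {n : ℕ} {q L col : ℕ → ℕ} (h : Colored n q L col) {i j : ℕ}
    (hij : i ≤ j) (hj : j < n) (hL : ∀ t, i < t → t ≤ j → L t ≠ 0) : col (q i) = col (q j) := by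
  induction j, hij using Nat.le_induction with
  | base => rfl
  | succ j hij ih =>
    rw [ih (by omega) fun t h1 h2 => hL t h1 (by omega)]
    exact h.eq hj (hL (j + 1) (by omega) le_rfl)

namespace Packing

variable {n N : ℕ} {a : ℕ → ℕ → Prop} {q ps L col : ℕ → ℕ}

theorem deg_le (h : Packing n N a q ps L) (v : ℕ) : deg ps L v ≤ 2 := by
  have h1 := h.L_le (ps v - 1)
  have h2 := h.L_le (ps v)
  unfold deg; omega

theorem deg_q (h : Packing n N a q ps L) {i : ℕ} (hi : i < n) :
    deg ps L (q i) = L i + L (i + 1) := by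
  simp [deg, h.ps_q hi]

theorem L_eq_zero (h : Packing n N a q ps L) {i : ℕ} (hi : N ≤ i) : L i = 0 := by
  by_contra h0
  have := h.L_lt h0
  omega

theorem q_inj (h : Packing n N a q ps L) {i j : ℕ} (hi : i < n) (hj : j < n) (hij : q i = q j) :
    i = j := by
  have h1 := h.ps_q hi
  have h2 := h.ps_q hj
  rw [hij] at h1
  omega

theorem ps_inj (h : Packing n N a q ps L) {u v : ℕ} (hu : u < n) (hv : v < n)
    (huv : ps u = ps v) : u = v := by
  rw [← h.q_ps hu, huv, h.q_ps hv]

/-- The sum of the degrees is twice the number of edges. -/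
theorem sum_deg (h : Packing n N a q ps L) :
    ∑ v ∈ Finset.range n, deg ps L v = 2 * ∑ i ∈ Finset.range n, L i := by
  have e : ∑ v ∈ Finset.range n, deg ps L v = ∑ i ∈ Finset.range n, (L i + L (i + 1)) := by
    refine Finset.sum_bij' (fun v _ => ps v - 1) (fun i _ => q i) ?_ ?_ ?_ ?_ ?_
    · intro v hv
      rw [Finset.mem_range] at hv ⊢
      have := h.ps_pos hv
      have := h.ps_le hv
      omega
    · intro i hi
      rw [Finset.mem_range] at hi ⊢
      exact h.q_lt hi
    · intro v hv
      exact h.q_ps (Finset.mem_range.1 hv)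
    · intro i hi
      simp [h.ps_q (Finset.mem_range.1 hi)]
    · intro v hv
      have := h.ps_pos (Finset.mem_range.1 hv)
      simp only [deg]
      rw [Nat.sub_add_cancel this]
  -- Shifting the index in the second sum changes nothing because `L 0` and `L n` vanish.
  rw [e, Finset.sum_add_distrib]
  have e1 := Finset.sum_range_succ L n
  have e2 := Finset.sum_range_succ' L n
  have := h.L_zero
  have := h.L_eq_zero h.N_le
  omega

theorem sum_L_le (h : Packing n N a q ps L) : ∑ i ∈ Finset.range n, L i ≤ N := by
  calc ∑ i ∈ Finset.range n, L i = ∑ i ∈ Finset.range N, L i := by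
        refine (Finset.sum_subset (Finset.range_subset_range.2 h.N_le) fun i _ hi => ?_).symm
        exact h.L_eq_zero (by simpa using hi)
    _ ≤ ∑ i ∈ Finset.range N, 1 := Finset.sum_le_sum fun i _ => h.L_le i
    _ = N := by simp

/-- Reversal of the segment `[b, d]` of a sequence. -/
def revSeq (b d : ℕ) (q : ℕ → ℕ) (r : ℕ) : ℕ := if b ≤ r ∧ r ≤ d then q (b + d - r) else q r

/-- The link flags after reversal of the segment `[b, d]`. -/
def revLink (b d : ℕ) (L : ℕ → ℕ) (r : ℕ) : ℕ := if b ≤ r ∧ r ≤ d then L (b + d + 1 - r) else L r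

/-- The positions after reversal of the segment `[b, d]`. -/
def revPos (b d : ℕ) (ps : ℕ → ℕ) (v : ℕ) : ℕ :=
  if b < ps v ∧ ps v ≤ d + 1 then b + d + 2 - ps v else ps v

/-- The zero flags at `b` and `d + 1` say that the segment consists of whole paths. The new flag at
`r` joins the old positions `b + d - r` and `b + d + 1 - r`, hence is the old flag at `b + d + 1 -
r`; symmetry of `a` allows its edge to be used backwards. Since `ps` stores positions plus one, its
reflection has the constant `b + d + 2`. -/
theorem reverse (h : Packing n N a q ps L) {b d : ℕ} (hbd : b ≤ d) (hd : d < N) (hb : L b = 0)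
    (hd1 : L (d + 1) = 0) {ps' : ℕ → ℕ} (hps : ∀ v < n, ps' v = revPos b d ps v)
    (hlt : ∀ {u v}, a u v → u < n) (hsymm : ∀ {u v}, a u v → a v u) :
    Packing n N a (revSeq b d q) ps' (revLink b d L) := by
  have hN := h.N_le
  have hqlt : ∀ {i}, i < n → revSeq b d q i < n := by
    intro i hi
    unfold revSeq
    split_ifs <;> exact h.q_lt (by omega)
  constructor
  · exact hqlt
  · intro i hi
    rw [hps _ (hqlt hi), revPos, revSeq]
    split_ifs with h1 h2 h2
    · rw [h.ps_q (by omega)]; omega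
    · rw [h.ps_q (by omega)] at h2; omega
    · rw [h.ps_q (by omega)] at h2; omega
    · exact h.ps_q hi
  · intro u hu
    have := h.ps_pos hu
    rw [hps u hu, revPos]; split_ifs <;> omega
  · intro u hu
    have := h.ps_le hu
    rw [hps u hu, revPos]; split_ifs <;> omega
  · intro u hu
    have h1 := h.ps_pos hu
    have h2 := h.q_ps hu
    rw [hps u hu, revPos, revSeq]
    split_ifs with h3 h4 h4
    · exact (congrArg q (show _ = ps u - 1 by omega)).trans h2
    · omega
    · omega
    · exact h2
  · have := h.L_zero
    unfold revLink
    split_ifs with h1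
    · have : b + d + 1 - 0 = d + 1 := by omega
      rw [this]; exact hd1
    · exact this
  · intro i
    unfold revLink
    split_ifs <;> exact h.L_le _
  · intro i hi
    by_contra hc
    rw [revLink, if_neg (by omega)] at hi
    exact hc (h.L_lt hi)
  · intro i hi
    unfold revLink at hi
    unfold revSeq
    split_ifs at hi with h1
    · by_cases hib : i = b
      · subst hib
        rw [show i + d + 1 - i = d + 1 by omega] at hi
        exact (hi hd1).elim
      · rw [if_pos (by omega), if_pos (by omega)]
        have := h.L_adj hi
        rw [show b + d + 1 - i - 1 = b + d - i by omega] at this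
        rw [show b + d - (i - 1) = b + d + 1 - i by omega]
        exact hsymm this
    · have hne : i ≠ d + 1 := by rintro rfl; exact hi hd1
      have h0 : i ≠ 0 := by rintro rfl; exact hi h.L_zero
      rw [if_neg (by omega), if_neg (by omega)]
      exact h.L_adj hi
  · intro u v huv
    have := h.ps_le_of_adj huv
    rw [hps u (hlt huv), revPos]; split_ifs <;> omega
  · exact hN

/-- Reversal swaps the two flags at each job of the segment. At its borders both the old and the new
flags vanish. -/
theorem deg_reverse (h : Packing n N a q ps L) {b d : ℕ} (hbd : b ≤ d) (hb : L b = 0)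
    (hd1 : L (d + 1) = 0) {ps' : ℕ → ℕ} (hps : ∀ v < n, ps' v = revPos b d ps v) {v : ℕ}
    (hv : v < n) : deg ps' (revLink b d L) v = deg ps L v := by
  have h1 := h.ps_pos hv
  unfold deg
  rw [hps v hv, revPos]
  split_ifs with h2
  · have e1 : revLink b d L (b + d + 2 - ps v - 1) = L (ps v) := by
      rw [revLink, if_pos (by omega)]; congr 1; omega
    have e2 : revLink b d L (b + d + 2 - ps v) = L (ps v - 1) := by
      by_cases h3 : ps v = b + 1
      · rw [revLink, if_neg (by omega), show b + d + 2 - ps v = d + 1 by omega,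
          show ps v - 1 = b by omega, hb, hd1]
      · rw [revLink, if_pos (by omega)]; congr 1; omega
    omega
  · have e1 : revLink b d L (ps v - 1) = L (ps v - 1) := by
      rw [revLink, if_neg (by omega)]
    have e2 : revLink b d L (ps v) = L (ps v) := by
      by_cases h3 : ps v = b
      · rw [revLink, if_pos (by omega), h3, show b + d + 1 - b = d + 1 by omega, hb, hd1]
      · rw [revLink, if_neg (by omega)]
    omega

/-- Colours belong to jobs rather than positions, so turning whole paths around leaves the colouring
valid unchanged. -/
theorem colored_reverse (hc : Colored n q L col) {b d : ℕ} (hbd : b ≤ d) (hd : d < n)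
    (hb : L b = 0) (hd1 : L (d + 1) = 0) (h0 : L 0 = 0) :
    Colored n (revSeq b d q) (revLink b d L) col := by
  constructor
  · intro i hin hi
    unfold revLink at hi
    unfold revSeq
    split_ifs at hi with h1
    · by_cases hib : i = b
      · subst hib
        rw [show i + d + 1 - i = d + 1 by omega] at hi
        exact (hi hd1).elim
      · rw [if_pos (by omega), if_pos (by omega)]
        have := hc.eq (by omega) hi
        rw [show b + d + 1 - i - 1 = b + d - i by omega] at this
        rw [show b + d - (i - 1) = b + d + 1 - i by omega]
        exact this.symm
    · have hne : i ≠ d + 1 := by rintro rfl; exact hi hd1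
      have h0 : i ≠ 0 := by rintro rfl; exact hi h0
      rw [if_neg (by omega), if_neg (by omega)]
      exact hc.eq hin hi
  · intro i i' j' hi h1 h2 h3
    unfold revLink at hi
    unfold revSeq
    by_cases c1 : b ≤ i' ∧ i' ≤ d <;> by_cases c2 : b ≤ j' ∧ j' ≤ d
    · rw [if_pos c1, if_pos c2]
      rw [if_pos (by omega)] at hi
      exact (hc.ne hi (by omega) (by omega) (by omega)).symm
    · rw [if_pos c1, if_neg c2]
      exact hc.ne hd1 (by omega) (by omega) h3
    · rw [if_neg c1, if_pos c2]
      exact hc.ne hb (by omega) (by omega) (by omega)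
    · rw [if_neg c1, if_neg c2]
      split_ifs at hi with h4
      · exact hc.ne hb (by omega) (by omega) h3
      · exact hc.ne hi h1 h2 h3

/-- Joining the paths that end at the position `i - 1` and begin at the position `i`. -/
theorem join (h : Packing n N a q ps L) {i : ℕ} (hi0 : i ≠ 0) (hi : i < N)
    (ha : a (q (i - 1)) (q i)) : Packing n N a q ps (Function.update L i 1) where
  q_lt := h.q_lt
  ps_q := h.ps_q
  ps_pos := h.ps_pos
  ps_le := h.ps_le
  q_ps := h.q_ps
  L_zero := by rw [Function.update_of_ne hi0.symm, h.L_zero]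
  L_le j := by
    rw [Function.update_apply]
    split_ifs
    · exact le_rfl
    · exact h.L_le j
  L_lt {j} hj := by
    rw [Function.update_apply] at hj
    split_ifs at hj with hji
    · exact hji ▸ hi
    · exact h.L_lt hj
  L_adj {j} hj := by
    rw [Function.update_apply] at hj
    split_ifs at hj with hji
    · exact hji ▸ ha
    · exact h.L_adj hj
  ps_le_of_adj := h.ps_le_of_adj
  N_le := h.N_le

/-- Only the two jobs at the flag `i` are affected. The old flag is added on the left to avoid
truncated subtraction. -/
theorem deg_update (h : Packing n N a q ps L) {i x : ℕ} (hi0 : i ≠ 0) (hi : i < n) {v : ℕ}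
    (hv : v < n) : deg ps (Function.update L i x) v + (if v = q (i - 1) then L i else 0) +
      (if v = q i then L i else 0) = deg ps L v + (if v = q (i - 1) then x else 0) +
      (if v = q i then x else 0) := by
  have h1 : v = q (i - 1) ↔ ps v = i := by
    constructor
    · rintro rfl
      rw [h.ps_q (by omega)]; omega
    · rintro rfl
      exact (h.q_ps hv).symm
  have h2 : v = q i ↔ ps v - 1 = i := by
    constructor
    · rintro rfl
      rw [h.ps_q hi]; omega
    · rintro rfl
      exact (h.q_ps hv).symm
  have h3 := h.ps_pos hv
  simp only [h1, h2, deg, Function.update_apply]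
  split_ifs with h4 h5 h5 <;> first | omega | (subst h4; omega) | (subst h5; omega)

/-- Recolouring can create a clash only between a job of one joined path and a job of the other.
These paths are adjacent intervals meeting at `i`, so no zero flag other than the one at `i`
separates their jobs. Either colour may absorb the other, whence the two cases for `A` and `B`. -/
theorem colored_join (hc : Colored n q L col) {i : ℕ} (hi : i < n) (h0 : L i = 0) {A B : ℕ}
    (hAB : (A = col (q (i - 1)) ∧ B = col (q i)) ∨ (A = col (q i) ∧ B = col (q (i - 1)))) :
    Colored n q (Function.update L i 1) (fun z => if col z = A then B else col z) := by
  constructor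
  · intro j hjn hj
    rw [Function.update_apply] at hj
    split_ifs at hj with hji
    · subst hji
      rcases hAB with ⟨rfl, rfl⟩ | ⟨rfl, rfl⟩ <;> simp
    · simp only [hc.eq hjn hj]
  · intro j i' j' hj h1 h2 h3 h4
    rw [Function.update_apply] at hj
    split_ifs at hj with hji
    have n1 := hc.ne hj h1 h2 h3
    have key : (col (q i') = col (q (i - 1)) ∧ col (q j') = col (q i)) ∨
        (col (q i') = col (q i) ∧ col (q j') = col (q (i - 1))) := by
      rcases hAB with ⟨rfl, rfl⟩ | ⟨rfl, rfl⟩ <;> split_ifs at h4 <;> grind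
    rcases key with ⟨k1, k2⟩ | ⟨k1, k2⟩
    · rcases lt_or_gt_of_ne hji with hlt | hgt
      · exact hc.ne (i' := i') (j' := i - 1) hj h1 (by omega) (by omega) k1
      · exact hc.ne (i' := i) (j' := j') hj hgt h2 h3 k2.symm
    · by_cases hi' : i' < i
      · exact hc.ne (i' := i') (j' := i) h0 hi' le_rfl hi k1
      · by_cases hi0 : i = 0
        · subst hi0
          exact n1 (k1.trans k2.symm)
        · exact hc.ne (i' := i - 1) (j' := j') h0 (by omega) (by omega) h3 k2.symm

/-- Removing the edge between the positions `i - 1` and `i`. -/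
theorem cut (h : Packing n N a q ps L) (i : ℕ) : Packing n N a q ps (Function.update L i 0) where
  q_lt := h.q_lt
  ps_q := h.ps_q
  ps_pos := h.ps_pos
  ps_le := h.ps_le
  q_ps := h.q_ps
  L_zero := by
    rw [Function.update_apply]
    split_ifs
    · rfl
    · exact h.L_zero
  L_le j := by
    rw [Function.update_apply]
    split_ifs
    · exact zero_le_one
    · exact h.L_le j
  L_lt {j} hj := by
    rw [Function.update_apply] at hj
    split_ifs at hj with hji
    · exact (hj rfl).elim
    · exact h.L_lt hj
  L_adj {j} hj := by
    rw [Function.update_apply] at hj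
    split_ifs at hj with hji
    · exact (hj rfl).elim
    · exact h.L_adj hj
  ps_le_of_adj := h.ps_le_of_adj
  N_le := h.N_le

/-- The colours after removing the edge between the positions `i - 1` and `i`: the second part
gets the new colour `n`. -/
def cutCol (n : ℕ) (q ps col : ℕ → ℕ) (i z : ℕ) : ℕ :=
  if col z = col (q i) ∧ i < ps z then n else col z

/-- The colour `n` is fresh by `hcol`. The condition `i < ps z` in `cutCol` selects the positions
from `i` on, since `ps` is shifted by one. -/
theorem colored_cut (h : Packing n N a q ps L) (hc : Colored n q L col) (hcol : ∀ z < n, col z < n)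
    {i : ℕ} (hi : L i ≠ 0) :
    Colored n q (Function.update L i 0) (cutCol n q ps col i) := by
  have hin := h.L_lt hi
  have hN := h.N_le
  constructor
  · intro j hjn hj
    rw [Function.update_apply] at hj
    split_ifs at hj with hji
    · exact (hj rfl).elim
    · have := hc.eq hjn hj
      simp only [cutCol, this, h.ps_q hjn, h.ps_q (show j - 1 < n by omega)]
      congr 2
      exact propext (by omega)
  · intro j i' j' hj h1 h2 h3
    have b1 := hcol (q i') (h.q_lt (by omega))
    have b2 := hcol (q j') (h.q_lt h3)
    simp only [cutCol, h.ps_q h3, h.ps_q (show i' < n by omega)]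
    rw [Function.update_apply] at hj
    split_ifs at hj with hji
    · subst hji
      rw [if_neg (by omega)]
      split_ifs with h4
      · omega
      · intro h5
        by_cases h6 : col (q j') = col (q j)
        · exact h4 ⟨h6, by omega⟩
        -- If `q j'` is off the cut path, some flag between `i'` and `j'` must vanish: otherwise `q
        -- j'` would have the colour of `q j`.
        · by_cases h7 : ∀ t, i' < t → t ≤ j' → L t ≠ 0
          · exact h6 (hc.eq_of_links h2 h3 fun t u1 u2 => h7 t (by omega) u2).symm
          · push Not at h7
            obtain ⟨t, u1, u2, u3⟩ := h7
            exact hc.ne u3 u1 u2 h3 h5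
    · have n1 := hc.ne hj h1 h2 h3
      split_ifs with h4 h5 h5
      · exact fun _ => n1 (h4.1.trans h5.1.symm)
      · omega
      · omega
      · exact n1

end Packing

end FlowShop

/-! ### Reversing a segment of a packing -/

namespace FlowShop

open WordRAM

/-- The memory holds the instance and a packing. -/
structure Mem (n M N : ℕ) (eu ev q ps L : ℕ → ℕ) (s : State) : Prop where
  var_n : s.var 0 = n
  var_M : s.var 1 = M
  var_N : s.var 2 = N
  arr_eu : s.arr 10 = eu
  arr_ev : s.arr 11 = ev
  arr_q : s.arr 4 = q
  arr_ps : s.arr 5 = ps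
  arr_L : s.arr 6 = L

/-- The variables outside `X` have the same values in `s` and `s'`. -/
def SameVars (X : List ℕ) (s s' : State) : Prop := ∀ x, x ∉ X → s'.var x = s.var x

theorem SameVars.trans {X : List ℕ} {s s' s'' : State} (h : SameVars X s s')
    (h' : SameVars X s' s'') : SameVars X s s'' := fun x hx => (h' x hx).trans (h x hx)

theorem SameVars.mono {X Y : List ℕ} {s s' : State} (h : SameVars X s s')
    (hXY : ∀ x ∈ X, x ∈ Y) : SameVars Y s s' := fun x hx => h x fun hx' => hx (hXY x hx')

/-- Copying the reversal of the segment from variable `21` to variable `22`. -/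
def revCopyBody : Cmd :=
  .seq (.put 12 (.var 23) (.get 4 (.var 21 + .var 22 - .var 23)))
    (.seq (.put 13 (.var 23) (.get 6 (.var 21 + .var 22 + .const 1 - .var 23)))
      (.assign 23 (.var 23 + .const 1)))

/-- Writing back the reversed segment. -/
def revWriteBody : Cmd :=
  .seq (.put 4 (.var 23) (.get 12 (.var 23)))
    (.seq (.put 6 (.var 23) (.get 13 (.var 23)))
      (.seq (.put 5 (.get 12 (.var 23)) (.var 23 + .const 1))
        (.assign 23 (.var 23 + .const 1))))

/-- The loop condition while passing through the segment. -/
def revCond : Expr := .bin .lt (.var 23) (.var 22 + .const 1)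

/-- Reversal of the segment of positions from variable `21` to variable `22`. -/
def revCmd : Cmd :=
  .seq (.assign 23 (.var 21)) (.seq (.loop revCond revCopyBody)
    (.seq (.assign 23 (.var 21)) (.loop revCond revWriteBody)))

section

variable {n M N W : ℕ} {a : ℕ → ℕ → Prop} {eu ev q ps L col : ℕ → ℕ} {s : State}

open Packing

/-- The reversed segment goes through the auxiliary arrays `12` and `13`, because writing in place
would destroy entries that are still to be read. The flag at `d + 1` is not touched; it is zero
before and after. The time is `O(N)` because `d < N`. -/
theorem runs_revCmd (hW : 2 * n + M + 5 ≤ W) (hA : Agreement n M a eu ev)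
    (hm : Mem n M N eu ev q ps L s) (hP : Packing n N a q ps L) {b d : ℕ} (hb : s.var 21 = b)
    (hd : s.var 22 = d) (hbd : b ≤ d) (hdN : d < N) (hLb : L b = 0) (hLd : L (d + 1) = 0) :
    Runs W revCmd s (60 * (N + 1)) (fun s' => ∃ ps',
      Mem n M N eu ev (revSeq b d q) ps' (revLink b d L) s' ∧
      Packing n N a (revSeq b d q) ps' (revLink b d L) ∧
      (∀ v < n, ps' v = revPos b d ps v) ∧
      SameVars [23] s s') := by
  have hW1 : 1 < W := by omega
  have hNn := hP.N_le
  obtain ⟨m1, m2, m3, m4, m5, m6, m7, m8⟩ := hm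
  have step1 : Runs W (.assign 23 (.var 21)) s 2 (fun s' => s'.arr = s.arr ∧
      SameVars [23] s s' ∧ s'.var 23 = b) := by
    refine Runs.of_wp_le hW1 (by decide) ?_
    simp only [wp_assign, fits_var, val_var, true_and]
    refine ⟨rfl, fun x hx => ?_, by simp [hb]⟩
    simp at hx
    simp [hx]
  have step2 : ∀ s1 : State, s1.arr = s.arr ∧ SameVars [23] s s1 ∧ s1.var 23 = b →
      Runs W (.loop revCond revCopyBody) s1 ((d + 1 - b) * (5 + 1 + 24) + 5 + 1) (fun s' =>
        SameVars [23] s s' ∧ (∀ x, x ≠ 12 → x ≠ 13 → s'.arr x = s.arr x) ∧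
        ∀ r, b ≤ r → r ≤ d → s'.arr 12 r = q (b + d - r) ∧ s'.arr 13 r = L (b + d + 1 - r)) := by
    rintro s1 ⟨h1, h2, h3⟩
    refine (Runs.loop hW1 (fun k s' => SameVars [23] s s' ∧ s'.var 23 = b + k ∧ k ≤ d + 1 - b ∧
      (∀ x, x ≠ 12 → x ≠ 13 → s'.arr x = s.arr x) ∧
      ∀ r, b ≤ r → r < b + k → s'.arr 12 r = q (b + d - r) ∧ s'.arr 13 r = L (b + d + 1 - r))
      (d + 1 - b) 24 ?_ ?_ ?_).mono le_rfl ?_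
    · rintro k s' ⟨i1, i2, i3, i4, i5⟩
      have e22 := i1 22 (by decide)
      simp [revCond]; omega
    · rintro k s' ⟨i1, i2, i3, i4, i5⟩ hv
      have e22 := i1 22 (by decide)
      have e21 := i1 21 (by decide)
      simp [revCond] at hv
      refine ⟨by omega, Runs.of_wp_le hW1 (by decide) ?_⟩
      have a4 := i4 4 (by decide) (by decide)
      have a6 := i4 6 (by decide) (by decide)
      simp [revCopyBody, e21, e22, hb, hd, i2, a4, a6, m6, m8]
      refine ⟨by omega, by omega, by omega, fun x hx => ?_, by omega, by omega, ?_, ?_⟩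
      · simp at hx
        simp [hx, i1 x (by simpa using hx)]
      · intro x h12 h13
        simp [h12, h13, i4 x h12 h13]
      · intro r r1 r2
        by_cases hr : r = b + k
        · subst hr; simp
        · simp [Function.update_of_ne hr, i5 r r1 (by omega)]
    · exact ⟨h2, h3, by omega, fun x _ _ => by rw [h1], fun r r1 r2 => by omega⟩
    · rintro s' ⟨k, hk, ⟨i1, i2, i3, i4, i5⟩, hv⟩
      have e22 := i1 22 (by decide)
      simp [revCond] at hv
      exact ⟨i1, i4, fun r r1 r2 => i5 r r1 (by omega)⟩
  have step3 : ∀ s1 : State, (SameVars [23] s s1 ∧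
        (∀ x, x ≠ 12 → x ≠ 13 → s1.arr x = s.arr x) ∧
        ∀ r, b ≤ r → r ≤ d → s1.arr 12 r = q (b + d - r) ∧ s1.arr 13 r = L (b + d + 1 - r)) →
      Runs W (.assign 23 (.var 21)) s1 2 (fun s' => (SameVars [23] s s' ∧
        (∀ x, x ≠ 12 → x ≠ 13 → s'.arr x = s.arr x) ∧
        ∀ r, b ≤ r → r ≤ d → s'.arr 12 r = q (b + d - r) ∧ s'.arr 13 r = L (b + d + 1 - r)) ∧
        s'.var 23 = b) := by
    rintro s1 ⟨h1, h2, h3⟩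
    refine Runs.of_wp_le hW1 (by decide) ?_
    simp only [wp_assign, fits_var, val_var, true_and]
    refine ⟨⟨fun x hx => ?_, h2, h3⟩, by simp [h1 21 (by decide), hb]⟩
    simp at hx
    simp [hx, h1 x (by simpa using hx)]
  have step4 : ∀ s1 : State, ((SameVars [23] s s1 ∧
        (∀ x, x ≠ 12 → x ≠ 13 → s1.arr x = s.arr x) ∧
        ∀ r, b ≤ r → r ≤ d → s1.arr 12 r = q (b + d - r) ∧ s1.arr 13 r = L (b + d + 1 - r)) ∧
        s1.var 23 = b) →
      Runs W (.loop revCond revWriteBody) s1 ((d + 1 - b) * (5 + 1 + 23) + 5 + 1)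
        (fun s' => ∃ ps',
          Mem n M N eu ev (revSeq b d q) ps' (revLink b d L) s' ∧
          (∀ v < n, ps' v = revPos b d ps v) ∧ SameVars [23] s s') := by
    rintro s1 ⟨⟨h1, h2, h3⟩, h4⟩
    -- After `k` rounds, exactly the entries for new positions below `b + k` are up to date; in `ps`
    -- these are the jobs whose reflected value is at most `b + k`.
    refine (Runs.loop hW1 (fun k s' => SameVars [23] s s' ∧ s'.var 23 = b + k ∧ k ≤ d + 1 - b ∧
      s'.arr 10 = eu ∧ s'.arr 11 = ev ∧
      (∀ r, b ≤ r → r ≤ d → s'.arr 12 r = q (b + d - r) ∧ s'.arr 13 r = L (b + d + 1 - r)) ∧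
      s'.arr 4 = (fun r => if b ≤ r ∧ r < b + k then q (b + d - r) else q r) ∧
      s'.arr 6 = (fun r => if b ≤ r ∧ r < b + k then L (b + d + 1 - r) else L r) ∧
      ∀ v < n, s'.arr 5 v =
        if b < ps v ∧ ps v ≤ d + 1 ∧ b + d + 2 - ps v ≤ b + k then b + d + 2 - ps v else ps v)
      (d + 1 - b) 23 ?_ ?_ ?_).mono le_rfl ?_
    · rintro k s' ⟨i1, i2, i3, i4⟩
      have e22 := i1 22 (by decide)
      simp [revCond]; omega
    · rintro k s' ⟨i1, i2, i3, i4, i5, i6, i7, i8, i9⟩ hv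
      have e22 := i1 22 (by decide)
      simp [revCond] at hv
      refine ⟨by omega, Runs.of_wp_le hW1 (by decide) ?_⟩
      obtain ⟨t1, t2⟩ := i6 (b + k) (by omega) (by omega)
      simp [revWriteBody, i2, t1, t2]
      refine ⟨by omega, fun x hx => ?_, by omega, by omega, i4, i5, i6, ?_, ?_, ?_⟩
      · simp at hx
        simp [hx, i1 x (by simpa using hx)]
      · rw [i7]
        funext r
        by_cases hr : r = b + k
        · subst hr; simp
        · rw [Function.update_of_ne hr]
          congr 1
          exact propext (by omega)
      · rw [i8]
        funext r
        by_cases hr : r = b + k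
        · subst hr; simp
        · rw [Function.update_of_ne hr]
          congr 1
          exact propext (by omega)
      · intro v hvn
        by_cases hr : v = q (b + d - (b + k))
        · subst hr
          rw [Function.update_self, hP.ps_q (by omega), if_pos (by omega)]
          omega
        · have hne : ps v ≠ b + d - (b + k) + 1 := fun h =>
            hr (by rw [← hP.q_ps hvn, h]; rfl)
          have := hP.ps_pos hvn
          rw [Function.update_of_ne hr, i9 v hvn]
          congr 1
          exact propext (by omega)
    · refine ⟨h1, h4, by omega, ?_, ?_, h3, ?_, ?_, ?_⟩
      · rw [h2 10 (by decide) (by decide), m4]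
      · rw [h2 11 (by decide) (by decide), m5]
      · rw [h2 4 (by decide) (by decide), m6]
        funext r
        rw [if_neg (by omega)]
      · rw [h2 6 (by decide) (by decide), m8]
        funext r
        rw [if_neg (by omega)]
      · intro v hvn
        rw [h2 5 (by decide) (by decide), m7, if_neg (by omega)]
    · rintro s' ⟨k, hk, ⟨i1, i2, i3, i4, i5, i6, i7, i8, i9⟩, hv⟩
      have e22 := i1 22 (by decide)
      simp [revCond] at hv
      have hkd : b + k = d + 1 := by omega
      refine ⟨s'.arr 5, ⟨?_, ?_, ?_, i4, i5, ?_, rfl, ?_⟩, ?_, i1⟩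
      · rw [i1 0 (by decide), m1]
      · rw [i1 1 (by decide), m2]
      · rw [i1 2 (by decide), m3]
      · rw [i7]
        funext r
        rw [revSeq]
        congr 1
        exact propext (by omega)
      · rw [i8]
        funext r
        rw [revLink]
        congr 1
        exact propext (by omega)
      · intro v hvn
        rw [i9 v hvn, revPos]
        congr 1
        exact propext (by omega)
  refine (step1.seq fun s1 k1 => (step2 s1 k1).seq fun s2 k2 => (step3 s2 k2).seq step4).mono
    (by omega) ?_
  rintro s' ⟨ps', g1, g2, g3⟩
  exact ⟨ps', g1, hP.reverse hbd hdN hLb hLd g2 hA.lt hA.symm, g2, g3⟩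

end

end FlowShop

/-! ### Linking two vertices -/

namespace FlowShop

open WordRAM

/-- Variable `22` walks from the position in variable `21` to the end of its path. -/
def walkCmd : Cmd :=
  .seq (.assign 22 (.var 21))
    (.loop (.get 6 (.var 22 + .const 1)) (.assign 22 (.var 22 + .const 1)))

/-- Reverses the path of the job in variable `w`, which is an end of this path, if necessary, so
that the job is its last one. -/
def makeLastCmd (w : ℕ) : Cmd :=
  .seq (.assign 21 (.get 5 (.var w) - .const 1))
    (.cond (.bin .eq (.get 6 (.var 21)) (.const 0)) (.seq walkCmd revCmd) .nop)

/-- Finds the segment between the jobs in the variables `19` and `20`. -/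
def segmentCmd : Cmd :=
  .cond (.bin .lt (.get 5 (.var 19)) (.get 5 (.var 20)))
    (.seq (.assign 21 (.get 5 (.var 19))) (.assign 22 (.get 5 (.var 20) - .const 1)))
    (.seq (.assign 21 (.get 5 (.var 20))) (.assign 22 (.get 5 (.var 19) - .const 1)))

/-- Joins the paths that end in the jobs in the variables `19` and `20` by an edge between these
jobs. -/
def linkCmd : Cmd :=
  .seq (makeLastCmd 19) (.seq (makeLastCmd 20) (.seq segmentCmd (.seq revCmd
    (.put 6 (.var 21) (.const 1)))))

/-- Ends of different paths that are adjacent. -/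
structure Linkable (a : ℕ → ℕ → Prop) (dg col : ℕ → ℕ) (u v : ℕ) : Prop where
  deg_fst : dg u ≤ 1
  deg_snd : dg v ≤ 1
  col_ne : col u ≠ col v
  adj : a u v

/-- The degrees after joining `u` and `v`. -/
def linkDeg (dg : ℕ → ℕ) (u v x : ℕ) : ℕ :=
  dg x + (if x = u then 1 else 0) + (if x = v then 1 else 0)

/-- The colours after joining `u` and `v`. -/
def linkCol (col : ℕ → ℕ) (u v x : ℕ) : ℕ := if col x = col v then col u else col x

section

variable {n M N W : ℕ} {a : ℕ → ℕ → Prop} {eu ev q ps L col dg : ℕ → ℕ} {s : State}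

open Packing

theorem Mem.of_sameVars (hm : Mem n M N eu ev q ps L s) {s' : State} {X : List ℕ}
    (hX : SameVars X s s') (h0 : 0 ∉ X) (h1 : 1 ∉ X) (h2 : 2 ∉ X)
    (harr : ∀ x, x = 10 ∨ x = 11 ∨ x = 4 ∨ x = 5 ∨ x = 6 → s'.arr x = s.arr x) :
    Mem n M N eu ev q ps L s' := by
  obtain ⟨m1, m2, m3, m4, m5, m6, m7, m8⟩ := hm
  refine ⟨?_, ?_, ?_, ?_, ?_, ?_, ?_, ?_⟩
  · rw [hX 0 h0, m1]
  · rw [hX 1 h1, m2]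
  · rw [hX 2 h2, m3]
  · rw [harr 10 (by simp), m4]
  · rw [harr 11 (by simp), m5]
  · rw [harr 4 (by simp), m6]
  · rw [harr 5 (by simp), m7]
  · rw [harr 6 (by simp), m8]

/-- The walk stops after at most `N` rounds, because no flag is set from position `N` on. -/
theorem runs_walkCmd (hW : 2 * n + M + 5 ≤ W) (hm : Mem n M N eu ev q ps L s)
    (hP : Packing n N a q ps L) {b : ℕ} (hb : s.var 21 = b) (hbN : b < N) :
    Runs W walkCmd s (12 * (N + 1)) (fun s' => Mem n M N eu ev q ps L s' ∧ SameVars [22] s s' ∧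
      ∃ d, s'.var 22 = d ∧ b ≤ d ∧ d < N ∧ L (d + 1) = 0 ∧ ∀ t, b < t → t ≤ d → L t ≠ 0) := by
  have hW1 : 1 < W := by omega
  have hNn := hP.N_le
  have step1 : Runs W (.assign 22 (.var 21)) s 2 (fun s' => Mem n M N eu ev q ps L s' ∧
      SameVars [22] s s' ∧ s'.var 22 = b) := by
    refine Runs.of_wp_le hW1 (by decide) ?_
    simp only [wp_assign, fits_var, val_var, true_and]
    have hX : SameVars [22] s (s.setVar 22 (s.var 21)) := by
      intro x hx
      simp at hx
      simp [hx]
    exact ⟨hm.of_sameVars hX (by decide) (by decide) (by decide) fun _ _ => rfl, hX, by simp [hb]⟩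
  refine (step1.seq (T' := 9 * N + 5) fun s1 h1 => Runs.loop_le hW1 (fun k s' => Mem n M N eu ev q ps L s' ∧
    SameVars [22] s s' ∧ s'.var 22 = b + k ∧ b + k < N ∧ ∀ t, b < t → t ≤ b + k → L t ≠ 0)
    N 4 4 _ rfl (by omega) ?_ ?_ ?_ ?_).mono (by omega) fun _ h => h
  · rintro k s' ⟨i1, i2, i3, i4, i5⟩
    simp; omega
  · rintro k s' ⟨i1, i2, i3, i4, i5⟩ hv
    simp [i1.arr_L, i3] at hv
    have hlt := hP.L_lt hv
    refine ⟨by omega, Runs.of_wp_le hW1 (by decide) ?_⟩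
    simp only [wp_assign, fits_add, fits_var, fits_const, val_add, val_var, val_const, i3]
    have hX : SameVars [22] s' (s'.setVar 22 (b + k + 1)) := by
      intro x hx
      simp at hx
      simp [hx]
    refine ⟨⟨trivial, by omega, by omega⟩,
      i1.of_sameVars hX (by decide) (by decide) (by decide) fun _ _ => rfl, i2.trans hX,
      by simp; omega, by omega, fun t t1 t2 => ?_⟩
    by_cases ht : t = b + k + 1
    · rw [ht]; exact hv
    · exact i5 t t1 (by omega)
  · exact ⟨h1.1, h1.2.1, h1.2.2, hbN, fun t t1 t2 => by omega⟩
  · rintro k s' hk ⟨i1, i2, i3, i4, i5⟩ hv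
    simp [i1.arr_L, i3] at hv
    exact ⟨i1, i2, b + k, i3, by omega, i4, hv, i5⟩

/-- If the flag before `u` vanishes, `u` is first on its path and reversing the path makes it last.
Otherwise degree at most one forces the flag after `u` to vanish. That last jobs of other paths stay
last allows the procedure to be applied to two paths in turn. -/
theorem runs_makeLastCmd (hW : 2 * n + M + 5 ≤ W) (hA : Agreement n M a eu ev)
    (hm : Mem n M N eu ev q ps L s) (hP : Packing n N a q ps L) (hC : Colored n q L col)
    {w u : ℕ} (hw : s.var w = u) (hun : u < n) (huN : ps u ≤ N) (hdu : deg ps L u ≤ 1) :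
    Runs W (makeLastCmd w) s (90 * (N + 1)) (fun s' => ∃ q' ps' L',
      Mem n M N eu ev q' ps' L' s' ∧ Packing n N a q' ps' L' ∧ Colored n q' L' col ∧
      (∀ v < n, deg ps' L' v = deg ps L v) ∧ L' (ps' u) = 0 ∧
      (∀ v < n, col v ≠ col u → L (ps v) = 0 → L' (ps' v) = 0) ∧
      SameVars [21, 22, 23] s s') := by
  have hW1 : 1 < W := by omega
  have hNn := hP.N_le
  have hpos := hP.ps_pos hun
  have step1 : Runs W (.assign 21 (.get 5 (.var w) - .const 1)) s 5
      (fun s' => Mem n M N eu ev q ps L s' ∧ SameVars [21, 22, 23] s s' ∧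
        s'.var 21 = ps u - 1) := by
    refine Runs.of_wp_le hW1 (by show 5 ≤ 5; decide) ?_
    simp only [wp_assign, fits_sub, fits_get, fits_var, fits_const, val_sub, val_get, val_var,
      val_const, hw, hm.arr_ps, true_and]
    have hX : SameVars [21, 22, 23] s (s.setVar 21 (ps u - 1)) := by
      intro x hx
      simp at hx
      simp [hx]
    exact ⟨hW1, hm.of_sameVars hX (by decide) (by decide) (by decide) fun _ _ => rfl, hX, by simp⟩
  refine (step1.seq (T' := 5 + (72 * (N + 1))) fun s1 ⟨k1, k2, k3⟩ =>
    Runs.cond (T := 72 * (N + 1)) hW1 (e := .bin .eq (.get 6 (.var 21)) (.const 0)) (by simp; omega)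
    (fun hv => ?_) (fun hv => ?_)).mono (by omega) fun _ h => h
  · simp [k1.arr_L, k3] at hv
    refine ((runs_walkCmd hW k1 hP k3 (by omega)).seq (T' := 60 * (N + 1))
      fun s2 ⟨l1, l2, d, l3, l4, l5, l6, l7⟩ => ?_).mono (by omega) fun _ h => h
    refine (runs_revCmd hW hA l1 hP ((l2 21 (by decide)).trans k3) l3 l4 l5 hv l6).mono le_rfl ?_
    rintro s' ⟨ps', r1, r2, r3, r4⟩
    refine ⟨_, ps', _, r1, r2, colored_reverse hC l4 (by omega) hv l6 hP.L_zero,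
      fun v hvn => hP.deg_reverse l4 hv l6 r3 hvn, ?_, ?_, ?_⟩
    · rw [r3 u hun, revPos, if_pos (by omega), revLink, if_neg (by omega),
        show ps u - 1 + d + 2 - ps u = d + 1 by omega, l6]
    · intro v hvn hcol hLv
      have hnot : ¬ (ps u - 1 < ps v ∧ ps v ≤ d + 1) := by
        rintro ⟨h1, h2⟩
        apply hcol
        have := hC.eq_of_links (i := ps u - 1) (j := ps v - 1) (by omega) (by omega)
          fun t t1 t2 => l7 t t1 (by omega)
        rw [hP.q_ps hvn, hP.q_ps hun] at this
        exact this.symm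
      rw [r3 v hvn, revPos, if_neg hnot, revLink]
      split_ifs with h
      · rw [show ps u - 1 + d + 1 - ps v = d + 1 by omega, l6]
      · exact hLv
    · exact k2.trans ((l2.mono (by simp)).trans (r4.mono (by simp)))
  · simp [k1.arr_L, k3] at hv
    refine (Runs.of_wp hW1 (P := .nop) ?_).mono (show 1 ≤ _ by omega) fun _ h => h
    refine ⟨q, ps, L, k1, hP, hC, fun _ _ => rfl, ?_, fun _ _ _ h => h, k2⟩
    unfold deg at hdu
    omega

/-- Once both jobs are last on their paths, let `x` be the left one and `y` the right one. The
segment from just after `x` up to `y` consists of whole paths, so reversing it puts `y` directly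
behind `x`, and the flag at `ps x` can be set. The outcome is described through degrees and colours
of jobs, which decide whether a further edge may be added however the paths are arranged. -/
theorem runs_linkCmd (hW : 2 * n + M + 5 ≤ W) (hA : Agreement n M a eu ev)
    (hm : Mem n M N eu ev q ps L s) (hP : Packing n N a q ps L) (hC : Colored n q L col)
    {u v : ℕ} (hu : s.var 19 = u) (hv : s.var 20 = v)
    (hdg : ∀ x < n, deg ps L x = dg x) (hL : Linkable a dg col u v) :
    Runs W linkCmd s (300 * (N + 1)) (fun s' => ∃ q' ps' L',
      Mem n M N eu ev q' ps' L' s' ∧ Packing n N a q' ps' L' ∧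
      Colored n q' L' (linkCol col u v) ∧
      (∀ x < n, deg ps' L' x = linkDeg dg u v x) ∧
      SameVars [21, 22, 23] s s') := by
  have hW1 : 1 < W := by omega
  have hNn := hP.N_le
  have hun := hA.lt hL.adj
  have hvn := hA.lt (hA.symm hL.adj)
  have huv : u ≠ v := fun h => hL.col_ne (by rw [h])
  refine ((runs_makeLastCmd hW hA hm hP hC hu hun (hP.ps_le_of_adj hL.adj)
    (by rw [hdg u hun]; exact hL.deg_fst)).seq (T' := 200 * (N + 1))
    fun s1 ⟨q1, ps1, L1, a1, a2, a3, a4, a5, a6, a7⟩ => ?_).mono (by omega) fun _ h => h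
  refine ((runs_makeLastCmd hW hA a1 a2 a3 ((a7 20 (by decide)).trans hv) hvn
    (a2.ps_le_of_adj (hA.symm hL.adj))
    (by rw [a4 v hvn, hdg v hvn]; exact hL.deg_snd)).seq (T' := 110 * (N + 1))
    fun s2 ⟨q2, ps2, L2, b1, b2, b3, b4, b5, b6, b7⟩ => ?_).mono (by omega) fun _ h => h
  have hLu : L2 (ps2 u) = 0 := b6 u hun hL.col_ne a5
  have e19 : s2.var 19 = u := (b7 19 (by decide)).trans ((a7 19 (by decide)).trans hu)
  have e20 : s2.var 20 = v := (b7 20 (by decide)).trans ((a7 20 (by decide)).trans hv)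
  have pu := b2.ps_pos hun
  have pv := b2.ps_pos hvn
  have puv : ps2 u ≠ ps2 v := fun h => huv (b2.ps_inj hun hvn h)
  have step : Runs W segmentCmd s2 30 (fun s' => Mem n M N eu ev q2 ps2 L2 s' ∧
      SameVars [21, 22, 23] s2 s' ∧ ∃ x y, s'.var 21 = ps2 x ∧ s'.var 22 = ps2 y - 1 ∧
        ps2 x < ps2 y ∧ ((x = u ∧ y = v) ∨ (x = v ∧ y = u))) := by
    refine Runs.of_wp_le hW1 (by decide) ?_
    simp only [segmentCmd, wp_cond, wp_seq, wp_assign, val_lt, fits_lt, fits_get, fits_var,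
      fits_sub, fits_const, val_get, val_var, val_sub, val_const, setVar_var, setVar_arr,
      b1.arr_ps, e19, e20, true_and, and_true]
    refine ⟨fun h => ?_, fun h => ?_⟩
    · have hlt : ps2 u < ps2 v := by by_contra hc; simp [hc] at h
      simp only [Nat.reduceEqDiff, if_false]
      refine ⟨hW1, b1.of_sameVars (X := [21, 22, 23]) ?_ (by decide) (by decide) (by decide)
        fun _ _ => rfl, ?_, u, v, by simp, by simp, hlt, Or.inl ⟨rfl, rfl⟩⟩ <;>
      · intro x hx
        simp at hx
        simp [hx]
    · have hlt : ps2 v < ps2 u := by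
        by_contra hc
        have : ps2 u < ps2 v := by omega
        simp [this] at h
      simp only [Nat.reduceEqDiff, if_false]
      refine ⟨hW1, b1.of_sameVars (X := [21, 22, 23]) ?_ (by decide) (by decide) (by decide)
        fun _ _ => rfl, ?_, v, u, by simp, by simp, hlt, Or.inr ⟨rfl, rfl⟩⟩ <;>
      · intro x hx
        simp at hx
        simp [hx]
  refine (step.seq (T' := 64 * (N + 1)) fun s3 ⟨c1, c2, x, y, c3, c4, c5, c6⟩ => ?_).mono
    (by omega) fun _ h => h
  have hx : x < n ∧ L2 (ps2 x) = 0 := by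
    rcases c6 with ⟨rfl, rfl⟩ | ⟨rfl, rfl⟩
    exacts [⟨hun, hLu⟩, ⟨hvn, b5⟩]
  have hy : y < n ∧ L2 (ps2 y) = 0 := by
    rcases c6 with ⟨rfl, rfl⟩ | ⟨rfl, rfl⟩
    exacts [⟨hvn, b5⟩, ⟨hun, hLu⟩]
  have hxy : a x y := by
    rcases c6 with ⟨rfl, rfl⟩ | ⟨rfl, rfl⟩
    exacts [hL.adj, hA.symm hL.adj]
  have px := b2.ps_pos hx.1
  have hyN := b2.ps_le_of_adj (hA.symm hxy)
  have hy1 : L2 (ps2 y - 1 + 1) = 0 := by rw [Nat.sub_add_cancel (by omega)]; exact hy.2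
  refine ((runs_revCmd hW hA c1 b2 c3 c4 (by omega) (by omega) hx.2 hy1).seq (T' := 4)
    fun s4 ⟨ps', d1, d2, d3, d4⟩ => ?_).mono (by omega) fun _ h => h
  have hqx : revSeq (ps2 x) (ps2 y - 1) q2 (ps2 x - 1) = x := by
    rw [revSeq, if_neg (by omega), b2.q_ps hx.1]
  have hqy : revSeq (ps2 x) (ps2 y - 1) q2 (ps2 x) = y := by
    rw [revSeq, if_pos (by omega), show ps2 x + (ps2 y - 1) - ps2 x = ps2 y - 1 by omega,
      b2.q_ps hy.1]
  have hL0 : revLink (ps2 x) (ps2 y - 1) L2 (ps2 x) = 0 := by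
    rw [revLink, if_pos (by omega), show ps2 x + (ps2 y - 1) + 1 - ps2 x = ps2 y - 1 + 1 by omega,
      hy1]
  have hxN : ps2 x < N := by omega
  refine Runs.of_wp_le hW1 (by decide) ?_
  have e21 : s4.var 21 = ps2 x := (d4 21 (by decide)).trans c3
  simp only [wp_put, fits_var, fits_const, val_var, val_const, e21, true_and]
  refine ⟨hW1, _, ps', Function.update (revLink (ps2 x) (ps2 y - 1) L2) (ps2 x) 1, ?_,
    d2.join (by omega) hxN (by rw [hqx, hqy]; exact hxy), ?_, ?_, ?_⟩
  · obtain ⟨m1, m2, m3, m4, m5, m6, m7, m8⟩ := d1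
    exact ⟨m1, m2, m3, by simpa using m4, by simpa using m5, by simpa using m6, by simpa using m7,
      by simp [m8]⟩
  · refine colored_join (colored_reverse b3 (by omega) (by omega) hx.2 hy1 b2.L_zero) (by omega)
      hL0 ?_
    rw [hqx, hqy]
    rcases c6 with ⟨rfl, rfl⟩ | ⟨rfl, rfl⟩
    exacts [Or.inr ⟨rfl, rfl⟩, Or.inl ⟨rfl, rfl⟩]
  · intro z hz
    have h1 := d2.deg_update (i := ps2 x) (x := 1) (by omega) (by omega) hz
    rw [hqx, hqy, hL0, b2.deg_reverse (by omega) hx.2 hy1 d3 hz, b4 z hz, a4 z hz, hdg z hz] at h1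
    unfold linkDeg
    rcases c6 with ⟨rfl, rfl⟩ | ⟨rfl, rfl⟩ <;> simp only [ite_self] at h1 <;> omega
  · intro z hz
    rw [setArr_var, d4 z (by simp at hz ⊢; omega), c2 z hz, b7 z hz,
      a7 z hz]

end

end FlowShop

/-! ### Improving exchanges -/

namespace FlowShop

open WordRAM Packing

/-- The first position of the path through the position `i`. -/
def blockStart (L : ℕ → ℕ) : ℕ → ℕ
  | 0 => 0
  | i + 1 => if L (i + 1) = 0 then i + 1 else blockStart L i

theorem blockStart_le (L : ℕ → ℕ) (i : ℕ) : blockStart L i ≤ i := by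
  induction i with
  | zero => exact le_rfl
  | succ i ih => rw [blockStart]; split_ifs <;> omega

theorem le_blockStart {L : ℕ → ℕ} {i j : ℕ} (hi : L i = 0) (hij : i ≤ j) : i ≤ blockStart L j := by
  induction j with
  | zero => omega
  | succ j ih =>
    rw [blockStart]
    split_ifs with h
    · exact hij
    · have : i ≠ j + 1 := by rintro rfl; exact h hi
      exact ih (by omega)

/-- The canonical colouring of a packing: the first position of the path of a job. -/
def blockCol (ps L : ℕ → ℕ) (v : ℕ) : ℕ := blockStart L (ps v - 1)

/-- `x` is an end of a path and has the neighbour `v` on another path. -/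
structure Ext (a : ℕ → ℕ → Prop) (dg col : ℕ → ℕ) (x v : ℕ) : Prop where
  adj : a x v
  deg_le : dg x ≤ 1
  col_ne : col x ≠ col v

/-- An improving exchange: either joining two paths by the edge `u₁v₁`, or removing the edge
between the positions `i - 1` and `i` and adding `u₂v₂` and `u₁v₁`. -/
def GoodMove (n : ℕ) (a : ℕ → ℕ → Prop) (q ps L col : ℕ → ℕ) (u₁ v₁ u₂ v₂ i : ℕ) (f : ℕ) : Prop :=
  (f = 1 ∧ Linkable a (deg ps L) col u₁ v₁) ∨
  (f = 2 ∧ L i ≠ 0 ∧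
    Linkable a (deg ps (Function.update L i 0)) (cutCol n q ps col i) u₂ v₂ ∧
    Linkable a (linkDeg (deg ps (Function.update L i 0)) u₂ v₂)
      (linkCol (cutCol n q ps col i) u₂ v₂) u₁ v₁)

/-- There is no improving exchange. -/
structure Stuck (n : ℕ) (a : ℕ → ℕ → Prop) (q ps L col : ℕ → ℕ) : Prop where
  join : ∀ {u v}, Ext a (deg ps L) col u v → ¬ deg ps L v ≤ 1
  exchange : ∀ {b x y}, L b ≠ 0 → Ext a (deg ps L) col x (q (b - 1)) →
    Ext a (deg ps L) col y (q b) → x = y ∧ deg ps L x ≠ 0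
  rotate : ∀ {b i y}, L b ≠ 0 → i < b → L i = 0 → col (q i) = col (q b) → a (q i) (q b) →
    ¬ Ext a (deg ps L) col y (q (b - 1))
  rotate' : ∀ {b i y}, L b ≠ 0 → i < n → b ≤ i → L (i + 1) = 0 → col (q i) = col (q b) →
    a (q i) (q (b - 1)) → ¬ Ext a (deg ps L) col y (q b)

variable {n M N W : ℕ} {a : ℕ → ℕ → Prop} {eu ev q ps L col dg : ℕ → ℕ} {s : State}

namespace Packing

/-- For two positions separated by a zero flag at `i`, the paths of the left and of the right one
begin before `i` and not before `i`, respectively. -/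
theorem colored_blockCol (h : Packing n N a q ps L) : Colored n q L (blockCol ps L) := by
  constructor
  · intro i hin hi
    have h0 : i ≠ 0 := by rintro rfl; exact hi h.L_zero
    obtain ⟨j, rfl⟩ : ∃ j, i = j + 1 := ⟨i - 1, by omega⟩
    rw [blockCol, blockCol, h.ps_q hin, h.ps_q (by omega)]
    simp [blockStart, hi]
  · intro i i' j' hi h1 h2 h3
    rw [blockCol, blockCol, h.ps_q h3, h.ps_q (by omega)]
    have b1 := blockStart_le L i'
    have b2 := le_blockStart hi h2
    simp only [Nat.add_sub_cancel]
    omega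

/-- This leaves `n` as a fresh colour for `cutCol`. -/
theorem blockCol_lt (h : Packing n N a q ps L) {v : ℕ} (hv : v < n) : blockCol ps L v < n := by
  have h1 := blockStart_le L (ps v - 1)
  have h2 := h.ps_pos hv
  have h3 := h.ps_le hv
  unfold blockCol
  omega

theorem deg_cut (h : Packing n N a q ps L) {i : ℕ} (hi : L i ≠ 0) {v : ℕ} (hv : v < n) :
    deg ps (Function.update L i 0) v + (if v = q (i - 1) then 1 else 0) +
      (if v = q i then 1 else 0) = deg ps L v := by
  have h0 : i ≠ 0 := by rintro rfl; exact hi h.L_zero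
  have h1 := h.L_lt hi
  have h2 := h.N_le
  have h3 := h.deg_update (x := 0) h0 (by omega) hv
  have h4 := h.L_le i
  rw [show L i = 1 by omega] at h3
  simpa using h3

/-- Cutting at `b` frees one degree at both ends of the edge. Joining `y` to the right part gives
that part the colour of `y`, while the left part keeps its old colour. So `x` can still be joined to
the left part, even if `x` and `y` were on the same path. If `x = y`, this vertex receives both
edges and must have been isolated. -/
theorem goodMove_exchange (h : Packing n N a q ps L) (hc : Colored n q L col)
    (hcol : ∀ z < n, col z < n) (hlt : ∀ {u v}, a u v → u < n) {b x y : ℕ} (hb : L b ≠ 0)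
    (hx : Ext a (deg ps L) col x (q (b - 1))) (hy : Ext a (deg ps L) col y (q b))
    (hxy : x = y → deg ps L x = 0) :
    GoodMove n a q ps L col x (q (b - 1)) y (q b) b 2 := by
  have hb0 : b ≠ 0 := by rintro rfl; exact hb h.L_zero
  have hbn : b < n := (h.L_lt hb).trans_le h.N_le
  have hxn := hlt hx.adj
  have hyn := hlt hy.adj
  have dx := h.deg_cut hb hxn
  have dy := h.deg_cut hb hyn
  have dp := h.deg_cut hb (h.q_lt (show b - 1 < n by omega))
  have dq := h.deg_cut hb (h.q_lt hbn)
  have lp := h.deg_le (q (b - 1))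
  have lq := h.deg_le (q b)
  have hpq : q (b - 1) ≠ q b := fun e => by have := h.q_inj (by omega) hbn e; omega
  have cpq := hc.eq hbn hb
  have pp := h.ps_q (show b - 1 < n by omega)
  have pq := h.ps_q hbn
  have hxp : x ≠ q (b - 1) := fun e => hx.col_ne (by rw [e])
  have hxq : x ≠ q b := fun e => hx.col_ne (by rw [e, cpq])
  have hyp : y ≠ q (b - 1) := fun e => hy.col_ne (by rw [e, cpq])
  have hyq : y ≠ q b := fun e => hy.col_ne (by rw [e])
  have cx := hcol x hxn
  have cy := hcol y hyn
  have cq := hcol (q b) (h.q_lt hbn)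
  simp only [hxp, hxq, hyp, hyq, hpq, hpq.symm, if_true, if_false, add_zero] at dx dy dp dq
  have k1 : cutCol n q ps col b x = col x := by
    rw [cutCol, if_neg fun e => hx.col_ne (e.1.trans cpq.symm)]
  have k2 : cutCol n q ps col b y = col y := by
    rw [cutCol, if_neg fun e => hy.col_ne e.1]
  have k3 : cutCol n q ps col b (q (b - 1)) = col (q b) := by
    rw [cutCol, if_neg (by omega), cpq]
  have k4 : cutCol n q ps col b (q b) = n := by
    rw [cutCol, if_pos ⟨rfl, by omega⟩]
  have xd := hx.deg_le
  have yd := hy.deg_le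
  have xc := hx.col_ne
  have yc := hy.col_ne
  rw [cpq] at xc
  refine Or.inr ⟨rfl, hb, ⟨by omega, by omega, by rw [k2, k4]; omega, hy.adj⟩,
    ⟨?_, ?_, ?_, hx.adj⟩⟩
  · unfold linkDeg
    rw [if_neg hxq]
    split_ifs with e
    · have := hxy e; omega
    · omega
  · unfold linkDeg
    rw [if_neg hyp.symm, if_neg hpq]
    omega
  · unfold linkCol
    rw [k1, k2, k3, k4, if_neg (by omega), if_neg (by omega)]
    exact xc

/-- Here `q i` is the first job of the path. After the cut, `y` is joined to the end `q (b - 1)` of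
the left part, whose other end `q i` is then joined to the start `q b` of the right part: the left
part has been turned around. No cycle arises, since the right part has the fresh colour `n` and the
left part that of `y`. -/
theorem goodMove_rotate (h : Packing n N a q ps L) (hc : Colored n q L col)
    (hcol : ∀ z < n, col z < n) (hlt : ∀ {u v}, a u v → u < n) {b i y : ℕ} (hb : L b ≠ 0)
    (hib : i < b) (hi : L i = 0) (hci : col (q i) = col (q b)) (hx : a (q i) (q b))
    (hy : Ext a (deg ps L) col y (q (b - 1))) :
    GoodMove n a q ps L col (q i) (q b) y (q (b - 1)) b 2 := by
  have hbn : b < n := (h.L_lt hb).trans_le h.N_le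
  have hyn := hlt hy.adj
  have dx := h.deg_cut hb (h.q_lt (show i < n by omega))
  have dy := h.deg_cut hb hyn
  have dp := h.deg_cut hb (h.q_lt (show b - 1 < n by omega))
  have dq := h.deg_cut hb (h.q_lt hbn)
  have lp := h.deg_le (q (b - 1))
  have lq := h.deg_le (q b)
  have hpq : q (b - 1) ≠ q b := fun e => by have := h.q_inj (by omega) hbn e; omega
  have hiq : q i ≠ q b := fun e => by have := h.q_inj (by omega) hbn e; omega
  have cpq := hc.eq hbn hb
  have pp := h.ps_q (show b - 1 < n by omega)
  have pq := h.ps_q hbn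
  have pi := h.ps_q (show i < n by omega)
  have hyp : y ≠ q (b - 1) := fun e => hy.col_ne (by rw [e])
  have hyq : y ≠ q b := fun e => hy.col_ne (by rw [e, cpq])
  have hyi : y ≠ q i := fun e => hy.col_ne (by rw [e, cpq, hci])
  have cy := hcol y hyn
  have cq := hcol (q b) (h.q_lt hbn)
  have xd : deg ps L (q i) ≤ 1 := by
    rw [h.deg_q (by omega), hi]
    have := h.L_le (i + 1)
    omega
  simp only [hiq, hyp, hyq, hpq, hpq.symm, if_true, if_false, add_zero] at dx dy dp dq
  have k1 : cutCol n q ps col b (q i) = col (q b) := by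
    rw [cutCol, if_neg (by omega), hci]
  have yc := hy.col_ne
  rw [cpq] at yc
  have k2 : cutCol n q ps col b y = col y := by
    rw [cutCol, if_neg fun e => yc e.1]
  have k3 : cutCol n q ps col b (q (b - 1)) = col (q b) := by
    rw [cutCol, if_neg (by omega), cpq]
  have k4 : cutCol n q ps col b (q b) = n := by
    rw [cutCol, if_pos ⟨rfl, by omega⟩]
  have yd := hy.deg_le
  refine Or.inr ⟨rfl, hb, ⟨by omega, by omega, by rw [k2, k3]; exact yc, hy.adj⟩,
    ⟨?_, ?_, ?_, hx⟩⟩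
  · unfold linkDeg
    rw [if_neg hyi.symm]
    omega
  · unfold linkDeg
    rw [if_neg hyq.symm, if_neg hpq.symm]
    omega
  · unfold linkCol
    rw [k1, k2, k3, k4, if_pos rfl, if_neg (by omega)]
    omega

/-- The mirror image, where the right part is turned around: `y` is joined to `q b`, and the last
job `q i` of the path to `q (b - 1)`. -/
theorem goodMove_rotate' (h : Packing n N a q ps L) (hc : Colored n q L col)
    (hcol : ∀ z < n, col z < n) (hlt : ∀ {u v}, a u v → u < n) {b i y : ℕ} (hb : L b ≠ 0)
    (hin : i < n) (hib : b ≤ i) (hi : L (i + 1) = 0) (hci : col (q i) = col (q b))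
    (hx : a (q i) (q (b - 1))) (hy : Ext a (deg ps L) col y (q b)) :
    GoodMove n a q ps L col (q i) (q (b - 1)) y (q b) b 2 := by
  have hbn : b < n := (h.L_lt hb).trans_le h.N_le
  have hb0 : b ≠ 0 := by rintro rfl; exact hb h.L_zero
  have hyn := hlt hy.adj
  have dx := h.deg_cut hb (h.q_lt hin)
  have dy := h.deg_cut hb hyn
  have dp := h.deg_cut hb (h.q_lt (show b - 1 < n by omega))
  have dq := h.deg_cut hb (h.q_lt hbn)
  have lp := h.deg_le (q (b - 1))
  have lq := h.deg_le (q b)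
  have hpq : q (b - 1) ≠ q b := fun e => by have := h.q_inj (by omega) hbn e; omega
  have hip : q i ≠ q (b - 1) := fun e => by have := h.q_inj hin (by omega) e; omega
  have cpq := hc.eq hbn hb
  have pp := h.ps_q (show b - 1 < n by omega)
  have pq := h.ps_q hbn
  have pi := h.ps_q hin
  have hyp : y ≠ q (b - 1) := fun e => hy.col_ne (by rw [e, cpq])
  have hyq : y ≠ q b := fun e => hy.col_ne (by rw [e])
  have hyi : y ≠ q i := fun e => hy.col_ne (by rw [e, hci])
  have cy := hcol y hyn
  have cq := hcol (q b) (h.q_lt hbn)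
  have xd : deg ps L (q i) ≤ 1 := by
    rw [h.deg_q hin, hi]
    have := h.L_le i
    omega
  simp only [hip, hyp, hyq, hpq, hpq.symm, if_true, if_false, add_zero] at dx dy dp dq
  have k1 : cutCol n q ps col b (q i) = n := by
    rw [cutCol, if_pos ⟨hci, by omega⟩]
  have yc := hy.col_ne
  have k2 : cutCol n q ps col b y = col y := by
    rw [cutCol, if_neg fun e => yc e.1]
  have k3 : cutCol n q ps col b (q (b - 1)) = col (q b) := by
    rw [cutCol, if_neg (by omega), cpq]
  have k4 : cutCol n q ps col b (q b) = n := by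
    rw [cutCol, if_pos ⟨rfl, by omega⟩]
  have yd := hy.deg_le
  refine Or.inr ⟨rfl, hb, ⟨by omega, by omega, by rw [k2, k4]; omega, hy.adj⟩,
    ⟨?_, ?_, ?_, hx⟩⟩
  · unfold linkDeg
    rw [if_neg hyi.symm]
    omega
  · unfold linkDeg
    rw [if_neg hyp.symm, if_neg hpq]
    omega
  · unfold linkCol
    rw [k1, k2, k3, k4, if_pos rfl, if_neg (by omega)]
    exact yc

end Packing

/-- What the marks know after the first `k` edges: `m₁ j` and `m₂ j`, if they are not `0`, are
`x + 1` and `y + 1` for two different ends `x`, `y` of other paths that are neighbours of the job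
at the position `j`. -/
structure Marks (N : ℕ) (a : ℕ → ℕ → Prop) (eu ev q ps L col m₁ m₂ : ℕ → ℕ) (k : ℕ) : Prop where
  fst : ∀ {j}, j < N → m₁ j ≠ 0 → Ext a (deg ps L) col (m₁ j - 1) (q j)
  snd : ∀ {j}, j < N → m₂ j ≠ 0 → Ext a (deg ps L) col (m₂ j - 1) (q j) ∧ m₁ j ≠ 0 ∧ m₁ j ≠ m₂ j
  complete : ∀ {e}, e < k → Ext a (deg ps L) col (eu e) (ev e) → ¬ deg ps L (ev e) ≤ 1 →
    m₁ (ps (ev e) - 1) = eu e + 1 ∨ (m₁ (ps (ev e) - 1) ≠ 0 ∧ m₂ (ps (ev e) - 1) ≠ 0)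

namespace Marks

variable {m₁ m₂ : ℕ → ℕ} {k : ℕ}

theorem skip (h : Marks N a eu ev q ps L col m₁ m₂ k)
    (hk : Ext a (deg ps L) col (eu k) (ev k) → ¬ deg ps L (ev k) ≤ 1 →
      m₁ (ps (ev k) - 1) = eu k + 1 ∨ (m₁ (ps (ev k) - 1) ≠ 0 ∧ m₂ (ps (ev k) - 1) ≠ 0)) :
    Marks N a eu ev q ps L col m₁ m₂ (k + 1) := by
  refine ⟨h.fst, h.snd, fun {e} he => ?_⟩
  by_cases hek : e = k
  · subst hek; exact hk
  · exact h.complete (by omega)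

/-- While the first mark is empty, completeness says that no earlier edge had to be recorded at this
position, so nothing is lost. -/
theorem put_fst (h : Marks N a eu ev q ps L col m₁ m₂ k) (hv : q (ps (ev k) - 1) = ev k)
    (hN : ps (ev k) - 1 < N)
    (hk : Ext a (deg ps L) col (eu k) (ev k)) (h0 : m₁ (ps (ev k) - 1) = 0) :
    Marks N a eu ev q ps L col (Function.update m₁ (ps (ev k) - 1) (eu k + 1)) m₂ (k + 1) := by
  constructor
  · intro j hj hne
    by_cases hjk : j = ps (ev k) - 1
    · rw [hjk, Function.update_self, hv]; exact hk
    · rw [Function.update_of_ne hjk] at hne ⊢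
      exact h.fst hj hne
  · intro j hj hne
    have := h.snd hj hne
    by_cases hjk : j = ps (ev k) - 1
    · subst hjk; exact (this.2.1 h0).elim
    · rw [Function.update_of_ne hjk]; exact this
  · intro e he hE hdeg
    by_cases hek : e = k
    · subst hek; left; simp
    · by_cases hjk : ps (ev e) - 1 = ps (ev k) - 1
      · have hm2 : m₂ (ps (ev k) - 1) = 0 := by
          by_contra hne
          exact (h.snd hN hne).2.1 h0
        have := h.complete (e := e) (by omega) hE hdeg
        rw [hjk] at this
        omega
      · rw [Function.update_of_ne hjk]
        exact h.complete (by omega) hE hdeg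

/-- Two marks at a position satisfy completeness for every edge into it, so an older second mark may
be overwritten. -/
theorem put_snd (h : Marks N a eu ev q ps L col m₁ m₂ k) (hv : q (ps (ev k) - 1) = ev k)
    (hk : Ext a (deg ps L) col (eu k) (ev k)) (h0 : m₁ (ps (ev k) - 1) ≠ 0)
    (h1 : m₁ (ps (ev k) - 1) ≠ eu k + 1) :
    Marks N a eu ev q ps L col m₁ (Function.update m₂ (ps (ev k) - 1) (eu k + 1)) (k + 1) := by
  constructor
  · exact h.fst
  · intro j hj hne
    by_cases hjk : j = ps (ev k) - 1
    · subst hjk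
      rw [Function.update_self, hv]; exact ⟨hk, h0, h1⟩
    · rw [Function.update_of_ne hjk] at hne ⊢
      exact h.snd hj hne
  · intro e he hE hdeg
    by_cases hjk : ps (ev e) - 1 = ps (ev k) - 1
    · right; rw [hjk, Function.update_self]; exact ⟨h0, by omega⟩
    · by_cases hek : e = k
      · subst hek; exact (hjk rfl).elim
      · rw [Function.update_of_ne hjk]
        exact h.complete (by omega) hE hdeg

end Marks

end FlowShop

/-! ### Loops over the edges -/

namespace FlowShop

open WordRAM Packing

/-- Loads the ends of the edge number `4` and their positions into the variables `5, …, 8`. -/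
def loadCmd : Cmd :=
  .seq (.assign 5 (.get 10 (.var 4))) (.seq (.assign 6 (.get 11 (.var 4)))
    (.seq (.assign 7 (.get 5 (.var 5) - .const 1)) (.assign 8 (.get 5 (.var 6) - .const 1))))

/-- Runs a program for every oriented edge. -/
def edgeLoop (P : Cmd) : Cmd :=
  .seq (.assign 4 (.const 0)) (.loop (.bin .lt (.var 4) (.var 1))
    (.seq loadCmd (.seq P (.assign 4 (.var 4 + .const 1)))))

/-- Variables `7` and `15` run through the positions and the beginnings of their paths. -/
def blockCmd : Cmd :=
  .seq (.assign 7 (.const 0)) (.loop (.bin .lt (.var 7) (.var 2))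
    (.seq (.cond (.get 6 (.var 7)) .nop (.assign 15 (.var 7)))
      (.seq (.put 7 (.var 7) (.var 15)) (.seq (.put 8 (.var 7) (.const 0))
        (.seq (.put 9 (.var 7) (.const 0)) (.assign 7 (.var 7 + .const 1)))))))

/-- Tests for an edge that joins two paths, and marks the second end of other edges from an end
of a path to another path. -/
def markCmd : Cmd :=
  .cond (.bin .lt (.get 6 (.var 7) + .get 6 (.var 7 + .const 1)) (.const 2))
    (.cond (.bin .eq (.get 7 (.var 7)) (.get 7 (.var 8))) .nop
      (.cond (.bin .lt (.get 6 (.var 8) + .get 6 (.var 8 + .const 1)) (.const 2))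
        (.seq (.assign 9 (.const 1)) (.seq (.assign 10 (.var 5)) (.assign 11 (.var 6))))
        (.cond (.bin .eq (.get 8 (.var 8)) (.const 0))
          (.put 8 (.var 8) (.var 5 + .const 1))
          (.cond (.bin .eq (.get 8 (.var 8)) (.var 5 + .const 1)) .nop
            (.put 9 (.var 8) (.var 5 + .const 1))))))
    .nop

/-- The variables that the search for an exchange may change. -/
def scratch : List ℕ := [4, 5, 6, 7, 8, 9, 10, 11, 12, 13, 14, 15, 17, 18]

variable {n M N W : ℕ} {a : ℕ → ℕ → Prop} {eu ev q ps L col dg : ℕ → ℕ} {s : State}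

theorem wp_loadCmd (hW : 2 * n + M + 5 ≤ W) (hm : Mem n M N eu ev q ps L s) {k : ℕ}
    (hk : s.var 4 = k) {Q : State → Prop}
    (hQ : ∀ s', s'.arr = s.arr → SameVars [4, 5, 6, 7, 8] s s' → s'.var 4 = k → s'.var 5 = eu k →
      s'.var 6 = ev k → s'.var 7 = ps (eu k) - 1 → s'.var 8 = ps (ev k) - 1 → Q s') :
    wp W loadCmd Q s := by
  have hW1 : 1 < W := by omega
  simp only [loadCmd, wp_seq, wp_assign, fits_get, fits_var, fits_sub, fits_const, val_get,
    val_var, val_sub, val_const, true_and, hW1, and_true, setVar_arr, hm.arr_eu, hm.arr_ev,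
    hm.arr_ps, hk]
  apply hQ <;> simp [hk]
  intro x hx
  simp at hx
  simp [hx]

/-- The invariant must tolerate changes of the variables `4` to `8`, since loading an edge and
advancing the counter overwrite them around each action. -/
theorem runs_edgeLoop (hW : 2 * n + M + 5 ≤ W) (P : ℕ → State → Prop) {A : Cmd} {T : ℕ}
    (hT : A.time ≤ T)
    (hP : ∀ k s s', P k s → s'.arr = s.arr → SameVars [4, 5, 6, 7, 8] s s' → P k s')
    (hmem : ∀ k s, P k s → Mem n M N eu ev q ps L s)
    (hact : ∀ k s, k < M → P k s → s.var 4 = k → s.var 5 = eu k → s.var 6 = ev k →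
      s.var 7 = ps (eu k) - 1 → s.var 8 = ps (ev k) - 1 →
      wp W A (fun s' => P (k + 1) s' ∧ s'.var 4 = k) s) (h0 : P 0 s) :
    Runs W (edgeLoop A) s ((T + 35) * (M + 1)) (P M) := by
  have hW1 : 1 < W := by omega
  have step : Runs W (.assign 4 (.const 0)) s 2 (fun s' => P 0 s' ∧ s'.var 4 = 0) := by
    refine Runs.of_wp_le hW1 (by decide) ?_
    simp only [wp_assign, fits_const, val_const]
    refine ⟨by omega, hP 0 s _ h0 rfl (fun x hx => ?_), by simp⟩
    simp at hx
    simp [hx]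
  have hbound : M * (3 + 1 + (T + 22)) ≤ (T + 35) * M := by
    rw [mul_comm]; exact Nat.mul_le_mul_right _ (by omega)
  have hbound' : (T + 35) * (M + 1) = (T + 35) * M + (T + 35) := by ring
  refine (step.seq (T' := (T + 35) * M + 4) fun s1 h1 => Runs.loop_le hW1
    (fun k s' => P k s' ∧ s'.var 4 = k ∧ k ≤ M) M (T + 22) 3 _ rfl (by omega) ?_ ?_ ?_ ?_).mono
    (by omega) fun _ h => h
  · rintro k s' ⟨i1, i2, i3⟩
    simp
  · rintro k s' ⟨i1, i2, i3⟩ hv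
    simp [i2, (hmem k s' i1).var_M] at hv
    refine ⟨hv, Runs.of_wp_le hW1 (T := T + 22) ?_ ?_⟩
    · have : (Cmd.seq loadCmd (.seq A (.assign 4 (.var 4 + .const 1)))).time = 16 + (A.time + 4) :=
        rfl
      omega
    rw [wp_seq]
    refine wp_loadCmd hW (hmem k s' i1) i2 fun s2 e1 e2 e3 e4 e5 e6 e7 => ?_
    have h2 := hact k s2 hv (hP k s' s2 i1 e1 e2) e3 e4 e5 e6 e7
    rw [wp_seq]
    have mono : ∀ (A : Cmd) (s : State) (Q Q' : State → Prop), (∀ s, Q s → Q' s) →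
        wp W A Q s → wp W A Q' s := by
      intro A
      induction A with
      | nop => intro s Q Q' h h'; exact h _ h'
      | assign x e => intro s Q Q' h h'; exact ⟨h'.1, h _ h'.2⟩
      | put b i e => intro s Q Q' h h'; exact ⟨h'.1, h'.2.1, h _ h'.2.2⟩
      | seq p q ihp ihq => intro s Q Q' h h'; exact ihp _ _ _ (fun s hs => ihq _ _ _ h hs) h'
      | cond e p q ihp ihq =>
        intro s Q Q' h h'
        exact ⟨h'.1, fun h0 => ihp _ _ _ h (h'.2.1 h0), fun h0 => ihq _ _ _ h (h'.2.2 h0)⟩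
      | loop e p => intro s Q Q' h h'; exact h'.elim
    refine mono _ _ _ _ (fun s3 h3 => ?_) h2
    simp only [wp_assign, fits_add, fits_var, fits_const, val_add, val_var, val_const, h3.2]
    refine ⟨⟨trivial, by omega, by omega⟩, hP _ s3 _ h3.1 rfl (fun x hx => ?_), by simp, hv⟩
    simp at hx
    simp [hx]
  · exact ⟨h1.1, h1.2, by omega⟩
  · rintro k s' hk ⟨i1, i2, i3⟩ hv
    simp [i2, (hmem k s' i1).var_M] at hv
    have : k = M := by omega
    exact this ▸ i1

/-- The common part of the invariants of the search for an exchange: path labels, and a recorded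
exchange is improving. -/
structure Search (n M N : ℕ) (a : ℕ → ℕ → Prop) (eu ev q ps L : ℕ → ℕ) (s₀ s : State) : Prop where
  mem : Mem n M N eu ev q ps L s
  same : SameVars scratch s₀ s
  block : ∀ i < N, s.arr 7 i = blockStart L i
  good : s.var 9 ≠ 0 → GoodMove n a q ps L (blockCol ps L) (s.var 10) (s.var 11) (s.var 12)
    (s.var 13) (s.var 14) (s.var 9)

theorem Search.of_same {s₀ s' : State} (h : Search n M N a eu ev q ps L s₀ s)
    (harr : ∀ x, x ≠ 8 → x ≠ 9 → s'.arr x = s.arr x)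
    (hX : SameVars [4, 5, 6, 7, 8, 15, 17, 18] s s') : Search n M N a eu ev q ps L s₀ s' := by
  refine ⟨h.mem.of_sameVars hX (by decide) (by decide) (by decide) ?_,
    h.same.trans (hX.mono (by decide)), fun i hi => ?_, ?_⟩
  · rintro x (rfl | rfl | rfl | rfl | rfl) <;> exact harr _ (by decide) (by decide)
  · rw [harr 7 (by decide) (by decide), h.block i hi]
  · rw [hX 9 (by decide), hX 10 (by decide), hX 11 (by decide), hX 12 (by decide),
      hX 13 (by decide), hX 14 (by decide)]
    exact h.good

theorem Search.record {s₀ s' : State} (h : Search n M N a eu ev q ps L s₀ s)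
    (harr : s'.arr = s.arr) (hX : SameVars scratch s s')
    (hg : GoodMove n a q ps L (blockCol ps L) (s'.var 10) (s'.var 11) (s'.var 12)
      (s'.var 13) (s'.var 14) (s'.var 9)) : Search n M N a eu ev q ps L s₀ s' :=
  ⟨h.mem.of_sameVars hX (by decide) (by decide) (by decide) fun x _ => by rw [harr],
    h.same.trans hX, fun i hi => by rw [harr, h.block i hi], fun _ => hg⟩

/-- Variable `15` needs no initial value: `L 0 = 0`, so the first round sets it. -/
theorem runs_blockCmd (hW : 2 * n + M + 5 ≤ W) (hm : Mem n M N eu ev q ps L s)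
    (hP : Packing n N a q ps L) :
    Runs W blockCmd s (40 * (N + 1)) (fun s' => Mem n M N eu ev q ps L s' ∧
      SameVars [7, 15] s s' ∧
      ∀ i < N, s'.arr 7 i = blockStart L i ∧ s'.arr 8 i = 0 ∧ s'.arr 9 i = 0) := by
  have hW1 : 1 < W := by omega
  have hNn := hP.N_le
  have step : Runs W (.assign 7 (.const 0)) s 2 (fun s' => Mem n M N eu ev q ps L s' ∧
      SameVars [7, 15] s s' ∧ s'.var 7 = 0) := by
    refine Runs.of_wp_le hW1 (by decide) ?_
    simp only [wp_assign, fits_const, val_const]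
    have hX : SameVars [7, 15] s (s.setVar 7 0) := by
      intro x hx
      simp at hx
      simp [hx]
    exact ⟨by omega, hm.of_sameVars hX (by decide) (by decide) (by decide) fun _ _ => rfl, hX,
      by simp⟩
  refine (step.seq (T' := 34 * N + 4) fun s1 h1 => Runs.loop_le hW1 (fun k s' => Mem n M N eu ev q ps L s' ∧
    SameVars [7, 15] s s' ∧ s'.var 7 = k ∧ k ≤ N ∧ (k ≠ 0 → s'.var 15 = blockStart L (k - 1)) ∧
    ∀ i < k, s'.arr 7 i = blockStart L i ∧ s'.arr 8 i = 0 ∧ s'.arr 9 i = 0)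
    N 30 3 _ rfl (by omega) ?_ ?_ ?_ ?_).mono (by omega) fun _ h => h
  · rintro k s' ⟨i1, i2, i3⟩
    simp
  · rintro k s' ⟨i1, i2, i3, i4, i5, i6⟩ hv
    simp [i3, i1.var_N] at hv
    refine ⟨hv, Runs.of_wp_le hW1 (by decide) ?_⟩
    rw [wp_seq]
    have tail : ∀ s2 : State, Mem n M N eu ev q ps L s2 → s2.arr = s'.arr →
        SameVars [7, 15] s s2 → s2.var 7 = k → s2.var 15 = blockStart L k →
        wp W (.seq (.put 7 (.var 7) (.var 15)) (.seq (.put 8 (.var 7) (.const 0))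
          (.seq (.put 9 (.var 7) (.const 0)) (.assign 7 (.var 7 + .const 1)))))
          (fun s' => Mem n M N eu ev q ps L s' ∧
            SameVars [7, 15] s s' ∧ s'.var 7 = k + 1 ∧ k + 1 ≤ N ∧
            (k + 1 ≠ 0 → s'.var 15 = blockStart L (k + 1 - 1)) ∧
            ∀ i < k + 1, s'.arr 7 i = blockStart L i ∧ s'.arr 8 i = 0 ∧ s'.arr 9 i = 0) s2 := by
      intro s2 j1 j2 j3 j4 j5
      obtain ⟨m1, m2, m3, m4, m5, m6, m7, m8⟩ := j1
      simp [j4, j5]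
      refine ⟨by omega, ⟨by omega, by omega⟩, ?_, fun x hx => ?_, hv, fun i hi => ?_⟩
      · constructor <;> simp [*]
      · have := j3 x hx
        simp at hx
        simp [hx, this]
      · by_cases hik : i = k
        · subst hik; simp
        · simp only [Function.update_of_ne hik, j2]
          exact i6 i (by omega)
    simp only [wp_cond, fits_get, fits_var, val_get, val_var, wp_nop, wp_assign, true_and, i3,
      i1.arr_L]
    refine ⟨fun h => tail _ i1 rfl i2 i3 ?_, fun h => ?_⟩
    · have hk0 : k ≠ 0 := by rintro rfl; exact h hP.L_zero
      obtain ⟨j, rfl⟩ : ∃ j, k = j + 1 := ⟨k - 1, by omega⟩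
      rw [i5 hk0, blockStart, if_neg h, Nat.add_sub_cancel]
    · have hX : SameVars [7, 15] s' (s'.setVar 15 k) := by
        intro x hx
        simp at hx
        simp [hx]
      refine tail _ (i1.of_sameVars hX (by decide) (by decide) (by decide) fun _ _ => rfl) rfl
        (i2.trans hX) (by simp [i3]) ?_
      cases k with
      | zero => simp [blockStart]
      | succ j => simp [blockStart, h]
  · exact ⟨h1.1, h1.2.1, h1.2.2, by omega, fun h => (h rfl).elim, fun i hi => by omega⟩
  · rintro k s' hk ⟨i1, i2, i3, i4, i5, i6⟩ hv
    simp [i3, i1.var_N] at hv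
    exact ⟨i1, i2, fun i hi => i6 i (by omega)⟩

/-- For an edge from a path end to a job on another path there are two cases. If the target is an
end as well, a join is recorded; otherwise the target is an inner job and the source is kept as a
mark. Later findings may replace a recorded exchange, but variable `9` never returns to zero, so a
final zero certifies that no join exists. -/
theorem runs_markCmd (hW : 2 * n + M + 5 ≤ W) (hA : Agreement n M a eu ev)
    (hP : Packing n N a q ps L) {s₀ : State} (hS : Search n M N a eu ev q ps L s₀ s)
    (hs1 : ∀ i < N, s.arr 8 i = 0 ∧ s.arr 9 i = 0) :
    Runs W (edgeLoop markCmd) s (100 * (M + 1)) (fun s' => Search n M N a eu ev q ps L s₀ s' ∧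
      Marks N a eu ev q ps L (blockCol ps L) (s'.arr 8) (s'.arr 9) M ∧
      (s'.var 9 = 0 → ∀ e < M, Ext a (deg ps L) (blockCol ps L) (eu e) (ev e) →
        ¬ deg ps L (ev e) ≤ 1)) := by
  have hNn := hP.N_le
  refine (runs_edgeLoop (N := N) (eu := eu) (ev := ev) (q := q) (ps := ps) (L := L) hW
    (fun k s' => Search n M N a eu ev q ps L s₀ s' ∧
    Marks N a eu ev q ps L (blockCol ps L) (s'.arr 8) (s'.arr 9) k ∧
      (s'.var 9 = 0 → ∀ e < k, Ext a (deg ps L) (blockCol ps L) (eu e) (ev e) →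
        ¬ deg ps L (ev e) ≤ 1)) (T := 65) (by decide) ?_ ?_ ?_ ?_).mono (by omega) fun _ h => h
  · rintro k s1 s2 ⟨h1, h2, h3⟩ harr hX
    refine ⟨h1.of_same (fun x _ _ => by rw [harr]) (hX.mono (by decide)), by rw [harr]; exact h2, ?_⟩
    rw [hX 9 (by decide)]
    exact h3
  · exact fun k s h => h.1.mem
  · rintro k s1 hk ⟨h1, h2, h3⟩ e4 e5 e6 e7 e8
    have hadj := hA.edge hk
    have hun := hA.lt hadj
    have hvn := hA.lt (hA.symm hadj)
    have pu := hP.ps_pos hun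
    have pv := hP.ps_pos hvn
    have uN := hP.ps_le_of_adj hadj
    have vN := hP.ps_le_of_adj (hA.symm hadj)
    have qv := hP.q_ps hvn
    have su : ps (eu k) - 1 + 1 = ps (eu k) := by omega
    have sv : ps (ev k) - 1 + 1 = ps (ev k) := by omega
    have bu := h1.block (ps (eu k) - 1) (by omega)
    have bv := h1.block (ps (ev k) - 1) (by omega)
    have du : L (ps (eu k) - 1) + L (ps (eu k)) = deg ps L (eu k) := rfl
    have dv : L (ps (ev k) - 1) + L (ps (ev k)) = deg ps L (ev k) := rfl
    have lu := hP.deg_le (eu k)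
    have lv := hP.deg_le (ev k)
    have cu : blockStart L (ps (eu k) - 1) = blockCol ps L (eu k) := rfl
    have cv : blockStart L (ps (ev k) - 1) = blockCol ps L (ev k) := rfl
    have hskip : ∀ s2 : State, s2 = s1 →
        (Ext a (deg ps L) (blockCol ps L) (eu k) (ev k) → ¬ deg ps L (ev k) ≤ 1 ∧
          s1.arr 8 (ps (ev k) - 1) = eu k + 1) →
        (Search n M N a eu ev q ps L s₀ s2 ∧
          Marks N a eu ev q ps L (blockCol ps L) (s2.arr 8) (s2.arr 9) (k + 1) ∧
          (s2.var 9 = 0 → ∀ e < k + 1, Ext a (deg ps L) (blockCol ps L) (eu e) (ev e) →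
            ¬ deg ps L (ev e) ≤ 1)) ∧ s2.var 4 = k := by
      rintro s2 rfl hE
      refine ⟨⟨h1, h2.skip fun h _ => Or.inl (hE h).2, fun h9 e he hx => ?_⟩, e4⟩
      by_cases hek : e = k
      · subst hek; exact (hE hx).1
      · exact h3 h9 e (by omega) hx
    simp only [markCmd, wp_cond, wp_seq, wp_assign, wp_put, wp_nop, fits_lt, fits_eq, fits_add,
      fits_get, fits_var, fits_const, val_lt, val_eq, val_add, val_get, val_var, val_const,
      e5, e7, e8, h1.mem.arr_L, su, sv, du, dv, bu, bv, cu, cv, true_and]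
    refine ⟨⟨⟨⟨by omega, by omega⟩, by omega⟩, by omega⟩, fun hd => ?_, fun hd => ?_⟩
    swap
    · refine hskip _ rfl fun hE => ?_
      have := hE.deg_le
      simp at hd
      omega
    have hd' : deg ps L (eu k) ≤ 1 := by simp at hd; omega
    refine ⟨fun hc => hskip _ rfl fun hE => ?_, fun hc => ?_⟩
    · exact (hc (by simp [hE.col_ne])).elim
    have hE : Ext a (deg ps L) (blockCol ps L) (eu k) (ev k) :=
      ⟨hadj, hd', fun h => by simp [h] at hc⟩
    refine ⟨⟨⟨⟨by omega, by omega⟩, by omega⟩, by omega⟩, fun hv => ?_, fun hv => ?_⟩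
    · have hv' : deg ps L (ev k) ≤ 1 := by simp at hv; omega
      refine ⟨by omega, ⟨h1.record rfl (fun x hx => ?_) ?_, ?_, ?_⟩, ?_⟩
      · simp [scratch] at hx
        simp [hx]
      · simp only [setVar_var]
        simp only [Nat.reduceEqDiff, if_true, if_false, e5, e6]
        exact Or.inl ⟨rfl, ⟨hd', hv', hE.col_ne, hadj⟩⟩
      · exact h2.skip fun _ h => (h hv').elim
      · simp
      · simp [e4]
    · have hv' : ¬ deg ps L (ev k) ≤ 1 := by simp at hv; omega
      have hcomp : s1.var 9 = 0 → ∀ e < k + 1,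
          Ext a (deg ps L) (blockCol ps L) (eu e) (ev e) → ¬ deg ps L (ev e) ≤ 1 := by
        intro h9 e he hx
        by_cases hek : e = k
        · subst hek; exact hv'
        · exact h3 h9 e (by omega) hx
      refine ⟨by omega, fun h8 => ?_, fun h8 => ?_⟩
      · have h8' : s1.arr 8 (ps (ev k) - 1) = 0 := by
          by_contra hne; simp [hne] at h8
        refine ⟨⟨by omega, by omega⟩, ⟨h1.of_same (fun x x1 x2 => ?_) (fun x _ => rfl), ?_, hcomp⟩,
          e4⟩
        · simp [x1]
        · simpa using h2.put_fst qv (by omega) hE h8'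
      · have h8' : s1.arr 8 (ps (ev k) - 1) ≠ 0 := by
          intro hne; simp [hne] at h8
        refine ⟨⟨by omega, by omega⟩, fun h9 => ?_, fun h9 => ?_⟩
        · refine hskip _ rfl fun _ => ⟨hv', ?_⟩
          by_contra hne; simp [hne] at h9
        · have h9' : s1.arr 8 (ps (ev k) - 1) ≠ eu k + 1 := by
            intro hne; simp [hne] at h9
          refine ⟨⟨by omega, by omega⟩,
            ⟨h1.of_same (fun x x1 x2 => ?_) (fun x _ => rfl), ?_, hcomp⟩, e4⟩
          · simp [x2]
          · simpa using h2.put_snd qv hE h8' h9'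
  · refine ⟨hS, ⟨fun hj h => (h (hs1 _ hj).1).elim, fun hj h => (h (hs1 _ hj).2).elim,
      fun he => by omega⟩, fun _ e he => by omega⟩

end FlowShop

/-! ### Searching for an exchange -/

namespace FlowShop

open WordRAM Packing

/-- Tests for an exchange that turns a path around one of its inner edges. -/
def rotateCmd : Cmd :=
  .cond (.bin .eq (.get 7 (.var 7)) (.get 7 (.var 8)))
    (.cond (.bin .lt (.var 7) (.var 8))
      (.cond (.get 6 (.var 7)) .nop
        (.cond (.get 8 (.var 8 - .const 1))
          (.seq (.assign 9 (.const 2)) (.seq (.assign 14 (.var 8)) (.seq (.assign 10 (.var 5))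
            (.seq (.assign 11 (.var 6)) (.seq (.assign 12 (.get 8 (.var 8 - .const 1) - .const 1))
              (.assign 13 (.get 4 (.var 8 - .const 1))))))))
          .nop))
      (.cond (.get 6 (.var 7 + .const 1)) .nop
        (.cond (.get 8 (.var 8 + .const 1))
          (.seq (.assign 9 (.const 2)) (.seq (.assign 14 (.var 8 + .const 1))
            (.seq (.assign 10 (.var 5)) (.seq (.assign 11 (.var 6))
              (.seq (.assign 12 (.get 8 (.var 8 + .const 1) - .const 1))
                (.assign 13 (.get 4 (.var 8 + .const 1))))))))
          .nop)))
    .nop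

/-- Chooses marked neighbours of the positions `7 - 1` and `7`, different ones if possible. -/
def chooseCmd : Cmd :=
  .seq (.assign 17 (.get 8 (.var 7 - .const 1) - .const 1))
    (.seq (.assign 18 (.get 8 (.var 7) - .const 1))
      (.cond (.bin .eq (.var 17) (.var 18))
        (.cond (.get 9 (.var 7 - .const 1))
          (.assign 17 (.get 9 (.var 7 - .const 1) - .const 1))
          (.cond (.get 9 (.var 7)) (.assign 18 (.get 9 (.var 7) - .const 1)) .nop))
        .nop))

/-- Records the exchange at the edge between the positions `7 - 1` and `7` if it is legal. -/
def recordCmd : Cmd :=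
  .seq (.assign 8 (.get 5 (.var 17)))
    (.cond (.bin .lt (.bin .eq (.var 17) (.var 18) +
        .bin .lt (.const 0) (.get 6 (.var 8 - .const 1) + .get 6 (.var 8))) (.const 2))
      (.seq (.assign 9 (.const 2)) (.seq (.assign 14 (.var 7)) (.seq (.assign 10 (.var 17))
        (.seq (.assign 11 (.get 4 (.var 7 - .const 1))) (.seq (.assign 12 (.var 18))
          (.assign 13 (.get 4 (.var 7))))))))
      .nop)

/-- Tests for exchanges of an inner edge of a path for two edges to ends of other paths. -/
def exchangeCmd : Cmd :=
  .seq (.assign 7 (.const 0)) (.loop (.bin .lt (.var 7) (.var 2))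
    (.seq
      (.cond (.get 6 (.var 7))
        (.cond (.get 8 (.var 7 - .const 1))
          (.cond (.get 8 (.var 7)) (.seq chooseCmd recordCmd) .nop) .nop) .nop)
      (.assign 7 (.var 7 + .const 1))))

variable {n M N W : ℕ} {a : ℕ → ℕ → Prop} {eu ev q ps L col dg : ℕ → ℕ} {s : State}

/-- For an edge from `u` to `v` inside a path with `u` at an end of it, the path edge to remove is
the one at `v` towards `u`. Its other end is at position `ps v - 2` or `ps v`. Any outside end
adjacent to that job completes the rotation, so it suffices to look at the first mark there. -/
theorem runs_rotateCmd (hW : 2 * n + M + 5 ≤ W) (hA : Agreement n M a eu ev)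
    (hP : Packing n N a q ps L) {s₀ : State} (hS : Search n M N a eu ev q ps L s₀ s)
    (hM : Marks N a eu ev q ps L (blockCol ps L) (s.arr 8) (s.arr 9) M) :
    Runs W (edgeLoop rotateCmd) s (115 * (M + 1)) (fun s' => Search n M N a eu ev q ps L s₀ s' ∧
      s'.arr = s.arr ∧ (s'.var 9 = 0 → s.var 9 = 0 ∧ ∀ e < M,
        blockCol ps L (eu e) = blockCol ps L (ev e) →
        (ps (eu e) < ps (ev e) → L (ps (eu e) - 1) = 0 → s.arr 8 (ps (ev e) - 1 - 1) = 0) ∧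
        (ps (ev e) < ps (eu e) → L (ps (eu e)) = 0 → s.arr 8 (ps (ev e)) = 0))) := by
  have hNn := hP.N_le
  have hC := hP.colored_blockCol
  refine (runs_edgeLoop (N := N) (eu := eu) (ev := ev) (q := q) (ps := ps) (L := L) hW
    (fun k s' => Search n M N a eu ev q ps L s₀ s' ∧
      s'.arr = s.arr ∧ (s'.var 9 = 0 → s.var 9 = 0 ∧ ∀ e < k,
        blockCol ps L (eu e) = blockCol ps L (ev e) →
        (ps (eu e) < ps (ev e) → L (ps (eu e) - 1) = 0 → s.arr 8 (ps (ev e) - 1 - 1) = 0) ∧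
        (ps (ev e) < ps (eu e) → L (ps (eu e)) = 0 → s.arr 8 (ps (ev e)) = 0)))
    (T := 80) (by decide) ?_ ?_ ?_ ?_).mono (by omega) fun _ h => h
  · rintro k s1 s2 ⟨h1, h2, h3⟩ harr hX
    refine ⟨h1.of_same (fun x _ _ => by rw [harr]) (hX.mono (by decide)), harr.trans h2, ?_⟩
    rw [hX 9 (by decide)]
    exact h3
  · exact fun k s h => h.1.mem
  · rintro k s1 hk ⟨h1, h2, h3⟩ e4 e5 e6 e7 e8
    have hadj := hA.edge hk
    have hun := hA.lt hadj
    have hvn := hA.lt (hA.symm hadj)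
    have pu := hP.ps_pos hun
    have pv := hP.ps_pos hvn
    have uN := hP.ps_le_of_adj hadj
    have vN := hP.ps_le_of_adj (hA.symm hadj)
    have qu := hP.q_ps hun
    have qv := hP.q_ps hvn
    have su : ps (eu k) - 1 + 1 = ps (eu k) := by omega
    have sv : ps (ev k) - 1 + 1 = ps (ev k) := by omega
    have bu := h1.block (ps (eu k) - 1) (by omega)
    have bv := h1.block (ps (ev k) - 1) (by omega)
    have cu : blockStart L (ps (eu k) - 1) = blockCol ps L (eu k) := rfl
    have cv : blockStart L (ps (ev k) - 1) = blockCol ps L (ev k) := rfl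
    have huv : ps (eu k) ≠ ps (ev k) := fun h =>
      hA.irrefl (ev k) (by have e := hP.ps_inj hun hvn h; rwa [e] at hadj)
    have m8 : s1.arr 8 = s.arr 8 := by rw [h2]
    have hskip : (blockCol ps L (eu k) = blockCol ps L (ev k) →
        (ps (eu k) < ps (ev k) → L (ps (eu k) - 1) = 0 → s.arr 8 (ps (ev k) - 1 - 1) = 0) ∧
        (ps (ev k) < ps (eu k) → L (ps (eu k)) = 0 → s.arr 8 (ps (ev k)) = 0)) →
        (Search n M N a eu ev q ps L s₀ s1 ∧
          s1.arr = s.arr ∧ (s1.var 9 = 0 → s.var 9 = 0 ∧ ∀ e < k + 1,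
            blockCol ps L (eu e) = blockCol ps L (ev e) →
            (ps (eu e) < ps (ev e) → L (ps (eu e) - 1) = 0 → s.arr 8 (ps (ev e) - 1 - 1) = 0) ∧
            (ps (ev e) < ps (eu e) → L (ps (eu e)) = 0 → s.arr 8 (ps (ev e)) = 0))) ∧
          s1.var 4 = k := by
      intro hE
      refine ⟨⟨h1, h2, fun h9 => ⟨(h3 h9).1, fun e he => ?_⟩⟩, e4⟩
      by_cases hek : e = k
      · subst hek; exact hE
      · exact (h3 h9).2 e (by omega)
    simp only [rotateCmd, wp_cond, wp_seq, wp_assign, wp_nop, fits_lt, fits_eq, fits_add,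
      fits_get, fits_var, fits_const, fits_sub, val_lt, val_eq, val_add, val_sub, val_get, val_var,
      val_const, e7, e8, h1.mem.arr_L, su, sv, bu, bv, cu, cv, m8, true_and]
    refine ⟨fun hc => ?_, fun hc => hskip fun h => ?_⟩
    swap
    · simp [h] at hc
    have hc' : blockCol ps L (eu k) = blockCol ps L (ev k) := by
      by_contra h; simp [h] at hc
    refine ⟨fun hlt => ?_, fun hlt => ?_⟩
    · have hlt' : ps (eu k) < ps (ev k) := by
        by_contra h
        have : ¬ ps (eu k) - 1 < ps (ev k) - 1 := by omega
        simp [this] at hlt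
      refine ⟨fun hL => hskip fun _ => ⟨fun _ h => (hL h).elim, fun h => by omega⟩, fun hL => ?_⟩
      refine ⟨by omega, fun hm => ?_, fun hm => hskip fun _ => ⟨fun _ _ => hm, fun h => by omega⟩⟩
      have hb : L (ps (ev k) - 1) ≠ 0 :=
        hC.link (i := ps (eu k) - 1) (j := ps (ev k) - 1) (by rw [qu, qv]; exact hc') (by omega)
          le_rfl (by omega)
      refine ⟨by omega, ?_⟩
      simp only [setVar_var, setVar_arr, Nat.reduceEqDiff, if_true, if_false, e5, e6, e8, m8,
        h1.mem.arr_q]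
      refine ⟨by omega, by omega, ⟨h1.record rfl (fun x hx => ?_) ?_, h2, by simp⟩, e4⟩
      · simp [scratch] at hx
        simp [hx]
      · have := hP.goodMove_rotate hC (fun z hz => hP.blockCol_lt hz) hA.lt
          (b := ps (ev k) - 1) (i := ps (eu k) - 1) hb (by omega) hL (by rw [qu, qv, hc'])
          (by rw [qu, qv]; exact hadj) (hM.fst (by omega) hm)
        rw [qu, qv] at this
        simpa using this
    · have hlt' : ps (ev k) < ps (eu k) := by
        by_contra h
        have : ps (eu k) - 1 < ps (ev k) - 1 := by omega
        simp [this] at hlt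
      refine ⟨⟨by omega, by omega⟩, fun hL => hskip fun _ => ⟨fun h => by omega,
        fun _ h => (hL h).elim⟩, fun hL => ?_⟩
      refine ⟨⟨by omega, by omega⟩, fun hm => ?_,
        fun hm => hskip fun _ => ⟨fun h => by omega, fun _ _ => hm⟩⟩
      have hb : L (ps (ev k)) ≠ 0 :=
        hC.link (i := ps (ev k) - 1) (j := ps (eu k) - 1) (by rw [qu, qv]; exact hc'.symm)
          (by omega) (by omega) (by omega)
      have hbN := hP.L_lt hb
      have hcol := hC.eq (by omega) hb
      rw [qv] at hcol
      refine ⟨by omega, ?_⟩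
      simp only [setVar_var, setVar_arr, Nat.reduceEqDiff, if_true, if_false, e5, e6, e8, m8, sv,
        h1.mem.arr_q]
      refine ⟨⟨by omega, by omega⟩, ⟨⟨by omega, by omega⟩, by omega⟩, ⟨by omega, by omega⟩,
        ⟨h1.record rfl (fun x hx => ?_) ?_, h2, by simp⟩, e4⟩
      · simp [scratch] at hx
        simp [hx]
      · have := hP.goodMove_rotate' hC (fun z hz => hP.blockCol_lt hz) hA.lt
          (b := ps (ev k)) (i := ps (eu k) - 1) hb (by omega) (by omega) (by rw [su]; exact hL)
          (by rw [qu, hc', hcol])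
          (by rw [qu, qv]; exact hadj) (hM.fst (by omega) hm)
        rw [qu, qv] at this
        simpa using this
  · exact ⟨hS, rfl, fun h => ⟨h, fun e he => by omega⟩⟩

/-- If the first marks coincide, a second mark at either position differs from both and gives two
different ends. An equal choice thus certifies that neither position has a second mark. -/
theorem wp_chooseCmd (hW : 2 * n + M + 5 ≤ W) {k : ℕ} (h7 : s.var 7 = k) (hkN : k < N)
    (hM : Marks N a eu ev q ps L col (s.arr 8) (s.arr 9) M) (hp : s.arr 8 (k - 1) ≠ 0)
    (hq : s.arr 8 k ≠ 0) {Q : State → Prop}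
    (hQ : ∀ s' x y, s'.arr = s.arr → SameVars [17, 18] s s' → s'.var 17 = x → s'.var 18 = y →
      Ext a (deg ps L) col x (q (k - 1)) → Ext a (deg ps L) col y (q k) →
      (x = y → s.arr 8 (k - 1) = s.arr 8 k ∧ s.arr 9 (k - 1) = 0 ∧ s.arr 9 k = 0 ∧
        x = s.arr 8 k - 1) → Q s') :
    wp W chooseCmd Q s := by
  have hW1 : 1 < W := by omega
  have sv : ∀ s' : State, (∀ x, x ≠ 17 → x ≠ 18 → s'.var x = s.var x) → SameVars [17, 18] s s' :=
    fun s' h x hx => h x (by rintro rfl; simp at hx) (by rintro rfl; simp at hx)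
  simp only [chooseCmd, wp_cond, wp_seq, wp_assign, wp_nop, fits_eq, fits_get, fits_var,
    fits_const, fits_sub, val_eq, val_sub, val_get, val_var, val_const, setVar_var, setVar_arr,
    Nat.reduceEqDiff, if_true, if_false, h7, true_and, and_true, hW1]
  have f1 := hM.fst (j := k - 1) (by omega) hp
  have f2 := hM.fst (j := k) hkN hq
  refine ⟨fun hc => ⟨fun h9 => ?_, fun h9 => ⟨fun h9' => ?_, fun h9' => ?_⟩⟩, fun hc => ?_⟩
  · have hc' : s.arr 8 (k - 1) - 1 = s.arr 8 k - 1 := by by_contra h; simp [h] at hc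
    obtain ⟨g1, g2, g3⟩ := hM.snd (j := k - 1) (by omega) h9
    refine hQ _ _ _ rfl (sv _ fun x h1 h2 => by simp [h1, h2]) (by simp) (by simp) g1 f2 fun h => ?_
    omega
  · have hc' : s.arr 8 (k - 1) - 1 = s.arr 8 k - 1 := by by_contra h; simp [h] at hc
    obtain ⟨g1, g2, g3⟩ := hM.snd (j := k) hkN h9'
    refine hQ _ _ _ rfl (sv _ fun x h1 h2 => by simp [h1, h2]) (by simp) (by simp) f1 g1 fun h => ?_
    omega
  · have hc' : s.arr 8 (k - 1) - 1 = s.arr 8 k - 1 := by by_contra h; simp [h] at hc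
    exact hQ _ _ _ rfl (sv _ fun x h1 h2 => by simp [h1, h2]) (by simp) (by simp) f1 f2
      fun h => ⟨by omega, h9, h9', by omega⟩
  · have hc' : s.arr 8 (k - 1) - 1 ≠ s.arr 8 k - 1 := by intro h; simp [h] at hc
    exact hQ _ _ _ rfl (sv _ fun x h1 h2 => by simp [h1, h2]) (by simp) (by simp) f1 f2
      fun h => (hc' h).elim

/-- The test in `recordCmd` adds the indicators of `x = y` and of positive degree of `x`. The value
`2` is the only obstacle: a single end can take two new edges only if it is isolated. -/
theorem runs_exchangeCmd (hW : 2 * n + M + 5 ≤ W) (hA : Agreement n M a eu ev)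
    (hP : Packing n N a q ps L) {s₀ : State} (hS : Search n M N a eu ev q ps L s₀ s)
    (hM : Marks N a eu ev q ps L (blockCol ps L) (s.arr 8) (s.arr 9) M) :
    Runs W exchangeCmd s (120 * (N + 1)) (fun s' => Search n M N a eu ev q ps L s₀ s' ∧
      (s'.var 9 = 0 → s.var 9 = 0 ∧ ∀ b < N, L b ≠ 0 → s.arr 8 (b - 1) ≠ 0 → s.arr 8 b ≠ 0 →
        s.arr 8 (b - 1) = s.arr 8 b ∧ s.arr 9 (b - 1) = 0 ∧ s.arr 9 b = 0 ∧
          deg ps L (s.arr 8 b - 1) ≠ 0)) := by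
  have hW1 : 1 < W := by omega
  have hNn := hP.N_le
  have hC := hP.colored_blockCol
  have step : Runs W (.assign 7 (.const 0)) s 2 (fun s' => Search n M N a eu ev q ps L s₀ s' ∧
      s'.arr = s.arr ∧ s'.var 7 = 0 ∧ s'.var 9 = s.var 9) := by
    refine Runs.of_wp_le hW1 (by decide) ?_
    simp only [wp_assign, fits_const, val_const]
    refine ⟨by omega, hS.of_same (fun _ _ _ => rfl) fun x hx => ?_, rfl, by simp, by simp⟩
    simp at hx
    simp [hx]
  refine (step.seq (T' := 110 * N + 4) fun s1 h1 => Runs.loop_le hW1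
    (fun k s' => Search n M N a eu ev q ps L s₀ s' ∧ s'.arr = s.arr ∧ s'.var 7 = k ∧ k ≤ N ∧
      (s'.var 9 = 0 → s.var 9 = 0 ∧ ∀ b < k, L b ≠ 0 → s.arr 8 (b - 1) ≠ 0 → s.arr 8 b ≠ 0 →
        s.arr 8 (b - 1) = s.arr 8 b ∧ s.arr 9 (b - 1) = 0 ∧ s.arr 9 b = 0 ∧
          deg ps L (s.arr 8 b - 1) ≠ 0))
    N 106 3 _ rfl (by omega) ?_ ?_ ?_ ?_).mono (by omega) fun _ h => h
  · rintro k s' ⟨i1, i2, i3⟩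
    simp
  · rintro k s' ⟨i1, i2, i3, i4, i5⟩ hv
    simp [i3, i1.mem.var_N] at hv
    refine ⟨hv, ?_⟩
    obtain ⟨R, hR⟩ : ∃ R : State → Prop, ∀ s', R s' ↔ (Search n M N a eu ev q ps L s₀ s' ∧
      s'.arr = s.arr ∧ s'.var 7 = k ∧
      (s'.var 9 = 0 → s.var 9 = 0 ∧ ∀ b < k + 1, L b ≠ 0 → s.arr 8 (b - 1) ≠ 0 → s.arr 8 b ≠ 0 →
        s.arr 8 (b - 1) = s.arr 8 b ∧ s.arr 9 (b - 1) = 0 ∧ s.arr 9 b = 0 ∧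
          deg ps L (s.arr 8 b - 1) ≠ 0)) := ⟨_, fun _ => Iff.rfl⟩
    refine Runs.seq (T := 102) (T' := 4) (R := R) ?_ ?_
    · have hskip : (L k ≠ 0 → s.arr 8 (k - 1) ≠ 0 → s.arr 8 k ≠ 0 → s.arr 8 (k - 1) = s.arr 8 k ∧
          s.arr 9 (k - 1) = 0 ∧ s.arr 9 k = 0 ∧ deg ps L (s.arr 8 k - 1) ≠ 0) →
          ∀ s2 : State, Search n M N a eu ev q ps L s₀ s2 → s2.arr = s.arr → s2.var 7 = k →
          s2.var 9 = s'.var 9 → R s2 := by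
        intro hE s2 j1 j2 j3 j4
        refine (hR _).2 ⟨j1, j2, j3, fun h9 => ?_⟩
        rw [j4] at h9
        refine ⟨(i5 h9).1, fun b hb => ?_⟩
        by_cases hbk : b = k
        · subst hbk; exact hE
        · exact (i5 h9).2 b (by omega)
      refine Runs.of_wp_le hW1 (by decide) ?_
      have m8 : s'.arr 8 = s.arr 8 := by rw [i2]
      have m9 : s'.arr 9 = s.arr 9 := by rw [i2]
      simp only [wp_cond, fits_get, fits_var, fits_sub, fits_const, val_get, val_var, val_sub,
        val_const, wp_nop, wp_seq, i3, i1.mem.arr_L, m8, true_and, hW1, and_true]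
      refine ⟨fun hL => ⟨fun hp => ⟨fun hq => ?_, fun hq =>
        hskip (fun _ _ h => (h hq).elim) _ i1 i2 i3 rfl⟩,
        fun hp => hskip (fun _ h => (h hp).elim) _ i1 i2 i3 rfl⟩,
        fun hL => hskip (fun h => (h hL).elim) _ i1 i2 i3 rfl⟩
      refine wp_chooseCmd (n := n) (N := N) (M := M) hW i3 hv (by rw [m8, m9]; exact hM)
        (by rw [m8]; exact hp) (by rw [m8]; exact hq) fun s2 x y j1 j2 j3 j4 hx hy hxy => ?_
      rw [m8, m9] at hxy
      have hxn := hA.lt hx.adj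
      have px := hP.ps_pos hxn
      have lx := hP.deg_le x
      have dx : L (ps x - 1) + L (ps x) = deg ps L x := rfl
      have hS2 : Search n M N a eu ev q ps L s₀ s2 :=
        i1.of_same (fun z _ _ => by rw [j1]) (j2.mono (by decide))
      have e7 : s2.var 7 = k := (j2 7 (by decide)).trans i3
      have e9 : s2.var 9 = s'.var 9 := j2 9 (by decide)
      simp only [recordCmd, wp_cond, wp_seq, wp_assign, wp_nop, fits_lt, fits_eq, fits_add,
        fits_get, fits_var, fits_const, fits_sub, val_lt, val_eq, val_add, val_sub, val_get,
        val_var, val_const, setVar_var, setVar_arr, Nat.reduceEqDiff, if_true, if_false, j3, j4,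
        e7, hS2.mem.arr_ps, hS2.mem.arr_L, hS2.mem.arr_q, dx, true_and]
      refine ⟨⟨⟨⟨by omega, by omega, by omega⟩, ?_⟩, by omega⟩, fun hc => ?_, fun hc => ?_⟩
      · split_ifs <;> omega
      · have hgood : x = y → deg ps L x = 0 := by
          intro h
          by_contra h0
          have h0' : 0 < deg ps L x := by omega
          subst h
          simp [h0'] at hc
        refine ⟨by omega, by omega, (hR _).2 ⟨hS2.record rfl (fun z hz => ?_) ?_, j1.trans i2, by simp [e7],
          by simp⟩⟩
        · simp [scratch] at hz
          simp [hz]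
        · have := hP.goodMove_exchange hC (fun z hz => hP.blockCol_lt hz) hA.lt hL hx hy hgood
          simpa using this
      · have hbad : x = y ∧ deg ps L x ≠ 0 := by
          constructor
          · by_contra h
            simp only [h, if_false, zero_add] at hc
            split_ifs at hc <;> omega
          · intro h
            simp only [h] at hc
            split_ifs at hc <;> omega
        obtain ⟨r1, r2, r3, r4⟩ := hxy hbad.1
        refine hskip (fun _ _ _ => ⟨r1, r2, r3, r4 ▸ hbad.2⟩) _ (hS2.of_same (fun _ _ _ => rfl)
          fun z hz => ?_) (j1.trans i2) (by simp [e7]) (by simp [e9])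
        simp at hz
        simp [hz]
    · intro s2 hs2
      obtain ⟨j1, j2, j3, j4⟩ := (hR _).1 hs2
      refine Runs.of_wp_le hW1 (by decide) ?_
      simp only [wp_assign, fits_add, fits_var, fits_const, val_add, val_var, val_const, j3]
      refine ⟨⟨trivial, by omega, by omega⟩, j1.of_same (fun _ _ _ => rfl) fun z hz => ?_, j2,
        by simp, hv, by simpa using j4⟩
      simp at hz
      simp [hz]
  · obtain ⟨k1, k2, k3, k4⟩ := h1
    exact ⟨k1, k2, k3, by omega, fun h => ⟨k4 ▸ h, fun b hb => by omega⟩⟩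
  · rintro k s' hk ⟨i1, i2, i3, i4, i5⟩ hv
    simp [i3, i1.mem.var_N] at hv
    exact ⟨i1, fun h9 => ⟨(i5 h9).1, fun b hb => (i5 h9).2 b (by omega)⟩⟩

end FlowShop

/-! ### The local search -/

namespace FlowShop

open WordRAM Packing

/-- Searches for an improving exchange; variable `9` tells whether there is one. -/
def searchCmd : Cmd :=
  .seq (.assign 9 (.const 0)) (.seq blockCmd (.seq (edgeLoop markCmd)
    (.seq (edgeLoop rotateCmd) exchangeCmd)))

/-- Carries out the exchange that was found, or ends the improvement. -/
def applyCmd : Cmd :=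
  .cond (.var 9)
    (.seq
      (.cond (.bin .eq (.var 9) (.const 2))
        (.seq (.put 6 (.var 14) (.const 0)) (.seq (.seq (.assign 19 (.var 12))
          (.assign 20 (.var 13))) linkCmd))
        .nop)
      (.seq (.seq (.assign 19 (.var 10)) (.assign 20 (.var 11))) linkCmd))
    (.assign 16 (.const 0))

/-- Local search. -/
def improveCmd : Cmd := .seq (.assign 16 (.const 1)) (.loop (.var 16) (.seq searchCmd applyCmd))

variable {n M N W : ℕ} {a : ℕ → ℕ → Prop} {eu ev q ps L col dg : ℕ → ℕ} {s : State}

/-- Absence of exchanges was tested on marks only; completeness of the marks extends it to all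
edges. Passes over the edges cost `O(M)` and passes over positions `O(N)`, which `N ≤ M` absorbs. -/
theorem runs_searchCmd (hW : 2 * n + M + 5 ≤ W) (hA : Agreement n M a eu ev)
    (hP : Packing n N a q ps L) (hNM : N ≤ M) (hm : Mem n M N eu ev q ps L s) :
    Runs W searchCmd s (400 * (M + 1)) (fun s' => Mem n M N eu ev q ps L s' ∧
      SameVars scratch s s' ∧
      (s'.var 9 ≠ 0 → GoodMove n a q ps L (blockCol ps L) (s'.var 10) (s'.var 11) (s'.var 12)
        (s'.var 13) (s'.var 14) (s'.var 9)) ∧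
      (s'.var 9 = 0 → Stuck n a q ps L (blockCol ps L))) := by
  have hW1 : 1 < W := by omega
  have hNn := hP.N_le
  have hC := hP.colored_blockCol
  have step : Runs W (.assign 9 (.const 0)) s 2 (fun s' => Mem n M N eu ev q ps L s' ∧
      SameVars scratch s s' ∧ s'.var 9 = 0) := by
    refine Runs.of_wp_le hW1 (by decide) ?_
    simp only [wp_assign, fits_const, val_const]
    have hX : SameVars scratch s (s.setVar 9 0) := by
      intro x hx
      simp [scratch] at hx
      simp [hx]
    exact ⟨by omega, hm.of_sameVars hX (by decide) (by decide) (by decide) fun _ _ => rfl, hX,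
      by simp⟩
  refine (step.seq (T' := 390 * (M + 1)) fun s1 ⟨a1, a2, a3⟩ => ?_).mono (by omega) fun _ h => h
  refine ((runs_blockCmd hW a1 hP).seq (T' := 340 * (M + 1)) fun s2 ⟨b1, b2, b3⟩ => ?_).mono
    (by omega) fun _ h => h
  have hS : Search n M N a eu ev q ps L s s2 :=
    ⟨b1, a2.trans (b2.mono (by decide)), fun i hi => (b3 i hi).1,
      fun h => (h ((b2 9 (by decide)).trans a3)).elim⟩
  refine ((runs_markCmd hW hA hP hS fun i hi => (b3 i hi).2).seq (T' := 240 * (M + 1))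
    fun s3 ⟨c1, c2, c3⟩ => ?_).mono (by omega) fun _ h => h
  refine ((runs_rotateCmd hW hA hP c1 c2).seq (T' := 120 * (M + 1))
    fun s4 ⟨d1, d2, d3⟩ => ?_).mono (by omega) fun _ h => h
  refine (runs_exchangeCmd hW hA hP d1 (by rw [d2]; exact c2)).mono (by omega) ?_
  rintro s' ⟨e1, e2⟩
  refine ⟨e1.mem, e1.same, e1.good, fun h9 => ?_⟩
  obtain ⟨h4, ex⟩ := e2 h9
  obtain ⟨h3, rot⟩ := d3 h4
  rw [d2] at ex
  have join := c3 h3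
  have hjoin : ∀ {u v}, Ext a (deg ps L) (blockCol ps L) u v → ¬ deg ps L v ≤ 1 := by
    intro u v h
    obtain ⟨e, he, rfl, rfl⟩ := hA.exists_edge h.adj
    exact join e he h
  -- As no join exists, the target of every edge from an outside end is an inner job, for which the
  -- marks are complete.
  have hmark : ∀ {x b}, b < n → Ext a (deg ps L) (blockCol ps L) x (q b) →
      s3.arr 8 b = x + 1 ∨ (s3.arr 8 b ≠ 0 ∧ s3.arr 9 b ≠ 0) := by
    intro x b hb h
    have hd := hjoin h
    obtain ⟨e, he, e1, e2⟩ := hA.exists_edge h.adj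
    have := c2.complete he (by rw [e1, e2]; exact h) (by rw [e2]; exact hd)
    rwa [e1, e2, hP.ps_q hb, Nat.add_sub_cancel] at this
  refine ⟨hjoin, ?_, ?_, ?_⟩
  · intro b x y hb hx hy
    have hbN := hP.L_lt hb
    have mx := hmark (by omega) hx
    have my := hmark (by omega) hy
    obtain ⟨r1, r2, r3, r4⟩ := ex b hbN hb (by omega) (by omega)
    have ex : s3.arr 8 (b - 1) = x + 1 := by omega
    have ey : s3.arr 8 b = y + 1 := by omega
    have hxy : x = y := by omega
    refine ⟨hxy, ?_⟩
    rw [ey, ← hxy] at r4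
    exact r4
  · intro b i y hb hib hi hcol hadj hy
    have hbN := hP.L_lt hb
    have my := hmark (by omega) hy
    obtain ⟨e, he, e1, e2⟩ := hA.exists_edge hadj
    have pi := hP.ps_q (show i < n by omega)
    have pb := hP.ps_q (show b < n by omega)
    have := (rot e he (by rw [e1, e2, hcol])).1 (by rw [e1, e2, pi, pb]; omega)
      (by rw [e1, pi]; exact hi)
    rw [e2, pb, Nat.add_sub_cancel] at this
    omega
  · intro b i y hb hin hib hi hcol hadj hy
    have hbN := hP.L_lt hb
    have hb0 : b ≠ 0 := by rintro rfl; exact hb hP.L_zero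
    have my := hmark (by omega) hy
    obtain ⟨e, he, e1, e2⟩ := hA.exists_edge hadj
    have pi := hP.ps_q hin
    have pb := hP.ps_q (show b - 1 < n by omega)
    have cb := hC.eq (by omega) hb
    have := (rot e he (by rw [e1, e2, hcol, cb])).2 (by rw [e1, e2, pi, pb]; omega)
      (by rw [e1, pi]; exact hi)
    rw [e2, pb, Nat.sub_add_cancel (by omega)] at this
    omega

theorem sum_linkDeg {u v : ℕ} (hu : u < n) (hv : v < n) :
    ∑ x ∈ Finset.range n, linkDeg dg u v x = ∑ x ∈ Finset.range n, dg x + 2 := by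
  simp only [linkDeg, Finset.sum_add_distrib, Finset.sum_ite_eq', Finset.mem_range, hu, hv, if_true]

theorem runs_linkVars (hW : 2 * n + M + 5 ≤ W) (hA : Agreement n M a eu ev)
    (hm : Mem n M N eu ev q ps L s) (hP : Packing n N a q ps L) (hC : Colored n q L col)
    {x y : ℕ} (hdg : ∀ x < n, deg ps L x = dg x)
    (hy : y ∉ [19, 20])
    (hL : Linkable a dg col (s.var x) (s.var y)) :
    Runs W (.seq (.seq (.assign 19 (.var x)) (.assign 20 (.var y))) linkCmd) s (310 * (N + 1))
      (fun s' => ∃ q' ps' L',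
      Mem n M N eu ev q' ps' L' s' ∧ Packing n N a q' ps' L' ∧
      Colored n q' L' (linkCol col (s.var x) (s.var y)) ∧
      (∀ z < n, deg ps' L' z = linkDeg dg (s.var x) (s.var y) z) ∧
      SameVars [19, 20, 21, 22, 23] s s') := by
  have hW1 : 1 < W := by omega
  simp at hy
  have step : Runs W (.seq (.assign 19 (.var x)) (.assign 20 (.var y))) s 4 (fun s' =>
      Mem n M N eu ev q ps L s' ∧ s'.var 19 = s.var x ∧ s'.var 20 = s.var y ∧
      SameVars [19, 20, 21, 22, 23] s s') := by
    refine Runs.of_wp_le hW1 (by show 4 ≤ 4; decide) ?_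
    simp only [wp_seq, wp_assign, fits_var, val_var, setVar_var, true_and, hy.1, if_false,
      Nat.reduceEqDiff, if_true]
    have hX : SameVars [19, 20, 21, 22, 23] s ((s.setVar 19 (s.var x)).setVar 20 (s.var y)) := by
      intro z hz
      simp at hz
      simp [hz]
    exact ⟨hm.of_sameVars hX (by decide) (by decide) (by decide) fun _ _ => rfl, hX⟩
  refine (step.seq fun s1 ⟨a1, a2, a3, a4⟩ => ?_).mono (T := 4 + 300 * (N + 1)) (by omega)
    fun _ h => h
  refine (runs_linkCmd hW hA a1 hP hC a2 a3 hdg hL).mono le_rfl ?_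
  rintro s' ⟨q', ps', L', b1, b2, b3, b4, b5⟩
  exact ⟨q', ps', L', b1, b2, b3, b4, a4.trans (b5.mono (by decide))⟩

/-- Reversals move the flags, so the numbers of edges are compared through degree sums. Every link
adds two and the cut removes two, so both kinds of move add two in total, that is, one edge. -/
theorem runs_applyCmd (hW : 2 * n + M + 5 ≤ W) (hA : Agreement n M a eu ev)
    (hm : Mem n M N eu ev q ps L s) (hP : Packing n N a q ps L)
    (hg : s.var 9 ≠ 0 → GoodMove n a q ps L (blockCol ps L) (s.var 10) (s.var 11) (s.var 12)
        (s.var 13) (s.var 14) (s.var 9)) :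
    Runs W applyCmd s (700 * (N + 1)) (fun s' => ∃ q' ps' L',
      Mem n M N eu ev q' ps' L' s' ∧ Packing n N a q' ps' L' ∧
      ((s.var 9 = 0 ∧ s'.var 16 = 0 ∧ q' = q ∧ ps' = ps ∧ L' = L) ∨
        (s'.var 16 = s.var 16 ∧
          ∑ i ∈ Finset.range n, L' i = ∑ i ∈ Finset.range n, L i + 1))) := by
  have hW1 : 1 < W := by omega
  have hNn := hP.N_le
  have hC := hP.colored_blockCol
  refine (Runs.cond (T := 680 * (N + 1)) hW1 (by simp) (fun hv => ?_) fun hv => ?_).mono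
    (by have : (Expr.var 9).cost = 1 := rfl; omega) fun _ h => h
  · rcases hg hv with ⟨h9, hl⟩ | ⟨h9, hL, hl2, hl1⟩
    · have step : Runs W (.cond (.bin .eq (.var 9) (.const 2))
          (.seq (.put 6 (.var 14) (.const 0)) (.seq (.seq (.assign 19 (.var 12))
            (.assign 20 (.var 13))) linkCmd)) .nop) s 5 (fun s' => s' = s) := by
        refine (Runs.cond (T := 1) hW1 (e := .bin .eq (.var 9) (.const 2)) ?_ (fun h => ?_)
          fun _ => ?_).mono (le_of_eq rfl) fun _ h => h
        · simp; omega
        · simp [h9] at h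
        · exact Runs.of_wp hW1 rfl
      refine (step.seq (T' := 310 * (N + 1)) fun s1 h1 => ?_).mono (by omega) fun _ h => h
      subst h1
      refine (runs_linkVars hW hA hm hP hC (fun _ _ => rfl) (by decide) hl).mono
        le_rfl ?_
      rintro s' ⟨q', ps', L', b1, b2, b3, b4, b5⟩
      refine ⟨q', ps', L', b1, b2, Or.inr ⟨b5 16 (by decide), ?_⟩⟩
      have e1 := b2.sum_deg
      have e2 := hP.sum_deg
      rw [Finset.sum_congr rfl fun x hx => b4 x (Finset.mem_range.1 hx),
        sum_linkDeg (hA.lt hl.adj) (hA.lt (hA.symm hl.adj))] at e1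
      omega
    · have hin : s.var 14 < n := (hP.L_lt hL).trans_le hNn
      have hput : Runs W (.put 6 (.var 14) (.const 0)) s 3 (fun s' =>
          Mem n M N eu ev q ps (Function.update L (s.var 14) 0) s' ∧ s'.var = s.var) := by
        refine Runs.of_wp_le hW1 (by decide) ?_
        simp only [wp_put, fits_var, fits_const, val_var, val_const, true_and]
        obtain ⟨m1, m2, m3, m4, m5, m6, m7, m8⟩ := hm
        exact ⟨by omega, ⟨m1, m2, m3, by simpa using m4, by simpa using m5, by simpa using m6,
          by simpa using m7, by simp [m8]⟩, rfl⟩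
      have step : Runs W (.cond (.bin .eq (.var 9) (.const 2))
          (.seq (.put 6 (.var 14) (.const 0)) (.seq (.seq (.assign 19 (.var 12))
            (.assign 20 (.var 13))) linkCmd)) .nop) s (320 * (N + 1)) (fun s' => ∃ q' ps' L',
            Mem n M N eu ev q' ps' L' s' ∧ Packing n N a q' ps' L' ∧
            Colored n q' L' (linkCol (cutCol n q ps (blockCol ps L) (s.var 14)) (s.var 12)
              (s.var 13)) ∧
            (∀ z < n, deg ps' L' z = linkDeg (deg ps (Function.update L (s.var 14) 0)) (s.var 12)
              (s.var 13) z) ∧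
            SameVars [19, 20, 21, 22, 23] s s') := by
        refine (Runs.cond (T := 3 + 310 * (N + 1)) hW1 (e := .bin .eq (.var 9) (.const 2)) ?_
          (fun _ => ?_) fun h => ?_).mono (T := 4 + (3 + 310 * (N + 1))) (by omega) fun _ h => h
        · simp; omega
        · refine hput.seq fun s1 ⟨c1, c2⟩ => ?_
          have := runs_linkVars (x := 12) (y := 13) hW hA c1 (hP.cut _)
            (hP.colored_cut hC (fun z hz => hP.blockCol_lt hz) hL) (fun _ _ => rfl) (by decide)
            (by rw [c2]; exact hl2)
          rw [c2] at this
          refine this.mono le_rfl ?_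
          rintro s' ⟨q', ps', L', b1, b2, b3, b4, b5⟩
          exact ⟨q', ps', L', b1, b2, b3, b4, fun z hz => by rw [b5 z hz, c2]⟩
        · simp [h9] at h
      refine (step.seq (T' := 310 * (N + 1))
        fun s1 ⟨q1, ps1, L1, c1, c2, c3, c4, c5⟩ => ?_).mono (by omega) fun _ h => h
      have e10 : s1.var 10 = s.var 10 := c5 10 (by decide)
      have e11 : s1.var 11 = s.var 11 := c5 11 (by decide)
      have := runs_linkVars (x := 10) (y := 11) hW hA c1 c2 c3 c4 (by decide)
            (by rw [e10, e11]; exact hl1)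
      rw [e10, e11] at this
      refine this.mono le_rfl ?_
      rintro s' ⟨q', ps', L', b1, b2, b3, b4, b5⟩
      refine ⟨q', ps', L', b1, b2, Or.inr ⟨(b5 16 (by decide)).trans (c5 16 (by decide)), ?_⟩⟩
      have e1 := b2.sum_deg
      have e2 := hP.sum_deg
      have e3 : ∑ x ∈ Finset.range n, deg ps (Function.update L (s.var 14) 0) x + 2 =
          ∑ x ∈ Finset.range n, deg ps L x := by
        rw [← sum_linkDeg (hP.q_lt (show s.var 14 - 1 < n by omega)) (hP.q_lt hin)]
        exact Finset.sum_congr rfl fun x hx => hP.deg_cut hL (Finset.mem_range.1 hx)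
      rw [Finset.sum_congr rfl fun x hx => b4 x (Finset.mem_range.1 hx),
        sum_linkDeg (hA.lt hl1.adj) (hA.lt (hA.symm hl1.adj)),
        sum_linkDeg (hA.lt hl2.adj) (hA.lt (hA.symm hl2.adj))] at e1
      omega
  · refine Runs.of_wp_le hW1 (T := 680 * (N + 1)) (by show 2 ≤ _; omega) ?_
    simp only [wp_assign, fits_const, val_const]
    have hX : SameVars [16] s (s.setVar 16 0) := by
      intro z hz
      simp at hz
      simp [hz]
    exact ⟨by omega, q, ps, L, hm.of_sameVars hX (by decide) (by decide) (by decide)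
      fun _ _ => rfl, hP, Or.inl ⟨hv, by simp, rfl, rfl, rfl⟩⟩

/-- As long as the search continues, the packing has at least as many edges as rounds completed, and
it never has more than `N`. So there are at most `N + 1` rounds of cost `O(M)`, including the last,
unsuccessful one. -/
theorem runs_improveCmd (hW : 2 * n + M + 5 ≤ W) (hA : Agreement n M a eu ev)
    (hm : Mem n M N eu ev q ps L s) (hP : Packing n N a q ps L) (hNM : N ≤ M) :
    Runs W improveCmd s (1200 * ((M + 1) * (M + 1))) (fun s' => ∃ q' ps' L',
      Mem n M N eu ev q' ps' L' s' ∧ Packing n N a q' ps' L' ∧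
      Stuck n a q' ps' L' (blockCol ps' L')) := by
  have hW1 : 1 < W := by omega
  have hNn := hP.N_le
  have step : Runs W (.assign 16 (.const 1)) s 2 (fun s' => Mem n M N eu ev q ps L s' ∧
      s'.var 16 = 1) := by
    refine Runs.of_wp_le hW1 (by decide) ?_
    simp only [wp_assign, fits_const, val_const]
    have hX : SameVars [16] s (s.setVar 16 1) := by
      intro z hz
      simp at hz
      simp [hz]
    exact ⟨by omega, hm.of_sameVars hX (by decide) (by decide) (by decide) fun _ _ => rfl,
      by simp⟩
  have b0 : (N + 1) * (1 + 1 + 1100 * (M + 1)) ≤ (M + 1) * (1102 * (M + 1)) :=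
    Nat.mul_le_mul (by omega) (by omega)
  have b1 : (M + 1) * (1102 * (M + 1)) = 1102 * ((M + 1) * (M + 1)) := by ring
  have b3 : ∀ x y : ℕ, x ≤ y → x + 1 + 1 ≤ y + 2 := fun x y h => by omega
  have b2 : M + 1 ≤ (M + 1) * (M + 1) := Nat.le_mul_of_pos_left _ (by omega)
  refine (step.seq (T' := 1102 * ((M + 1) * (M + 1)) + 2) fun s1 ⟨h1, h16⟩ => Runs.loop_le hW1
    (fun k s' => ∃ q' ps' L', Mem n M N eu ev q' ps' L' s' ∧ Packing n N a q' ps' L' ∧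
      ((s'.var 16 ≠ 0 ∧ k ≤ ∑ i ∈ Finset.range n, L' i) ∨
        (s'.var 16 = 0 ∧ Stuck n a q' ps' L' (blockCol ps' L'))))
    (N + 1) (1100 * (M + 1)) 1 _ rfl (b3 _ _ (b0.trans_eq b1)) ?_ ?_ ?_ ?_).mono (by omega) fun _ h => h
  · rintro k s' -
    simp
  · rintro k s' ⟨q', ps', L', i1, i2, i3⟩ hv
    simp only [val_var] at hv
    obtain ⟨-, hk⟩ := i3.resolve_right fun h => hv h.1
    refine ⟨by have := i2.sum_L_le; omega, ?_⟩
    refine ((runs_searchCmd hW hA i2 hNM i1).seq (T' := 700 * (M + 1))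
      fun s2 ⟨c1, c2, c3, c4⟩ => ?_).mono (by omega) fun _ h => h
    refine (runs_applyCmd hW hA c1 i2 c3).mono (by omega) ?_
    rintro s3 ⟨q3, ps3, L3, d1, d2, d3⟩
    refine ⟨q3, ps3, L3, d1, d2, ?_⟩
    rcases d3 with ⟨r1, r2, rfl, rfl, rfl⟩ | ⟨r1, r2⟩
    · exact Or.inr ⟨r2, c4 r1⟩
    · refine Or.inl ⟨?_, by omega⟩
      rw [r1, c2 16 (by decide)]
      exact hv
  · exact ⟨q, ps, L, h1, hP, Or.inl ⟨by omega, by omega⟩⟩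
  · rintro k s' hk ⟨q', ps', L', i1, i2, i3⟩ hv
    simp only [val_var] at hv
    exact ⟨q', ps', L', i1, i2, (i3.resolve_left fun h => h.1 hv).2⟩

end FlowShop

/-! ### The first packing and the output -/

namespace FlowShop

open WordRAM Packing

/-- Lists both orientations of all edges in the arrays `10` and `11`. -/
def orientCmd : Cmd :=
  .seq (.loop (.bin .lt (.var 4) (.var 1))
    (.seq (.put 10 (.var 4) (.get 0 (.var 4))) (.seq (.put 11 (.var 4) (.get 1 (.var 4)))
      (.seq (.put 10 (.var 4 + .var 1) (.get 1 (.var 4)))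
        (.seq (.put 11 (.var 4 + .var 1) (.get 0 (.var 4)))
          (.assign 4 (.var 4 + .const 1)))))))
    (.seq (.assign 1 (.var 1 + .var 1)) (.assign 4 (.const 0)))

/-- Appends the job in variable `5` to the sequence unless it occurs already. -/
def registerCmd : Cmd :=
  .cond (.get 5 (.var 5)) .nop
    (.seq (.put 4 (.var 3) (.var 5)) (.seq (.assign 3 (.var 3 + .const 1))
      (.put 5 (.var 5) (.var 3))))

/-- Lists the jobs, first those that are ends of edges. -/
def sequenceCmd : Cmd :=
  .seq (.loop (.bin .lt (.var 4) (.var 1)) (.seq (.assign 5 (.get 10 (.var 4)))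
      (.seq registerCmd (.assign 4 (.var 4 + .const 1)))))
    (.seq (.seq (.assign 2 (.var 3)) (.assign 5 (.const 0)))
      (.loop (.bin .lt (.var 5) (.var 0)) (.seq registerCmd (.assign 5 (.var 5 + .const 1)))))

/-- Writes the starting times. -/
def outputCmd : Cmd :=
  .seq (.seq (.assign 4 (.const 0)) (.assign 24 (.const 0)))
    (.loop (.bin .lt (.var 4) (.var 0))
      (.seq (.cond (.get 6 (.var 4)) (.assign 24 (.var 24 + .const 1))
          (.assign 24 (.var 24 + .const 2)))
        (.seq (.put 2 (.get 4 (.var 4)) (.var 24 - .const 2))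
          (.seq (.put 3 (.get 4 (.var 4)) (.var 24 - .const 1))
            (.assign 4 (.var 4 + .const 1))))))

/-- The starting time on the first machine of the job at a position. -/
def startTime (L : ℕ → ℕ) : ℕ → ℕ
  | 0 => 0
  | i + 1 => startTime L i + if L (i + 1) = 0 then 2 else 1

/-- The first `k` positions hold different jobs, with positions `ps - 1`. -/
structure Listed (n : ℕ) (q ps : ℕ → ℕ) (k : ℕ) : Prop where
  q_lt : ∀ {i}, i < k → q i < n
  ps_q : ∀ {i}, i < k → ps (q i) = i + 1
  q_ps : ∀ {u}, u < n → ps u ≠ 0 → ps u ≤ k ∧ q (ps u - 1) = u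

/-- The array `ps` recovers the position of each listed job, so the listed jobs are different. -/
theorem Listed.le {n k : ℕ} {q ps : ℕ → ℕ} (h : Listed n q ps k) : k ≤ n := by
  have := Finset.card_le_card_of_injOn (s := Finset.range k) (t := Finset.range n) q
    (fun i hi => by
      simp only [Finset.coe_range, Set.mem_Iio] at hi ⊢
      exact h.q_lt hi)
    (fun i hi j hj hij => by
      simp only [Finset.coe_range, Set.mem_Iio] at hi hj
      have h1 := h.ps_q hi
      have h2 := h.ps_q hj
      rw [hij] at h1
      omega)
  simpa using this

theorem Listed.push {n k u : ℕ} {q ps : ℕ → ℕ} (h : Listed n q ps k) (hu : u < n)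
    (h0 : ps u = 0) :
    Listed n (Function.update q k u) (Function.update ps u (k + 1)) (k + 1) := by
  constructor
  · intro i hi
    by_cases hik : i = k
    · rw [hik, Function.update_self]; exact hu
    · rw [Function.update_of_ne hik]; exact h.q_lt (by omega)
  · intro i hi
    by_cases hik : i = k
    · rw [hik, Function.update_self, Function.update_self]
    · have h1 := h.ps_q (i := i) (by omega)
      rw [Function.update_of_ne hik, Function.update_of_ne ?_, h1]
      intro h2
      rw [h2] at h1
      omega
  · intro v hv hne
    by_cases hvu : v = u
    · subst hvu; simp
    · rw [Function.update_of_ne hvu] at hne ⊢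
      obtain ⟨h1, h2⟩ := h.q_ps hv hne
      refine ⟨by omega, ?_⟩
      rw [Function.update_of_ne (by omega), h2]

variable {n m M N W : ℕ} {a : ℕ → ℕ → Prop} {eu ev q ps L : ℕ → ℕ} {s : State}

theorem startTime_le (L : ℕ → ℕ) (i : ℕ) : startTime L i ≤ 2 * i := by
  induction i with
  | zero => exact le_rfl
  | succ i ih => rw [startTime]; split_ifs <;> omega

/-- The reversed copy of the edge `e` gets the number `e + m`, so later passes see `M = 2m` oriented
edges. -/
theorem runs_orientCmd (hW : 2 * n + 2 * m + 5 ≤ W) (h1 : s.var 1 = m) (h4 : s.var 4 = 0) :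
    Runs W orientCmd s (40 * (m + 1)) (fun s' => SameVars [1, 4] s s' ∧ s'.var 1 = m + m ∧
      s'.var 4 = 0 ∧ (∀ x, x ≠ 10 → x ≠ 11 → s'.arr x = s.arr x) ∧
      ∀ e < m, s'.arr 10 e = s.arr 0 e ∧ s'.arr 11 e = s.arr 1 e ∧
        s'.arr 10 (e + m) = s.arr 1 e ∧ s'.arr 11 (e + m) = s.arr 0 e) := by
  have hW1 : 1 < W := by omega
  refine (Runs.seq (T := 34 * m + 4) (T' := 6) (R := fun s' => SameVars [1, 4] s s' ∧
      s'.var 1 = m ∧ (∀ x, x ≠ 10 → x ≠ 11 → s'.arr x = s.arr x) ∧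
      ∀ e < m, s'.arr 10 e = s.arr 0 e ∧ s'.arr 11 e = s.arr 1 e ∧
        s'.arr 10 (e + m) = s.arr 1 e ∧ s'.arr 11 (e + m) = s.arr 0 e) ?_ ?_).mono (by omega)
    fun _ h => h
  · refine Runs.loop_le hW1 (fun k s' => SameVars [1, 4] s s' ∧ s'.var 1 = m ∧ s'.var 4 = k ∧
      k ≤ m ∧ (∀ x, x ≠ 10 → x ≠ 11 → s'.arr x = s.arr x) ∧
      ∀ e < k, s'.arr 10 e = s.arr 0 e ∧ s'.arr 11 e = s.arr 1 e ∧
        s'.arr 10 (e + m) = s.arr 1 e ∧ s'.arr 11 (e + m) = s.arr 0 e) m 30 3 _ rfl (by omega)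
      ?_ ?_ ?_ ?_
    · rintro k s' -
      simp
    · rintro k s' ⟨i1, i2, i3, i4, i5, i6⟩ hv
      simp [i2, i3] at hv
      refine ⟨hv, Runs.of_wp_le hW1 (by decide) ?_⟩
      have a0 := i5 0 (by decide) (by decide)
      have a1 := i5 1 (by decide) (by decide)
      simp only [wp_seq, wp_put, wp_assign, fits_var, fits_get, fits_add, fits_const, val_var,
        val_get, val_add, val_const, setArr_var, setArr_arr, setVar_var, setVar_arr, i2, i3, a0, a1,
        true_and, Nat.reduceEqDiff, if_true, if_false, OfNat.zero_ne_ofNat, OfNat.one_ne_ofNat]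
      refine ⟨by omega, by omega, ⟨by omega, by omega⟩, fun x hx => ?_, hv,
        fun x x1 x2 => by simp [x1, x2, i5 x x1 x2], fun e he => ?_⟩
      · have := i1 x hx
        simp at hx
        simp [hx, this]
      · by_cases hek : e = k
        · subst hek
          simp [show m ≠ 0 by omega]
        · have := i6 e (by omega)
          simp [hek, show ¬ (e = k + m) by omega,
            show ¬ (e + m = k) by omega, this]
    · exact ⟨fun _ _ => rfl, h1, h4, by omega, fun _ _ _ => rfl, fun e he => by omega⟩
    · rintro k s' hk ⟨i1, i2, i3, i4, i5, i6⟩ hv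
      simp [i2, i3] at hv
      exact ⟨i1, i2, i5, fun e he => i6 e (by omega)⟩
  · rintro s' ⟨i1, i2, i3, i4⟩
    refine Runs.of_wp_le hW1 (by decide) ?_
    simp only [wp_seq, wp_assign, fits_var, fits_add, fits_const, val_var, val_add, val_const,
      setVar_arr, setVar_var, i2, true_and]
    refine ⟨by omega, by omega, fun x hx => ?_, by simp, by simp, i3, i4⟩
    have := i1 x hx
    simp at hx
    simp [hx, this]

theorem wp_registerCmd (hW : 2 * n + M + 5 ≤ W) {k u : ℕ} (h3 : s.var 3 = k) (h5 : s.var 5 = u)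
    (hL : Listed n (s.arr 4) (s.arr 5) k) (hu : u < n) {Q : State → Prop}
    (hQ : ∀ s' k', SameVars [3] s s' → s'.var 3 = k' → Listed n (s'.arr 4) (s'.arr 5) k' →
      k ≤ k' → k' ≤ k + 1 → s'.arr 5 u ≠ 0 → (∀ v, s.arr 5 v ≠ 0 → s'.arr 5 v = s.arr 5 v) →
      (∀ x, x ≠ 4 → x ≠ 5 → s'.arr x = s.arr x) → Q s') :
    wp W registerCmd Q s := by
  have hkn := hL.le
  simp only [registerCmd, wp_cond, wp_seq, wp_put, wp_assign, wp_nop, fits_get, fits_var, fits_add,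
    fits_const, val_get, val_var, val_add, val_const, setArr_var, setVar_var, Nat.reduceEqDiff,
    if_true, if_false, h3, h5, true_and]
  refine ⟨fun h0 => hQ s k (fun _ _ => rfl) h3 hL le_rfl (by omega) h0 (fun _ _ => rfl)
    fun _ _ _ => rfl, fun h0 => ⟨⟨by omega, by omega⟩, ?_⟩⟩
  refine hQ _ (k + 1) (fun x hx => ?_) (by simp) ?_ (by omega) le_rfl (by simp) (fun v hv => ?_)
    fun x x1 x2 => by simp [x1, x2]
  · simp at hx
    simp [hx]
  · simpa using hL.push hu h0
  · have : v ≠ u := by rintro rfl; exact hv h0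
    simp [this]

/-- The value `0` in `ps` means not yet listed, which is why positions are stored plus one. Every
job with a neighbour is the source of an oriented edge, so the first loop lists all of them, at most
one per edge; hence `N ≤ M`. The second loop appends the isolated jobs without moving the others. -/
theorem runs_sequenceCmd (hW : 2 * n + M + 5 ≤ W) (hA : Agreement n M a (s.arr 10) (s.arr 11))
    (h0 : s.var 0 = n) (h1 : s.var 1 = M) (h3 : s.var 3 = 0) (h4 : s.var 4 = 0)
    (a5 : ∀ i, s.arr 5 i = 0) (a6 : ∀ i, s.arr 6 i = 0) :
    Runs W sequenceCmd s (50 * (n + M + 1)) (fun s' => ∃ N q ps L, N ≤ M ∧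
      Mem n M N (s.arr 10) (s.arr 11) q ps L s' ∧ Packing n N a q ps L) := by
  have hW1 : 1 < W := by omega
  have step1 : Runs W (.loop (.bin .lt (.var 4) (.var 1)) (.seq (.assign 5 (.get 10 (.var 4)))
      (.seq registerCmd (.assign 4 (.var 4 + .const 1))))) s (30 * M + 4) (fun s' =>
      SameVars [3, 4, 5] s s' ∧ Listed n (s'.arr 4) (s'.arr 5) (s'.var 3) ∧ s'.var 3 ≤ M ∧
      (∀ e < M, s'.arr 5 (s.arr 10 e) ≠ 0) ∧ ∀ x, x ≠ 4 → x ≠ 5 → s'.arr x = s.arr x) := by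
    refine Runs.loop_le hW1 (fun k s' => SameVars [3, 4, 5] s s' ∧
      Listed n (s'.arr 4) (s'.arr 5) (s'.var 3) ∧ s'.var 3 ≤ k ∧ s'.var 4 = k ∧ k ≤ M ∧
      (∀ e < k, s'.arr 5 (s.arr 10 e) ≠ 0) ∧ ∀ x, x ≠ 4 → x ≠ 5 → s'.arr x = s.arr x)
      M 26 3 _ rfl (by omega) ?_ ?_ ?_ ?_
    · rintro k s' -
      simp
    · rintro k s' ⟨i1, i2, i3, i4, i5, i6, i7⟩ hv
      simp [i4, i1 1 (by decide), h1] at hv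
      refine ⟨hv, Runs.of_wp_le hW1 (by decide) ?_⟩
      have a10 := i7 10 (by decide) (by decide)
      rw [wp_seq, wp_assign]
      refine ⟨trivial, ?_⟩
      rw [wp_seq, val_get, val_var, i4, a10]
      refine wp_registerCmd (s := s'.setVar 5 (s.arr 10 k)) (k := s'.var 3) (u := s.arr 10 k) hW
        (by rw [setVar_var, if_neg (by decide)]) (by rw [setVar_var, if_pos rfl]) i2
        (hA.lt (hA.edge hv)) fun s2 k' j1 j2 j3 j4 j5 j6 j7 j8 => ?_
      have e4 : s2.var 4 = k := by rw [j1 4 (by decide)]; simp [i4]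
      simp only [wp_assign, fits_add, fits_var, fits_const, val_add, val_var, val_const, e4,
        setVar_var, setVar_arr, Nat.reduceEqDiff, if_true, if_false, j2]
      refine ⟨⟨trivial, hW1, by omega⟩, fun x hx => ?_, j3, by omega, trivial, hv, fun e he => ?_,
        fun x x1 x2 => ?_⟩
      · have e1 := i1 x hx
        have e2 := j1 x (by simp at hx ⊢; omega)
        simp at hx
        simp [hx, e1, e2]
      · by_cases hek : e = k
        · subst hek; exact j6
        · have := i6 e (by omega)
          have e1 := j7 _ (by simpa using this)
          rw [e1]
          simpa using this
      · rw [j8 x x1 x2, setVar_arr, i7 x x1 x2]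
    · refine ⟨fun _ _ => rfl, ⟨fun hi => ?_, fun hi => ?_, fun _ h => (h (a5 _)).elim⟩, by omega, h4,
        by omega, fun e he => by omega, fun _ _ _ => rfl⟩ <;> omega
    · rintro k s' hk ⟨i1, i2, i3, i4, i5, i6, i7⟩ hv
      simp [i4, i1 1 (by decide), h1] at hv
      exact ⟨i1, i2, by omega, fun e he => i6 e (by omega), i7⟩
  refine (step1.seq (T' := 30 * n + 10) fun s1 ⟨b1, b2, b3, b4, b5⟩ => ?_).mono (by omega)
    fun _ h => h
  obtain ⟨N, hN⟩ : ∃ N, s1.var 3 = N := ⟨_, rfl⟩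
  rw [hN] at b2 b3
  have hNn := b2.le
  have step2 : Runs W (.seq (.assign 2 (.var 3)) (.assign 5 (.const 0))) s1 4 (fun s' =>
      s'.arr = s1.arr ∧ s'.var 0 = n ∧ s'.var 1 = M ∧ s'.var 2 = N ∧ s'.var 3 = N ∧
      s'.var 5 = 0) := by
    refine Runs.of_wp_le hW1 (by decide) ?_
    simp [hN, b1 0 (by decide), b1 1 (by decide), h0, h1]
    omega
  refine (step2.seq (T' := 25 * n + 4) fun s2 ⟨c1, c2, c3, c4, c5, c6⟩ => Runs.loop_le hW1
    (fun k s' => s'.var 0 = n ∧ s'.var 1 = M ∧ s'.var 2 = N ∧ s'.var 5 = k ∧ k ≤ n ∧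
      N ≤ s'.var 3 ∧ Listed n (s'.arr 4) (s'.arr 5) (s'.var 3) ∧
      (∀ u, s1.arr 5 u ≠ 0 → s'.arr 5 u = s1.arr 5 u) ∧ (∀ u < k, s'.arr 5 u ≠ 0) ∧
      ∀ x, x ≠ 4 → x ≠ 5 → s'.arr x = s.arr x) n 21 3 _ rfl (by omega) ?_ ?_ ?_ ?_).mono (by omega)
    fun _ h => h
  · rintro k s' -
    simp
  · rintro k s' ⟨i1, i2, i3, i4, i5, i6, i7, i8, i9, i10⟩ hv
    simp [i1, i4] at hv
    refine ⟨hv, Runs.of_wp_le hW1 (by decide) ?_⟩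
    rw [wp_seq]
    refine wp_registerCmd (k := s'.var 3) (u := k) hW rfl i4 i7 hv
      fun s3 k' j1 j2 j3 j4 j5 j6 j7 j8 => ?_
    have e5 : s3.var 5 = k := (j1 5 (by decide)).trans i4
    simp only [wp_assign, fits_add, fits_var, fits_const, val_add, val_var, val_const, e5,
      setVar_var, setVar_arr, Nat.reduceEqDiff, if_true, if_false, j2, OfNat.zero_ne_ofNat,
      OfNat.one_ne_ofNat]
    refine ⟨⟨trivial, hW1, by omega⟩, (j1 0 (by decide)).trans i1, (j1 1 (by decide)).trans i2,
      (j1 2 (by decide)).trans i3, trivial, hv, by omega, j3, fun u hu => ?_, fun u hu => ?_,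
      fun x x1 x2 => (j8 x x1 x2).trans (i10 x x1 x2)⟩
    · rw [j7 u (by rw [i8 u hu]; exact hu), i8 u hu]
    · by_cases huk : u = k
      · subst huk; exact j6
      · have := i9 u (by omega)
        rw [j7 u this]; exact this
  · refine ⟨c2, c3, c4, c6, by omega, by omega, ?_, fun u _ => by rw [c1], fun u hu => by omega,
      fun x x1 x2 => by rw [c1, b5 x x1 x2]⟩
    rw [c1, c5]; exact b2
  · rintro k s' hk ⟨i1, i2, i3, i4, i5, i6, i7, i8, i9, i10⟩ hv
    simp [i1, i4] at hv
    have hkn : k = n := by omega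
    subst hkn
    have hle := i7.le
    -- All `n` jobs are listed at different positions, so the list has length at least `n`.
    have hge : k ≤ s'.var 3 := by
      have := Finset.card_le_card_of_injOn (s := Finset.range k) (t := Finset.range (s'.var 3))
        (fun u => s'.arr 5 u - 1)
        (fun u hu => by
          simp only [Finset.coe_range, Set.mem_Iio] at hu ⊢
          have h1 := i9 u hu
          have h2 := (i7.q_ps hu h1).1
          omega)
        (fun u hu v hv huv => by
          simp only [Finset.coe_range, Set.mem_Iio] at hu hv huv
          rw [← (i7.q_ps hu (i9 u hu)).2, huv, (i7.q_ps hv (i9 v hv)).2])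
      simpa using this
    have hk3 : s'.var 3 = k := by omega
    rw [hk3] at i7
    have l0 : ∀ i, s'.arr 6 i = 0 := fun i => by rw [i10 6 (by decide) (by decide), a6]
    refine ⟨N, s'.arr 4, s'.arr 5, s'.arr 6, b3, ⟨i1, i2, i3, i10 10 (by decide) (by decide),
      i10 11 (by decide) (by decide), rfl, rfl, rfl⟩, ⟨i7.q_lt, i7.ps_q, fun hu => ?_,
      fun hu => (i7.q_ps hu (i9 _ hu)).1, fun hu => (i7.q_ps hu (i9 _ hu)).2, l0 0,
      fun i => by rw [l0]; omega, fun h => (h (l0 _)).elim, fun h => (h (l0 _)).elim,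
      fun huv => ?_, hNn⟩⟩
    · have := i9 _ hu
      omega
    · obtain ⟨e, he, rfl, -⟩ := hA.exists_edge huv
      have h1 := b4 e he
      rw [i8 _ h1]
      exact (b2.q_ps (hA.lt huv) h1).1

/-- Variable `24` is the completion time of the preceding job on the second machine, and `0` at the
start. Since `L 0 = 0`, the first round raises it to `2`, which gives the starting time `0`. -/
theorem runs_outputCmd (hW : 2 * n + M + 5 ≤ W) (hm : Mem n M N eu ev q ps L s)
    (hP : Packing n N a q ps L) :
    Runs W outputCmd s (40 * (n + 1)) (fun s' => ∀ i < n,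
      s'.arr 2 (q i) = startTime L i ∧ s'.arr 3 (q i) = startTime L i + 1) := by
  have hW1 : 1 < W := by omega
  have step : Runs W (.seq (.assign 4 (.const 0)) (.assign 24 (.const 0))) s 4 (fun s' =>
      s'.var 0 = n ∧ s'.arr 4 = q ∧ s'.arr 6 = L ∧ s'.var 4 = 0 ∧ s'.var 24 = 0) := by
    refine Runs.of_wp_le hW1 (by decide) ?_
    simp [hm.var_n, hm.arr_q, hm.arr_L]
    omega
  refine (step.seq (T' := 36 * n + 4) fun s1 h1 => Runs.loop_le hW1 (fun k s' =>
    s'.var 0 = n ∧ s'.arr 4 = q ∧ s'.arr 6 = L ∧ s'.var 4 = k ∧ k ≤ n ∧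
    (s'.var 24 = if k = 0 then 0 else startTime L (k - 1) + 2) ∧
    ∀ i < k, s'.arr 2 (q i) = startTime L i ∧ s'.arr 3 (q i) = startTime L i + 1)
    n 32 3 _ rfl (by omega) ?_ ?_ ?_ ?_).mono (by omega) fun _ h => h
  · rintro k s' -
    simp
  · rintro k s' ⟨i1, i2, i3, i4, i5, i6, i7⟩ hv
    simp [i1, i4] at hv
    refine ⟨hv, Runs.of_wp_le hW1 (by decide) ?_⟩
    have hT := startTime_le L k
    have ht : s'.var 24 + (if L k = 0 then 2 else 1) = startTime L k + 2 := by
      rw [i6]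
      cases k with
      | zero => simp [hP.L_zero, startTime]
      | succ j => simp [startTime]; omega
    have tail : ∀ s2 : State, s2.arr = s'.arr → s2.var 0 = n → s2.var 4 = k →
        s2.var 24 = startTime L k + 2 →
        wp W (.seq (.put 2 (.get 4 (.var 4)) (.var 24 - .const 2))
          (.seq (.put 3 (.get 4 (.var 4)) (.var 24 - .const 1))
            (.assign 4 (.var 4 + .const 1)))) (fun s' =>
          s'.var 0 = n ∧ s'.arr 4 = q ∧ s'.arr 6 = L ∧ s'.var 4 = k + 1 ∧ k + 1 ≤ n ∧
          (s'.var 24 = if k + 1 = 0 then 0 else startTime L (k + 1 - 1) + 2) ∧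
          ∀ i < k + 1, s'.arr 2 (q i) = startTime L i ∧ s'.arr 3 (q i) = startTime L i + 1) s2 := by
      intro s2 j1 j2 j3 j4
      simp [j1, j2, j3, j4, i2, i3]
      refine ⟨by omega, by omega, ⟨by omega, by omega⟩, by omega, fun i hi => ?_⟩
      by_cases hik : i = k
      · subst hik; simp
      · have hne : q i ≠ q k := fun h => hik (hP.q_inj (by omega) hv h)
        simp [Function.update_of_ne hne, i7 i (by omega)]
    rw [wp_seq, wp_cond]
    simp only [fits_get, fits_var, val_get, val_var, wp_assign, fits_add, fits_const, val_add,
      val_const, i3, i4, true_and]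
    refine ⟨fun h => ⟨⟨by omega, ?_⟩, tail _ rfl ?_ ?_ ?_⟩,
      fun h => ⟨⟨by omega, ?_⟩, tail _ rfl ?_ ?_ ?_⟩⟩
    · rw [if_neg h] at ht; omega
    · simp [i1]
    · simp [i4]
    · rw [if_neg h] at ht; simp [ht]
    · rw [if_pos h] at ht; omega
    · simp [i1]
    · simp [i4]
    · rw [if_pos h] at ht; simp [ht]
  · obtain ⟨k1, k2, k3, k4, k5⟩ := h1
    exact ⟨k1, k2, k3, k4, by omega, by simp [k5], fun i hi => by omega⟩
  · rintro k s' hk ⟨i1, i2, i3, i4, i5, i6, i7⟩ hv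
    simp [i1, i4] at hv
    exact fun i hi => i7 i (by omega)

end FlowShop

/-! ### The complete program -/

namespace FlowShop

open WordRAM Packing Finset

variable {n M N W : ℕ} {a : ℕ → ℕ → Prop} {eu ev q ps L : ℕ → ℕ} {s : State}

/-- A path packing without improving exchange has at least two thirds as many edges as a 2-matching
that is given by orientations `D` of its edges with in- and outdegrees at most one. -/
theorem card_twoMatching_le (hA : Agreement n M a eu ev) (hP : Packing n N a q ps L)
    (hS : Stuck n a q ps L (blockCol ps L)) {D : Fin n → Fin n → Prop} [DecidableRel D]
    (hD : ∀ j k, D j k → a j k) (hasymm : ∀ j k, D j k → ¬ D k j)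
    (hout : ∀ j k k', D j k → D j k' → k = k') (hin : ∀ j j' k, D j k → D j' k → j = j') :
    2 * #{p : Fin n × Fin n | D p.1 p.2} ≤ 3 * ∑ i ∈ range n, L i := by
  classical
  have hC := hP.colored_blockCol
  have hNn := hP.N_le
  let r : Fin n → Fin n := fun i => ⟨q i, hP.q_lt i.2⟩
  have hr : Function.Bijective r := by
    refine Finite.injective_iff_bijective.1 fun i j hij => Fin.ext (hP.q_inj i.2 j.2 ?_)
    exact congrArg Fin.val hij
  -- The underlying undirected graph of `D`, carried over from jobs to positions.
  let O : ℕ → ℕ → Prop := fun x y =>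
    ∃ (hx : x < n) (hy : y < n), D (r ⟨x, hx⟩) (r ⟨y, hy⟩) ∨ D (r ⟨y, hy⟩) (r ⟨x, hx⟩)
  have hOa : ∀ {x y}, O x y → a (q x) (q y) := by
    rintro x y ⟨hx, hy, h | h⟩
    · exact hD _ _ h
    · exact hA.symm (hD _ _ h)
  have hOn : ∀ {x y}, O x y → x < n := fun ⟨hx, _, _⟩ => hx
  have hOs : ∀ {x y}, O x y → O y x := fun ⟨hx, hy, h⟩ => ⟨hy, hx, h.symm⟩
  have hOn' : ∀ {x y}, O x y → y < n := fun h => hOn (hOs h)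
  -- Out- and in-neighbours are disjoint by `hasymm`, so the `O`-degree is the sum of the two. Over
  -- all positions the degrees therefore sum to twice the number of pairs.
  have hcount : ∀ x (hx : x < n), #{y ∈ range n | O x y} =
      #{y | D (r ⟨x, hx⟩) (r y)} + #{y | D (r y) (r ⟨x, hx⟩)} := by
    intro x hx
    rw [← card_union_of_disjoint]
    · refine (card_nbij' (fun y => y.1) (fun y => if h : y < n then ⟨y, h⟩ else ⟨x, hx⟩)
        ?_ ?_ ?_ ?_).symm
      · intro y hy
        simp only [coe_union, coe_filter, mem_univ, true_and, Set.mem_union, Set.mem_ofPred_eq] at hy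
        simp only [coe_filter, mem_range, Set.mem_ofPred_eq]
        exact ⟨y.2, hx, y.2, hy⟩
      · intro y hy
        simp only [coe_filter, mem_range, Set.mem_ofPred_eq] at hy
        obtain ⟨hyn, _, _, h⟩ := hy
        simpa [hyn] using h
      · intro y hy
        simp
      · intro y hy
        simp only [coe_filter, mem_range, Set.mem_ofPred_eq] at hy
        simp [hy.1]
    · rw [disjoint_left]
      intro y h1 h2
      simp only [mem_filter, mem_univ, true_and] at h1 h2
      exact hasymm _ _ h1 h2
  have key := two_thirds_of_stuck (n := n) (L := L) (c := fun i => blockCol ps L (q i)) (O := O)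
    hP.L_le hP.L_zero (fun i hi => hP.L_eq_zero (by omega))
    (fun i hi => hC.eq ((hP.L_lt hi).trans_le hNn) hi)
    (fun i i' j' h0 h1 h2 h3 => hC.ne h0 h1 h2 h3)
    (fun i j h => hOs h) (fun i h => hA.irrefl _ (hOa h)) (fun i j h => hOn h)
    (fun x => by
      by_cases hx : x < n
      · rw [hcount x hx]
        have h1 : #{y | D (r ⟨x, hx⟩) (r y)} ≤ 1 := card_le_one.2 fun y hy z hz => by
          simp only [mem_filter, mem_univ, true_and] at hy hz
          exact hr.1 (hout _ _ _ hy hz)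
        have h2 : #{y | D (r y) (r ⟨x, hx⟩)} ≤ 1 := card_le_one.2 fun y hy z hz => by
          simp only [mem_filter, mem_univ, true_and] at hy hz
          exact hr.1 (hin _ _ _ hy hz)
        omega
      · rw [filter_eq_empty_iff.2 fun y _ h => hx (hOn h)]
        simp)
    (fun i j h hd hc hd' => by
      rw [← hP.deg_q (hOn h)] at hd
      rw [← hP.deg_q (hOn' h)] at hd'
      exact hS.join ⟨hOa h, by omega, hc⟩ (by omega))
    (fun b x y hb hx hy hdx hdy hcx hcy => by
      rw [← hP.deg_q (hOn hx)] at hdx ⊢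
      rw [← hP.deg_q (hOn hy)] at hdy
      have cb := hC.eq ((hP.L_lt hb).trans_le hNn) hb
      have := hS.exchange hb ⟨hOa hx, by omega, by rw [cb]; exact hcx⟩
        ⟨hOa hy, by omega, hcy⟩
      exact ⟨hP.q_inj (hOn hx) (hOn hy) this.1, this.2⟩)
    (fun b x y hb hxb hc hL hx hy hdy hcy => by
      rw [← hP.deg_q (hOn hy)] at hdy
      have cb := hC.eq ((hP.L_lt hb).trans_le hNn) hb
      exact hS.rotate hb hxb hL hc (hOa hx) ⟨hOa hy, by omega, by rw [cb]; exact hcy⟩)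
    (fun b x y hb hxb hc hL hx hy hdy hcy => by
      rw [← hP.deg_q (hOn hy)] at hdy
      exact hS.rotate' hb (hOn hx) hxb hL hc (hOa hx) ⟨hOa hy, by omega, hcy⟩)
  have hsum : ∑ x ∈ range n, #{y ∈ range n | O x y} =
      ∑ x : Fin n, #{y | D (r x) (r y)} + ∑ x : Fin n, #{y | D (r y) (r x)} := by
    rw [← sum_add_distrib, Finset.sum_range]
    exact sum_congr rfl fun x _ => hcount x x.2
  have hpairs : ∑ x : Fin n, #{y | D (r x) (r y)} = #{p : Fin n × Fin n | D p.1 p.2} := by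
    simp only [card_filter]
    rw [← univ_product_univ, sum_product]
    rw [hr.sum_comp fun x => ∑ y, if D x (r y) then 1 else 0]
    exact sum_congr rfl fun x _ => hr.sum_comp fun y => if D x y then 1 else 0
  have hswap : ∑ x : Fin n, #{y | D (r y) (r x)} = ∑ x : Fin n, #{y | D (r x) (r y)} := by
    simp only [card_filter]
    exact sum_comm
  omega

/-- Every link saves one unit compared with jobs spaced two units apart. -/
theorem startTime_add (hL : ∀ i, L i ≤ 1) (hL0 : L 0 = 0) (i : ℕ) :
    startTime L i + ∑ j ∈ range (i + 1), L j = 2 * i := by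
  induction i with
  | zero => simp [startTime, hL0]
  | succ i ih =>
    rw [startTime, sum_range_succ]
    have := hL (i + 1)
    split_ifs <;> omega

/-- The complete program. -/
def flowShopCmd : Cmd := .seq orientCmd (.seq sequenceCmd (.seq improveCmd outputCmd))

theorem runs_flowShopCmd {n : ℕ} {G : SimpleGraph (Fin n)} {l : List (Fin n × Fin n)}
    (hl : ListsEdges Gᶜ l) (hW : 2 * n + 2 * l.length + 5 ≤ W) :
    Runs W flowShopCmd (inputState l)
      (40 * (l.length + 1) + (50 * (n + 2 * l.length + 1) +
        (1200 * ((2 * l.length + 1) * (2 * l.length + 1)) + 40 * (n + 1))))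
      (fun s => (outputSchedule n s).Feasible G ∧
        ∀ σ : Schedule (Fin n), σ.Feasible G →
          (outputSchedule n s).makespan ≤ 4 / 3 * σ.makespan) := by
  set m := l.length with hm
  let a : ℕ → ℕ → Prop := fun u v => ∃ (hu : u < n) (hv : v < n), Gᶜ.Adj ⟨u, hu⟩ ⟨v, hv⟩
  have ha : ∀ {e} (he : e < m), a ((inputState l).arr 0 e) ((inputState l).arr 1 e) := by
    intro e he
    rw [hm] at he
    have h0 : (inputState l).arr 0 e = (l[e]).1 := by
      simp [inputState, List.getD_eq_getElem?_getD, he]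
    have h1 : (inputState l).arr 1 e = (l[e]).2 := by
      simp [inputState, List.getD_eq_getElem?_getD, he]
    rw [h0, h1]
    exact ⟨(l[e]).1.2, (l[e]).2.2, (hl.adj_iff _ _).2 (Or.inl (List.getElem_mem he))⟩
  have hsymm : ∀ {u v}, a u v → a v u := fun ⟨hu, hv, h⟩ => ⟨hv, hu, h.symm⟩
  have hv1 : (inputState l).var 1 = m := by simp [inputState, hm]
  refine (runs_orientCmd hW hv1 (by simp [inputState])).seq fun s1 ⟨b1, b2, b3, b4, b5⟩ => ?_
  have hA : Agreement n (2 * m) a (s1.arr 10) (s1.arr 11) := by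
    refine ⟨hsymm, fun u ⟨hu, hv, h⟩ => h.ne rfl, fun ⟨hu, _, _⟩ => hu, fun {e} he => ?_,
      fun {u v} huv => ?_⟩
    · by_cases hem : e < m
      · rw [(b5 e hem).1, (b5 e hem).2.1]
        exact ha hem
      · obtain ⟨f, rfl⟩ : ∃ f, e = f + m := ⟨e - m, by omega⟩
        rw [(b5 f (by omega)).2.2.1, (b5 f (by omega)).2.2.2]
        exact hsymm (ha (by omega))
    · obtain ⟨hu, hv, h⟩ := huv
      have hget : ∀ {x y : Fin n}, (x, y) ∈ l → ∃ e < m, (inputState l).arr 0 e = x ∧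
          (inputState l).arr 1 e = y := by
        intro x y hxy
        obtain ⟨e, he, hxe⟩ := List.getElem_of_mem hxy
        refine ⟨e, he, ?_, ?_⟩ <;> simp [inputState, List.getD_eq_getElem?_getD, he, hxe]
      rcases (hl.adj_iff _ _).1 h with h | h
      · obtain ⟨e, he, e0, e1⟩ := hget h
        exact ⟨e, by omega, by rw [(b5 e he).1, e0], by rw [(b5 e he).2.1, e1]⟩
      · obtain ⟨e, he, e0, e1⟩ := hget h
        exact ⟨e + m, by omega, by rw [(b5 e he).2.2.1, e1], by rw [(b5 e he).2.2.2, e0]⟩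
  refine (runs_sequenceCmd hW hA ((b1 0 (by decide)).trans (by simp [inputState]))
    (b2.trans (two_mul m).symm) ((b1 3 (by decide)).trans (by simp [inputState])) b3
    (fun i => by rw [b4 5 (by decide) (by decide)]; simp [inputState])
    (fun i => by rw [b4 6 (by decide) (by decide)]; simp [inputState])).seq
    fun s2 ⟨N, q0, ps0, L0, c1, c2, c3⟩ => ?_
  refine (runs_improveCmd hW hA c2 c3 c1).seq fun s3 ⟨q, ps, L, d1, d2, d3⟩ => ?_
  refine (runs_outputCmd hW d1 d2).mono le_rfl fun s hs => ⟨?_, fun σ hσ => ?_⟩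
  · let r : Fin n → Fin n := fun i => ⟨q i, d2.q_lt i.2⟩
    have hr : Function.Bijective r := by
      refine Finite.injective_iff_bijective.1 fun i j hij => Fin.ext (d2.q_inj i.2 j.2 ?_)
      exact congrArg Fin.val hij
    refine feasible_of_sequence hr (c := L) (T := startTime L) (fun i => rfl) (fun i => ?_)
      (fun i => ?_) fun i j hij hj => ?_
    · have := (hs i i.2).1
      simp [outputSchedule, r, this]
    · have := (hs i i.2).2
      simp [outputSchedule, r, this]
    · obtain ⟨_, _, h⟩ := d2.L_adj hj
      have : (⟨q (j.1 - 1), by assumption⟩ : Fin n) = r i := Fin.ext (by simp [r, ← hij])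
      rw [← this]
      exact h
  · classical
    obtain ⟨D, hD, hasymm, hout, hin, hcard⟩ := hσ.exists_twoMatching
    have h1 := hcard
    have h2 := card_twoMatching_le hA d2 d3 (fun j k h => ⟨j.2, k.2, hD j k h⟩) hasymm hout hin
    set d := #{p : Fin n × Fin n | D p.1 p.2} with hd
    -- By `hout`, a pair is determined by its first job.
    have h3 : d ≤ n := by
      refine (card_le_card_of_injOn (fun p => p.1) (fun _ _ => mem_coe.2 (mem_univ _)) ?_).trans_eq
        (card_fin n)
      rintro ⟨x, y⟩ hp ⟨x', y'⟩ hp' hxx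
      simp only [coe_filter, mem_univ, true_and, Set.mem_ofPred_eq] at hp hp' hxx
      subst hxx
      rw [hout _ _ _ hp hp']
    have h4 : ∑ i ∈ range n, L i ≤ n := d2.sum_L_le.trans d2.N_le
    have h5 : (outputSchedule n s).makespan ≤ ((2 * n - ∑ i ∈ range n, L i : ℕ) : ℝ) := by
      refine makespan_le (Nat.cast_nonneg _) fun j => ?_
      have hpos := d2.ps_pos j.2
      have hle := d2.ps_le j.2
      have hj := (hs (ps j - 1) (by omega)).2
      rw [d2.q_ps j.2] at hj
      -- The links up to the job are accounted for by `startTime_add`. The later ones number at most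
      -- `n - ps j`, at most one per remaining position.
      have ht : startTime L (ps j - 1) + 2 + ∑ i ∈ range n, L i ≤ 2 * n := by
        have t1 := startTime_add d2.L_le d2.L_zero (ps j - 1)
        rw [Nat.sub_add_cancel hpos] at t1
        have t2 := sum_range_add_sum_Ico L hle
        have t3 : ∑ i ∈ Ico (ps j) n, L i ≤ n - ps j := by
          calc ∑ i ∈ Ico (ps j) n, L i ≤ ∑ i ∈ Ico (ps j) n, 1 := sum_le_sum fun i _ => d2.L_le i
            _ = n - ps j := by simp
        omega
      have : s.arr 3 j + 1 ≤ 2 * n - ∑ i ∈ range n, L i := by omega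
      simp only [outputSchedule]
      exact_mod_cast this
    rw [Nat.cast_sub (by omega)] at h5
    have h2' : (2 : ℝ) * d ≤ 3 * (∑ i ∈ range n, L i : ℕ) := by exact_mod_cast h2
    have h3' : (d : ℝ) ≤ n := by exact_mod_cast h3
    push_cast at h1 h5
    push_cast at h2'
    -- With `p` the number of links and `C` the makespan of `σ`, the facts `2n ≤ C + d`, `2d ≤ 3p`
    -- and `d ≤ n` give `2n - p ≤ 4/3 C`.
    linarith

end FlowShop

theorem theorem2p7 :
    ∃ (P : WordRAM.Cmd) (c w : ℕ),
      ∀ (n : ℕ) (G : SimpleGraph (Fin n)) (l : List (Fin n × Fin n)),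
        FlowShop.ListsEdges Gᶜ l →
        ∃ (t : ℕ) (s : WordRAM.State),
          WordRAM.Exec ((n + 2) ^ w) P (FlowShop.inputState l) t s ∧
          t ≤ c * (Gᶜ.edgeSet.ncard ^ 2 * Nat.log 2 n + n + 1) ∧
          (FlowShop.outputSchedule n s).Feasible G ∧
          ∀ σ : FlowShop.Schedule (Fin n), σ.Feasible G →
            (FlowShop.outputSchedule n s).makespan ≤ 4 / 3 * σ.makespan := by
  refine ⟨FlowShop.flowShopCmd, 20000, 4, fun n G l hl => ?_⟩
  have hm := hl.length_le
  -- The list has at most `n²` edges, and the program handles no value beyond `2n + 2m + 4`, so the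
  -- fourth power of `n + 2` is enough for the words.
  have hn4 : 2 * n + 2 * (n * n) + 5 ≤ (n + 2) ^ 4 := by ring_nf; nlinarith [sq_nonneg n]
  have hsmall : WordRAM.Small ((n + 2) ^ 4) (FlowShop.inputState l) := by
    constructor
    · intro x
      simp only [FlowShop.inputState]
      split_ifs <;> omega
    · intro b i
      have hval : ∀ f : Fin n × Fin n → Fin n, (l.map fun p => (f p : ℕ)).getD i 0 ≤ n := by
        intro f
        rw [List.getD_eq_getElem?_getD, List.getElem?_map]
        cases l[i]? with
        | none => simp
        | some p => exact (f p).2.le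
      have h1 := hval Prod.fst
      have h2 := hval Prod.snd
      simp only [FlowShop.inputState]
      split_ifs <;> omega
  obtain ⟨t, s, h1, h2, -, h3, h4⟩ := FlowShop.runs_flowShopCmd hl (by omega) hsmall
  refine ⟨t, s, h1, h2.trans ?_, h3, h4⟩
  rw [← hl.length_eq]
  -- Without edges the time is linear in `n`. With an edge, `n ≥ 2`, so the logarithm is at least
  -- one and `m²` is itself within the bound.
  rcases Nat.eq_zero_or_pos l.length with h0 | hpos
  · rw [h0]
    ring_nf
    omega
  · have hn2 : 2 ≤ n := by
      by_contra hlt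
      have : n = 0 ∨ n = 1 := by omega
      obtain ⟨p, hp⟩ := List.exists_mem_of_length_pos hpos
      have hadj := (hl.adj_iff p.1 p.2).2 (Or.inl hp)
      rcases this with rfl | rfl
      · exact p.1.elim0
      · exact hadj.ne (Subsingleton.elim _ _)
    have hlog : 1 ≤ Nat.log 2 n := Nat.log_pos (by norm_num) hn2
    have hsq : l.length ^ 2 ≤ l.length ^ 2 * Nat.log 2 n := Nat.le_mul_of_pos_right _ hlog
    nlinarith [hsq, Nat.le_self_pow two_ne_zero l.length]
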